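/- Let $k\in\mathbb Z$. Cover $\mathbb{CP}^1$ by the standard charts $U_0,U_1$ with coordinates $x$ and $y=1/x$. Let $\mathcal O$ be the structure sheaf of the split complex-analytic supermanifold of dimension $1|3$ over $\mathbb{CP}^1$ denoted $(k,k,k)$: it is glued from $\mathcal F_{U_0}\otimes\bigwedge(\xi_1,\xi_2,\xi_3)$ and $\mathcal F_{U_1}\otimes\bigwedge(\eta_1,\eta_2,\eta_3)$ ($\mathcal F$ the sheaf of holomorphic functions) over $U_0\cap U_1$ by $y=x^{-1}$, $\eta_i=x^{-k}\xi_i$. Let $\mathcal T_2$ be the sheaf of degree $2$ vector fields, i.e. of those $\mathbb C$-linear (even) derivations $v$ of $\mathcal O$ with $v(\mathcal O_q)\subset\mathcal O_{q+2}$ for all $q$, where $\mathcal O_q$ is the part of degree $q$ in the odd coordinates. For $\{i,j,l\}=\{1,2,3\}$ with $i<j$, let $\mathcal T_2^{ij}\subset\mathcal T_2$ be the locally free $\mathcal F$-submodule of rank $2$ with basis $\xi_i\xi_j\frac{\partial}{\partial x},\ \xi_i\xi_j\xi_l\frac{\partial}{\partial\xi_l}$ over $U_0$ and basis $\eta_i\eta_j\frac{\partial}{\partial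 y},\ \eta_i\eta_j\eta_l\frac{\partial}{\partial\eta_l}$ over $U_1$. Let $H^1(\mathbb{CP}^1,\cdot)$ be the first (Čech) cohomology, i.e. the direct limit of the first Čech cohomology over all open covers. 1. If $k\ge 2$, then for every $i<j$ and $l\ne i,j$ the classes of the following Čech $1$-cocycles of the cover $\{U_0,U_1\}$ (sections over $U_0\cap U_1$) form a basis of the complex vector space $H^1(\mathbb{CP}^1,\mathcal T_2^{ij})$: $$x^{-n}\xi_i\xi_j\frac{\partial}{\partial x}\quad(n=1,\dots,2k-3),\qquad x^{-n}\xi_i\xi_j\xi_l\frac{\partial}{\partial\xi_l}\quad(n=1,\dots,2k-1).$$ 2. If $k<2$, then $H^1(\mathbb{CP}^1,\mathcal T_2)=\{0\}$. -/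

import Mathlib

/-! ### First Čech cohomology of a presheaf of complex vector spaces -/

namespace Cech

open CategoryTheory Opposite TopologicalSpace

variable {X : TopCat.{0}} (F : TopCat.Presheaf (ModuleCat.{0} ℂ) X)

/-- Restriction of sections from `V` to a smaller open set `W`. -/
noncomputable def res {V W : Opens X} (h : W ≤ V) : F.obj (op V) →ₗ[ℂ] F.obj (op W) :=
  (F.map (homOfLE h).op).hom

theorem res_res {U V W : Opens X} (h : V ≤ U) (h' : W ≤ V) (s : F.obj (op U)) :
    res F h' (res F h s) = res F (h'.trans h) s := by
  have e : (homOfLE (h'.trans h)).op = (homOfLE h).op ≫ (homOfLE h').op := rfl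
  simp only [res, e, F.map_comp, ModuleCat.hom_comp, LinearMap.comp_apply]

/-- Čech 1-cocycles of a family `U` of open sets: families `c i j ∈ F (U i ∩ U j)` with
`c i j + c j m = c i m` on `U i ∩ U j ∩ U m`. -/
noncomputable def Z1 {ι : Type} (U : ι → Opens X) :
    Submodule ℂ (∀ i j, F.obj (op (U i ⊓ U j))) where
  carrier := {c | ∀ i j m,
    res F (W := U i ⊓ U j ⊓ U m) inf_le_left (c i j) +
      res F (W := U i ⊓ U j ⊓ U m) (inf_le_inf_right _ inf_le_right) (c j m) =
      res F (W := U i ⊓ U j ⊓ U m) (inf_le_inf_right _ inf_le_left) (c i m)}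
  zero_mem' := by intro i j m; simp
  add_mem' := by
    intro a b ha hb i j m
    simp only [Pi.add_apply, map_add]
    rw [← ha i j m, ← hb i j m]; abel
  smul_mem' := by
    intro r a ha i j m
    simp only [Pi.smul_apply, map_smul]
    rw [← ha i j m, smul_add]

/-- The Čech differential `(b i) ↦ (b j - b i on U i ∩ U j)`. -/
noncomputable def d0 {ι : Type} (U : ι → Opens X) : (∀ i, F.obj (op (U i))) →ₗ[ℂ] Z1 F U where
  toFun b := ⟨fun i j => res F inf_le_right (b j) - res F inf_le_left (b i), by
    intro i j m
    simp only [map_sub, res_res]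
    abel⟩
  map_add' a b := by
    ext i j
    simp only [Pi.add_apply, map_add, Submodule.coe_add]
    abel
  map_smul' r a := by
    ext i j
    simp only [Pi.smul_apply, map_smul, RingHom.id_apply, Submodule.coe_smul, smul_sub]

/-- `H¹(𝔘, F)` of a family `U` of open sets. -/
abbrev H1Cover {ι : Type} (U : ι → Opens X) : Type :=
  Z1 F U ⧸ LinearMap.range (d0 F U)

/-- Restriction of cocycles along a refinement `V a ⊆ U (r a)`. -/
noncomputable def refineZ1 {ι κ : Type} (U : ι → Opens X) (V : κ → Opens X) (r : κ → ι)
    (h : ∀ a, V a ≤ U (r a)) : Z1 F U →ₗ[ℂ] Z1 F V where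
  toFun c := ⟨fun a b => res F (inf_le_inf (h a) (h b)) (c.1 (r a) (r b)), by
    intro a b e
    have hc := congrArg
      (res F (W := V a ⊓ V b ⊓ V e) (inf_le_inf (inf_le_inf (h a) (h b)) (h e)))
      (c.2 (r a) (r b) (r e))
    simp only [map_add, res_res] at hc ⊢
    exact hc⟩
  map_add' a b := by
    ext i j
    simp only [Pi.add_apply, map_add, Submodule.coe_add]
  map_smul' r a := by
    ext i j
    simp only [Pi.smul_apply, map_smul, RingHom.id_apply, Submodule.coe_smul]

/-- The map `H¹(𝔘, F) → H¹(𝔙, F)` induced by a refinement. -/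
noncomputable def refineH1 {ι κ : Type} (U : ι → Opens X) (V : κ → Opens X) (r : κ → ι)
    (h : ∀ a, V a ≤ U (r a)) : H1Cover F U →ₗ[ℂ] H1Cover F V :=
  Submodule.mapQ _ _ (refineZ1 F U V r h) (by
    rintro _ ⟨b, rfl⟩
    refine ⟨fun a => res F (h a) (b (r a)), ?_⟩
    ext a e
    simp only [d0, refineZ1, LinearMap.coe_mk, AddHom.coe_mk, map_sub, res_res])

/-- Open covers of `X` indexed by the points of `X`, the point `x` lying in the `x`-th member.
Every open cover is refined by one of these. -/
structure PtCover (X : TopCat.{0}) : Type where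
  /-- The open set with index `x`. -/
  nhd : X → Opens X
  mem : ∀ x, x ∈ nhd x

/-- `𝔘 ≤ 𝔙` when `𝔙` is finer, i.e. `𝔙 x ⊆ 𝔘 x` for all `x`. -/
instance : Preorder (PtCover X) where
  le U V := ∀ x, V.nhd x ≤ U.nhd x
  le_refl _ _ := le_rfl
  le_trans _ _ _ h h' x := (h' x).trans (h x)

noncomputable instance : DecidableEq (PtCover X) := Classical.decEq _

/-- `H¹(X, F)`: the direct limit of `H¹(𝔘, F)` over the open covers of `X`. -/
abbrev H1 : Type :=
  Module.DirectLimit (fun U : PtCover X => H1Cover F U.nhd)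
    (fun U V h => refineH1 F U.nhd V.nhd id h)

/-- The class in `H¹(X, F)` of a 1-cocycle of an open cover `U : ι → Opens X`; here `r` chooses,
for each point, a member of the cover containing it (the class does not depend on `r`). -/
noncomputable def classOf {ι : Type} (U : ι → Opens X) (r : X → ι) (hr : ∀ x, x ∈ U (r x)) :
    Z1 F U →ₗ[ℂ] H1 F :=
  Module.DirectLimit.of ℂ (PtCover X) (fun U : PtCover X => H1Cover F U.nhd)
      (fun U V h => refineH1 F U.nhd V.nhd id h) ⟨fun x => U (r x), hr⟩ ∘ₗ
    Submodule.mkQ _ ∘ₗ refineZ1 F U (fun x => U (r x)) r (fun _ => le_rfl)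

end Cech

/-! ### The split supermanifold `(k,k,k)` over the Riemann sphere -/

namespace SuperP1

open CategoryTheory Opposite TopologicalSpace
open scoped OnePoint

/-- The Grassmann algebra with three generators. -/
abbrev Gr : Type := ExteriorAlgebra ℂ (Fin 3 → ℂ)

/-- The odd generators `ξ 0, ξ 1, ξ 2`. -/
noncomputable def ξ (i : Fin 3) : Gr := ExteriorAlgebra.ι ℂ (Pi.single i (1 : ℂ))

/-- The monomial basis of the Grassmann algebra. -/
noncomputable def monomials : Module.Basis (Finset (Fin 3)) ℂ Gr :=
  (Pi.basisFun ℂ (Fin 3)).ExteriorAlgebra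

/-- The coefficient of `f : Ω → Gr` at the monomial with index `S`, extended by zero to `ℂ`. -/
noncomputable def coeff {Ω : Set ℂ} (f : Ω → Gr) (S : Finset (Fin 3)) : ℂ → ℂ :=
  Function.extend Subtype.val (fun z => monomials.repr (f z) S) 0

theorem coeff_apply {Ω : Set ℂ} (f : Ω → Gr) (S : Finset (Fin 3)) (z : Ω) :
    coeff f S z = monomials.repr (f z) S :=
  Subtype.val_injective.extend_apply _ _ z

/-- `f` has holomorphic coefficients, i.e. is a superfunction on the open set `Ω`. -/
def IsHolo {Ω : Set ℂ} (f : Ω → Gr) : Prop :=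
  ∀ S, DifferentiableOn ℂ (coeff f S) Ω

theorem IsHolo.add {Ω : Set ℂ} {f g : Ω → Gr} (hf : IsHolo f) (hg : IsHolo g) :
    IsHolo (f + g) := fun S =>
  ((hf S).add (hg S)).congr fun z hz => by
    simp [coeff_apply _ _ ⟨z, hz⟩]

theorem IsHolo.const {Ω : Set ℂ} (c : Gr) : IsHolo (fun _ : Ω => c) := fun S =>
  (differentiableOn_const (monomials.repr c S)).congr fun z hz => by
    simp [coeff_apply _ _ ⟨z, hz⟩]

theorem IsHolo.mul {Ω : Set ℂ} {f g : Ω → Gr} (hf : IsHolo f) (hg : IsHolo g) :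
    IsHolo (f * g) := fun S => by
  have key : DifferentiableOn ℂ (fun z => ∑ A, ∑ B,
      coeff f A z * coeff g B z * monomials.repr (monomials A * monomials B) S) Ω :=
    DifferentiableOn.fun_sum fun A _ => DifferentiableOn.fun_sum fun B _ =>
      ((hf A).mul (hg B)).mul_const _
  refine key.congr fun z hz => ?_
  simp only [coeff_apply _ _ ⟨z, hz⟩, Pi.mul_apply]
  conv_lhs => rw [← monomials.sum_repr (f ⟨z, hz⟩), ← monomials.sum_repr (g ⟨z, hz⟩)]
  simp only [Finset.sum_mul_sum, map_sum, smul_mul_smul_comm, map_smul, Finsupp.finsetSum_apply,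
    Finsupp.smul_apply, smul_eq_mul]

/-- `∂f/∂x`: differentiate the coefficients. -/
noncomputable def dEven {Ω : Set ℂ} (f : Ω → Gr) (z : Ω) : Gr :=
  ∑ S, deriv (coeff f S) z • monomials S

/-- `∂/∂ξ_l`: the odd derivation of the Grassmann algebra with `ξ_m ↦ δ_{lm}`. -/
noncomputable def dOdd (l : Fin 3) : Gr →ₗ[ℂ] Gr :=
  CliffordAlgebra.contractLeft (LinearMap.proj l : (Fin 3 → ℂ) →ₗ[ℂ] ℂ)

/-- The vector field `a ξ_i ξ_j ∂/∂x + b ξ_i ξ_j ξ_l ∂/∂ξ_l` applied to the superfunction `f`. -/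
noncomputable def field (i j l : Fin 3) (a b : ℂ → ℂ) {Ω : Set ℂ} (f : Ω → Gr) (z : Ω) : Gr :=
  a z • (ξ i * ξ j * dEven f z) + b z • (ξ i * ξ j * ξ l * dOdd l (f z))

/-- The complex projective line, as the one-point compactification of `ℂ`. -/
noncomputable abbrev CP1 : TopCat.{0} := TopCat.of (OnePoint ℂ)

/-- The inverse of the coordinate `x`. -/
noncomputable def chart0 (x : ℂ) : CP1 := (x : OnePoint ℂ)

/-- The inverse of the coordinate `y = 1/x`. -/
noncomputable def chart1 (y : ℂ) : CP1 :=
  open Classical in if y = 0 then (∞ : OnePoint ℂ) else ((y⁻¹ : ℂ) : OnePoint ℂ)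

/-- The part of `V` in the first chart, in the coordinate `x`. -/
abbrev dom0 (V : Opens CP1) : Set ℂ := {x | chart0 x ∈ V}

/-- The part of `V` in the second chart, in the coordinate `y`. -/
abbrev dom1 (V : Opens CP1) : Set ℂ := {y | chart1 y ∈ V}

theorem inv_mem_dom0 {V : Opens CP1} {y : ℂ} (hy : y ∈ dom1 V) (h : y ≠ 0) : y⁻¹ ∈ dom0 V := by
  have : chart1 y = chart0 y⁻¹ := by simp [chart1, chart0, h]
  simpa [dom0, dom1, this] using hy

/-- The algebra automorphism `ξ_i ↦ c ξ_i` of the Grassmann algebra. -/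
noncomputable def rescale (c : ℂ) : Gr →ₐ[ℂ] Gr :=
  ExteriorAlgebra.map (c • LinearMap.id)

/-- The structure sheaf of the split supermanifold `(k,k,k)`: a section over `V` is a
superfunction in `(x, ξ)` on `V ∩ U₀` together with a superfunction in `(y, η)` on `V ∩ U₁`
(`η_i` being written as the `i`-th generator) which agree under `y = x⁻¹`, `η_i = x^{-k} ξ_i`,
that is `ξ_i = y^{-k} η_i`. -/
noncomputable def O (k : ℤ) (V : Opens CP1) : Subalgebra ℂ ((dom0 V → Gr) × (dom1 V → Gr)) where
  carrier := {s | IsHolo s.1 ∧ IsHolo s.2 ∧ ∀ (y : dom1 V) (h : (y : ℂ) ≠ 0),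
    s.2 y = rescale ((y : ℂ) ^ (-k)) (s.1 ⟨(y : ℂ)⁻¹, inv_mem_dom0 y.2 h⟩)}
  mul_mem' := by
    rintro s t ⟨h0, h1, h⟩ ⟨h0', h1', h'⟩
    exact ⟨h0.mul h0', h1.mul h1', fun y hy => by simp [h y hy, h' y hy]⟩
  add_mem' := by
    rintro s t ⟨h0, h1, h⟩ ⟨h0', h1', h'⟩
    exact ⟨h0.add h0', h1.add h1', fun y hy => by simp [h y hy, h' y hy]⟩
  algebraMap_mem' := by
    intro c
    exact ⟨IsHolo.const (algebraMap ℂ Gr c), IsHolo.const (algebraMap ℂ Gr c), fun y hy => by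
      simp [Prod.algebraMap_apply, Pi.algebraMap_apply]⟩

/-- The algebra of sections over `V` of the structure sheaf. -/
def Sec (k : ℤ) (V : Opens CP1) : Type := O k V

noncomputable instance (k : ℤ) (V : Opens CP1) : Ring (Sec k V) :=
  inferInstanceAs (Ring (O k V))

noncomputable instance (k : ℤ) (V : Opens CP1) : Algebra ℂ (Sec k V) :=
  inferInstanceAs (Algebra ℂ (O k V))

/-- A section as a superfunction in `(x, ξ)`. -/
def Sec.f0 {k : ℤ} {V : Opens CP1} (s : Sec k V) : dom0 V → Gr := (show O k V from s).1.1

/-- A section as a superfunction in `(y, η)`. -/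
def Sec.f1 {k : ℤ} {V : Opens CP1} (s : Sec k V) : dom1 V → Gr := (show O k V from s).1.2

theorem IsHolo.restrict {Ω Ω' : Set ℂ} (h : Ω' ⊆ Ω) {f : Ω → Gr} (hf : IsHolo f) :
    IsHolo (fun z : Ω' => f ⟨z, h z.2⟩) := fun S =>
  ((hf S).mono h).congr fun z hz => by
    rw [coeff_apply _ _ ⟨z, hz⟩, coeff_apply f S ⟨z, h hz⟩]

/-- Restriction of sections of the structure sheaf. -/
noncomputable def resO (k : ℤ) {V W : Opens CP1} (h : W ≤ V) : Sec k V →ₗ[ℂ] Sec k W where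
  toFun s := ⟨(fun z => s.f0 ⟨z, h z.2⟩, fun z => s.f1 ⟨z, h z.2⟩),
    IsHolo.restrict (fun _ hz => h hz) s.2.1, IsHolo.restrict (fun _ hz => h hz) s.2.2.1,
    fun y hy => s.2.2.2 ⟨y, h y.2⟩ hy⟩
  map_add' _ _ := rfl
  map_smul' _ _ := rfl

/-- A section is homogeneous of degree `q` when its values are. -/
def IsHomog {k : ℤ} {V : Opens CP1} (q : ℕ) (s : Sec k V) : Prop :=
  (∀ z, s.f0 z ∈ ⋀[ℂ]^q (Fin 3 → ℂ)) ∧ ∀ z, s.f1 z ∈ ⋀[ℂ]^q (Fin 3 → ℂ)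

/-- Sections over `V` of the degree 2 part of the tangent sheaf: derivations of the sheaf
`O|_V` (compatible families of maps on the sections over all `W ⊆ V`) that raise the degree
by 2. Such derivations are even, so the sign in the graded Leibniz rule is trivial. -/
noncomputable def T2 (k : ℤ) (V : Opens CP1) :
    Submodule ℂ (∀ W : Set.Iic V, Sec k W.1 →ₗ[ℂ] Sec k W.1) where
  carrier := {D |
    (∀ W s t, D W (s * t) = D W s * t + s * D W t) ∧
    (∀ W W' (h : W'.1 ≤ W.1) s, resO k h (D W s) = D W' (resO k h s)) ∧
    (∀ W q s, IsHomog q s → IsHomog (q + 2) (D W s))}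
  zero_mem' := ⟨by simp, by simp, fun W q s _ => ⟨fun z => Submodule.zero_mem _,
    fun z => Submodule.zero_mem _⟩⟩
  add_mem' := by
    rintro D E ⟨hD, hD', hD''⟩ ⟨hE, hE', hE''⟩
    refine ⟨fun W s t => ?_, fun W W' h s => ?_, fun W q s hs => ⟨fun z => ?_, fun z => ?_⟩⟩
    · simp only [Pi.add_apply, LinearMap.add_apply, hD, hE, add_mul, mul_add]; abel
    · simp only [Pi.add_apply, LinearMap.add_apply, map_add, hD' W W' h, hE' W W' h]
    · exact Submodule.add_mem _ ((hD'' W q s hs).1 z) ((hE'' W q s hs).1 z)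
    · exact Submodule.add_mem _ ((hD'' W q s hs).2 z) ((hE'' W q s hs).2 z)
  smul_mem' := by
    rintro c D ⟨hD, hD', hD''⟩
    refine ⟨fun W s t => ?_, fun W W' h s => ?_, fun W q s hs => ⟨fun z => ?_, fun z => ?_⟩⟩
    · simp only [Pi.smul_apply, LinearMap.smul_apply, hD, smul_add, smul_mul_assoc,
        mul_smul_comm]
    · simp only [Pi.smul_apply, LinearMap.smul_apply, map_smul, hD' W W' h]
    · exact Submodule.smul_mem _ c ((hD'' W q s hs).1 z)
    · exact Submodule.smul_mem _ c ((hD'' W q s hs).2 z)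

/-- The vector space of degree 2 vector fields over `V`. -/
def VF (k : ℤ) (V : Opens CP1) : Type := T2 k V

noncomputable instance (k : ℤ) (V : Opens CP1) : AddCommGroup (VF k V) :=
  inferInstanceAs (AddCommGroup (T2 k V))

noncomputable instance (k : ℤ) (V : Opens CP1) : Module ℂ (VF k V) :=
  inferInstanceAs (Module ℂ (T2 k V))

/-- The action of a vector field over `V` on the sections over `W ⊆ V`. -/
noncomputable def VF.act {k : ℤ} {V : Opens CP1} (D : VF k V) {W : Opens CP1} (h : W ≤ V) :
    Sec k W →ₗ[ℂ] Sec k W :=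
  (show T2 k V from D).1 ⟨W, h⟩

/-- Restriction of vector fields. -/
noncomputable def resVF (k : ℤ) {V V' : Opens CP1} (h : V' ≤ V) : VF k V →ₗ[ℂ] VF k V' where
  toFun D := ⟨fun W => D.act (le_trans W.2 h),
    fun W => D.2.1 ⟨W.1, le_trans W.2 h⟩,
    fun W W' => D.2.2.1 ⟨W.1, le_trans W.2 h⟩ ⟨W'.1, le_trans W'.2 h⟩,
    fun W => D.2.2.2 ⟨W.1, le_trans W.2 h⟩⟩
  map_add' _ _ := rfl
  map_smul' _ _ := rfl

/-- In the coordinates `(x, ξ)`, `D` is the vector field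
`a(x) ξ_i ξ_j ∂/∂x + b(x) ξ_i ξ_j ξ_l ∂/∂ξ_l`. -/
def IsField0 (k : ℤ) (i j l : Fin 3) {V : Opens CP1} (D : VF k V) (a b : ℂ → ℂ) : Prop :=
  ∀ (W : Opens CP1) (h : W ≤ V) (s : Sec k W) z, (D.act h s).f0 z = field i j l a b s.f0 z

/-- In the coordinates `(y, η)`, `D` is the vector field
`a(y) η_i η_j ∂/∂y + b(y) η_i η_j η_l ∂/∂η_l`. -/
def IsField1 (k : ℤ) (i j l : Fin 3) {V : Opens CP1} (D : VF k V) (a b : ℂ → ℂ) : Prop :=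
  ∀ (W : Opens CP1) (h : W ≤ V) (s : Sec k W) z, (D.act h s).f1 z = field i j l a b s.f1 z

/-- Sections over `V` of the rank 2 subsheaf of the degree 2 part of the tangent sheaf which is
spanned over the holomorphic functions by `ξ_i ξ_j ∂/∂x`, `ξ_i ξ_j ξ_l ∂/∂ξ_l` on `U₀` and by
`η_i η_j ∂/∂y`, `η_i η_j η_l ∂/∂η_l` on `U₁`. -/
noncomputable def T2ij (k : ℤ) (i j l : Fin 3) (V : Opens CP1) : Submodule ℂ (VF k V) where
  carrier := {D |
    (∃ a b, DifferentiableOn ℂ a (dom0 V) ∧ DifferentiableOn ℂ b (dom0 V) ∧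
      IsField0 k i j l D a b) ∧
    (∃ a b, DifferentiableOn ℂ a (dom1 V) ∧ DifferentiableOn ℂ b (dom1 V) ∧
      IsField1 k i j l D a b)}
  zero_mem' := by
    refine ⟨⟨0, 0, differentiableOn_const 0, differentiableOn_const 0, fun W hW s z => ?_⟩,
      ⟨0, 0, differentiableOn_const 0, differentiableOn_const 0, fun W hW s z => ?_⟩⟩ <;>
    exact Eq.symm (by simp only [field, Pi.zero_apply, zero_smul, add_zero]; rfl)
  add_mem' := by
    rintro D E ⟨⟨a, b, ha, hb, h⟩, ⟨a', b', ha', hb', h'⟩⟩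
      ⟨⟨c, d, hc, hd, e⟩, ⟨c', d', hc', hd', e'⟩⟩
    refine ⟨⟨a + c, b + d, ha.add hc, hb.add hd, fun W hW s z => ?_⟩,
      ⟨a' + c', b' + d', ha'.add hc', hb'.add hd', fun W hW s z => ?_⟩⟩
    · have := congrArg₂ (· + ·) (h W hW s z) (e W hW s z)
      simp only [field, Pi.add_apply, add_smul] at this ⊢
      refine Eq.trans this ?_
      abel
    · have := congrArg₂ (· + ·) (h' W hW s z) (e' W hW s z)
      simp only [field, Pi.add_apply, add_smul] at this ⊢
      refine Eq.trans this ?_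
      abel
  smul_mem' := by
    rintro r D ⟨⟨a, b, ha, hb, h⟩, ⟨a', b', ha', hb', h'⟩⟩
    refine ⟨⟨r • a, r • b, ha.const_smul r, hb.const_smul r, fun W hW s z => ?_⟩,
      ⟨r • a', r • b', ha'.const_smul r, hb'.const_smul r, fun W hW s z => ?_⟩⟩
    · refine (congrArg (r • ·) (h W hW s z)).trans ?_
      simp only [field, Pi.smul_apply, smul_add, smul_assoc]
    · refine (congrArg (r • ·) (h' W hW s z)).trans ?_
      simp only [field, Pi.smul_apply, smul_add, smul_assoc]

theorem resVF_mem (k : ℤ) (i j l : Fin 3) {V V' : Opens CP1} (h : V' ≤ V) {D : VF k V}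
    (hD : D ∈ T2ij k i j l V) : resVF k h D ∈ T2ij k i j l V' := by
  obtain ⟨⟨a, b, ha, hb, e⟩, ⟨a', b', ha', hb', e'⟩⟩ := hD
  exact ⟨⟨a, b, ha.mono fun _ hz => h hz, hb.mono fun _ hz => h hz, fun W hW => e W (hW.trans h)⟩,
    ⟨a', b', ha'.mono fun _ hz => h hz, hb'.mono fun _ hz => h hz, fun W hW => e' W (hW.trans h)⟩⟩

/-- The sheaf `𝒯₂` of degree 2 vector fields. -/
noncomputable def sheafT2 (k : ℤ) : TopCat.Presheaf (ModuleCat.{0} ℂ) CP1 where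
  obj V := ModuleCat.of ℂ (VF k V.unop)
  map f := ModuleCat.ofHom (resVF k f.unop.le)
  map_id _ := rfl
  map_comp _ _ := rfl

/-- The subsheaf `𝒯₂^{ij}` of `𝒯₂`, where `{i, j, l} = {0, 1, 2}`. -/
noncomputable def sheafT2ij (k : ℤ) (i j l : Fin 3) : TopCat.Presheaf (ModuleCat.{0} ℂ) CP1 where
  obj V := ModuleCat.of ℂ (T2ij k i j l V.unop)
  map f := ModuleCat.ofHom
    ((resVF k f.unop.le).restrict fun _ hD => resVF_mem k i j l f.unop.le hD)
  map_id _ := rfl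
  map_comp _ _ := rfl

/-- The chart domain `U₀`, where `x` is defined. -/
def U0 : Opens CP1 := ⟨{(∞ : OnePoint ℂ)}ᶜ, isOpen_compl_singleton (X := OnePoint ℂ)⟩

/-- The chart domain `U₁`, where `y` is defined. -/
def U1 : Opens CP1 := ⟨{((0 : ℂ) : OnePoint ℂ)}ᶜ, isOpen_compl_singleton (X := OnePoint ℂ)⟩

/-- The standard cover `{U₀, U₁}`. -/
def stdCover : Fin 2 → Opens CP1 := ![U0, U1]

/-- The member of the standard cover used at each point: `U₁` at infinity, `U₀` elsewhere. -/
def stdIndex (p : CP1) : Fin 2 := OnePoint.elim (X := ℂ) p 1 (fun _ => 0)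

theorem stdIndex_mem (p : CP1) : p ∈ stdCover (stdIndex p) := by
  induction p using OnePoint.rec with
  | infty => exact OnePoint.infty_ne_coe 0
  | coe x => exact OnePoint.coe_ne_infty x

/-- `w ∈ H¹(ℂP¹, 𝒯₂^{ij})` is the class of the Čech cocycle of the cover `{U₀, U₁}` given on
`U₀ ∩ U₁` by the vector field `a(x) ξ_i ξ_j ∂/∂x + b(x) ξ_i ξ_j ξ_l ∂/∂ξ_l`. -/
def IsClassOf (k : ℤ) (i j l : Fin 3) (w : Cech.H1 (sheafT2ij k i j l)) (a b : ℂ → ℂ) : Prop :=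
  ∃ (c : Cech.Z1 (sheafT2ij k i j l) stdCover) (D : T2ij k i j l (stdCover 0 ⊓ stdCover 1)),
    c.1 0 1 = D ∧ IsField0 k i j l D.1 a b ∧
    w = Cech.classOf (sheafT2ij k i j l) stdCover stdIndex stdIndex_mem c

end SuperP1

/-!
In a chart, a degree 2 derivation of the structure sheaf is the sum over `l` of the fields
`a ξ_i ξ_j ∂/∂x + b ξ_i ξ_j ξ_l ∂/∂ξ_l` with `{i, j, l} = {0, 1, 2}` and holomorphic `a`, `b`
(`act_eq_sum_fld`): it is determined by its values on the coordinates, these have degrees 2 and 3,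
and its value at a function of `x` is found at each point by division by a linear factor. Hence
`𝒯₂` is the direct sum of the three sheaves `𝒯₂^{ij}`, and each of these is the sheaf of sections
of a rank 2 bundle over the sphere, with the transition matrix `trAt k`:
`(a, b) ↦ (-y ^ (2 - 2k) a, y ^ (-2k) b - k y ^ (1 - 2k) a)`, where `a`, `b` are taken at `y⁻¹`.

The cohomology of this bundle is computed without sheaf theory. A cocycle of an arbitrary open
cover has primitives over the discs `|x| < 2` and `|y| < 2`: a partition of unity gives smooth
primitives, whose common `∂̄` is removed by solving the inhomogeneous Cauchy-Riemann equation with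
the Cauchy kernel (`exists_dbar_eq`, `exists_cousin`). On the annulus the two families differ by a
holomorphic pair of functions, which is split by its Laurent expansion
(`exists_annulus_decomposition`); what remains is a combination `P` of the monomials `x⁻ⁿ` in the
theorem, and nothing for `k < 2`. For `k = 1` the diagonal of the transition matrix leaves the
residue `x⁻¹` in the second component, and it is the off-diagonal entry that removes it. So every
cocycle is cohomologous to the cocycle `P` of the standard cover (`exists_primitive`), which gives
the generation in the first part and the vanishing in the second.

Conversely, if a principal part `P` becomes a coboundary on some cover, then it is the difference
of an entire function and a function which vanishes at infinity to a higher order than any of its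
monomials. The entire function is zero by Liouville's theorem, and then so are the coefficients of
`P` (`eq_zero_of_trAt_eq`). Since the first component is treated before the second, the
off-diagonal entry is not in the way.
-/

/-! ### Čech cohomology as a direct limit -/

namespace Cech

open CategoryTheory Opposite TopologicalSpace

variable {X : TopCat.{0}} (F : TopCat.Presheaf (ModuleCat.{0} ℂ) X)

theorem res_self {U : Opens X} (h : U ≤ U) (s : F.obj (op U)) : res F h s = s := by
  simp [res]

theorem refineZ1_apply {ι κ : Type} (U : ι → Opens X) (V : κ → Opens X) (r : κ → ι)
    (h : ∀ a, V a ≤ U (r a)) (c : Z1 F U) (a b : κ) :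
    (refineZ1 F U V r h c).1 a b = res F (inf_le_inf (h a) (h b)) (c.1 (r a) (r b)) := rfl

theorem d0_apply {ι : Type} (U : ι → Opens X) (b : ∀ i, F.obj (op (U i))) (i j : ι) :
    (d0 F U b).1 i j = res F inf_le_right (b j) - res F inf_le_left (b i) := rfl

theorem Z1.ext {ι : Type} {U : ι → Opens X} {c c' : Z1 F U} (h : ∀ i j, c.1 i j = c'.1 i j) :
    c = c' :=
  Subtype.ext (funext fun i => funext fun j => h i j)

theorem refineZ1_refineZ1 {ι κ τ : Type} (U : ι → Opens X) (V : κ → Opens X) (W : τ → Opens X)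
    (r : κ → ι) (h : ∀ a, V a ≤ U (r a)) (r' : τ → κ) (h' : ∀ a, W a ≤ V (r' a)) (c : Z1 F U) :
    refineZ1 F V W r' h' (refineZ1 F U V r h c) =
      refineZ1 F U W (r ∘ r') (fun a => (h' a).trans (h (r' a))) c :=
  Z1.ext F fun a b => by
    rw [refineZ1_apply, refineZ1_apply, refineZ1_apply, res_res]
    rfl

instance : DirectedSystem (fun U : PtCover X => H1Cover F U.nhd)
    (fun U V h => refineH1 F U.nhd V.nhd id h) where
  map_self U x := by
    obtain ⟨c, rfl⟩ := Submodule.mkQ_surjective _ x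
    refine congrArg (Submodule.mkQ _) (Z1.ext F fun i j => ?_)
    rw [refineZ1_apply, res_self]
    rfl
  map_map U V W h h' x := by
    obtain ⟨c, rfl⟩ := Submodule.mkQ_surjective _ x
    exact congrArg (Submodule.mkQ _) (refineZ1_refineZ1 F _ _ _ _ _ _ _ c)

instance : Nonempty (PtCover X) := ⟨⟨fun _ => ⊤, fun _ => trivial⟩⟩

instance : IsDirectedOrder (PtCover X) :=
  ⟨fun U V => ⟨⟨fun x => U.nhd x ⊓ V.nhd x, fun x => ⟨U.mem x, V.mem x⟩⟩,
    fun _ => inf_le_left, fun _ => inf_le_right⟩⟩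

noncomputable instance : AddCommGroup (H1 F) :=
  Module.DirectLimit.addCommGroup (fun U : PtCover X => H1Cover F U.nhd)
    (fun U V h => refineH1 F U.nhd V.nhd id h)

/-- The class in `H¹(X, F)` of a cocycle of a cover indexed by points. -/
noncomputable def mkClass (U : PtCover X) : Z1 F U.nhd →ₗ[ℂ] H1 F :=
  Module.DirectLimit.of ℂ (PtCover X) (fun U : PtCover X => H1Cover F U.nhd)
      (fun U V h => refineH1 F U.nhd V.nhd id h) U ∘ₗ Submodule.mkQ _

theorem exists_mkClass (w : H1 F) : ∃ U c, mkClass F U c = w := by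
  obtain ⟨U, x, rfl⟩ := Module.DirectLimit.exists_of w
  obtain ⟨c, rfl⟩ := Submodule.mkQ_surjective _ x
  exact ⟨U, c, rfl⟩

theorem mkClass_refine {U V : PtCover X} (h : U ≤ V) (c : Z1 F U.nhd) :
    mkClass F V (refineZ1 F U.nhd V.nhd id h c) = mkClass F U c :=
  Module.DirectLimit.of_f (G := fun U : PtCover X => H1Cover F U.nhd)
    (f := fun U V h => refineH1 F U.nhd V.nhd id h) (hij := h) (x := Submodule.mkQ _ c)

theorem mkClass_d0 (U : PtCover X) (b : ∀ i, F.obj (op (U.nhd i))) :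
    mkClass F U (d0 F U.nhd b) = 0 := by
  have h : Submodule.mkQ (LinearMap.range (d0 F U.nhd)) (d0 F U.nhd b) = 0 :=
    (Submodule.Quotient.mk_eq_zero _).2 ⟨b, rfl⟩
  rw [mkClass, LinearMap.comp_apply, h, map_zero]

theorem exists_of_mkClass_eq_zero {U : PtCover X} {c : Z1 F U.nhd} (h : mkClass F U c = 0) :
    ∃ (V : PtCover X) (hV : U ≤ V) (b : ∀ i, F.obj (op (V.nhd i))),
      d0 F V.nhd b = refineZ1 F U.nhd V.nhd id hV c := by
  obtain ⟨V, hV, h0⟩ := Module.DirectLimit.of.zero_exact h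
  obtain ⟨b, hb⟩ := (Submodule.Quotient.mk_eq_zero _).1 h0
  exact ⟨V, hV, b, hb⟩

/-- Cocycles of two covers have the same class if they are cohomologous on the intersections of
the members. -/
theorem mkClass_eq_classOf {U : PtCover X} (c : Z1 F U.nhd) {ι : Type} (S : ι → Opens X)
    (r : X → ι) (hr : ∀ x, x ∈ S (r x)) (c' : Z1 F S)
    (b : ∀ x, F.obj (op (U.nhd x ⊓ S (r x))))
    (h : ∀ x y, res F inf_le_right (b y) - res F inf_le_left (b x) =
      res F (inf_le_inf inf_le_left inf_le_left) (c.1 x y) -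
        res F (inf_le_inf inf_le_right inf_le_right) (c'.1 (r x) (r y))) :
    mkClass F U c = classOf F S r hr c' := by
  let V : PtCover X := ⟨fun x => U.nhd x ⊓ S (r x), fun x => ⟨U.mem x, hr x⟩⟩
  let U' : PtCover X := ⟨fun x => S (r x), hr⟩
  have h1 : U ≤ V := fun _ => inf_le_left
  have h2 : U' ≤ V := fun _ => inf_le_right
  have e : classOf F S r hr c' = mkClass F U' (refineZ1 F S U'.nhd r (fun _ => le_rfl) c') := rfl
  have hd : refineZ1 F U.nhd V.nhd id h1 c =
      refineZ1 F U'.nhd V.nhd id h2 (refineZ1 F S U'.nhd r (fun _ => le_rfl) c') +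
        d0 F V.nhd b := by
    rw [refineZ1_refineZ1]
    exact Z1.ext F fun x y => sub_eq_iff_eq_add'.1 (h x y).symm
  rw [e, ← mkClass_refine F h1, ← mkClass_refine F h2, hd, map_add, mkClass_d0, add_zero]

theorem exists_of_classOf_eq_zero {ι : Type} (S : ι → Opens X)
    (r : X → ι) (hr : ∀ x, x ∈ S (r x)) (c : Z1 F S) (h : classOf F S r hr c = 0) :
    ∃ (V : PtCover X) (hV : ∀ x, V.nhd x ≤ S (r x)) (b : ∀ x, F.obj (op (V.nhd x))),
      ∀ x y, res F inf_le_right (b y) - res F inf_le_left (b x) =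
        res F (inf_le_inf (hV x) (hV y)) (c.1 (r x) (r y)) := by
  obtain ⟨V, hV, b, hb⟩ := exists_of_mkClass_eq_zero F
    (U := ⟨fun x => S (r x), hr⟩) (c := refineZ1 F S _ r (fun _ => le_rfl) c) h
  refine ⟨V, hV, b, fun x y => ?_⟩
  have := congrFun (congrFun (congrArg Subtype.val hb) x) y
  rw [refineZ1_refineZ1] at this
  exact this

/-- The alternating cochain of a cover by two open sets given by a section over their
intersection. -/
noncomputable def pairCochain (S : Fin 2 → Opens X) (s : F.obj (op (S 0 ⊓ S 1))) :
    ∀ i j, F.obj (op (S i ⊓ S j))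
  | 0, 0 => 0
  | 0, 1 => s
  | 1, 0 => -res F (le_of_eq (inf_comm _ _)) s
  | 1, 1 => 0

theorem pairCochain_mem (S : Fin 2 → Opens X) (s : F.obj (op (S 0 ⊓ S 1))) :
    pairCochain F S s ∈ Z1 F S
  | 0, 0, 0 => by simp only [pairCochain, map_zero, add_zero]
  | 0, 0, 1 => by simp only [pairCochain, map_zero, zero_add]
  | 0, 1, 0 => by simp only [pairCochain, map_zero, map_neg, res_res, add_neg_cancel]
  | 0, 1, 1 => by simp only [pairCochain, map_zero, add_zero]
  | 1, 0, 0 => by simp only [pairCochain, map_zero, add_zero]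
  | 1, 0, 1 => by simp only [pairCochain, map_zero, map_neg, res_res, neg_add_cancel]
  | 1, 1, 0 => by simp only [pairCochain, map_zero, zero_add]
  | 1, 1, 1 => by simp only [pairCochain, map_zero, add_zero]

/-- The alternating cocycle of a cover by two open sets given by a section over their
intersection. -/
noncomputable def pairZ1 (S : Fin 2 → Opens X) : F.obj (op (S 0 ⊓ S 1)) →ₗ[ℂ] Z1 F S where
  toFun s := ⟨pairCochain F S s, pairCochain_mem F S s⟩
  map_add' s t := Z1.ext F fun
    | 0, 0 => (add_zero _).symm
    | 0, 1 => rfl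
    | 1, 0 => by
      change -res F _ (s + t) = -res F _ s + -res F _ t
      rw [map_add, neg_add]
    | 1, 1 => (add_zero _).symm
  map_smul' a s := Z1.ext F fun
    | 0, 0 => (smul_zero a).symm
    | 0, 1 => rfl
    | 1, 0 => by
      change -res F _ (a • s) = a • -res F _ s
      rw [map_smul, smul_neg]
    | 1, 1 => (smul_zero a).symm

theorem pairZ1_apply (S : Fin 2 → Opens X) (s : F.obj (op (S 0 ⊓ S 1))) (i j : Fin 2) :
    (pairZ1 F S s).1 i j = pairCochain F S s i j := rfl

end Cech

namespace SuperP1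

open Complex MeasureTheory Set Filter Topology
open scoped Real ContDiff Convolution Manifold

/-! ### The inhomogeneous Cauchy–Riemann equation -/

/-- Twice the Wirtinger derivative `∂f/∂z̄`. -/
noncomputable def dbar (f : ℂ → ℂ) (z : ℂ) : ℂ := fderiv ℝ f z 1 + I * fderiv ℝ f z I

theorem differentiableAt_of_dbar_eq_zero {f : ℂ → ℂ} {z : ℂ} (hf : DifferentiableAt ℝ f z)
    (h : dbar f z = 0) : DifferentiableAt ℂ f z := by
  refine differentiableAt_complex_iff_differentiableAt_real.2 ⟨hf, ?_⟩
  have h' : I * dbar f z = 0 := by rw [h, mul_zero]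
  rw [dbar, mul_add, ← mul_assoc, I_mul_I] at h'
  rw [smul_eq_mul]
  linear_combination -h'

theorem dbar_eq_zero {f : ℂ → ℂ} {z : ℂ} (h : DifferentiableAt ℂ f z) : dbar f z = 0 := by
  obtain ⟨-, h'⟩ := differentiableAt_complex_iff_differentiableAt_real.1 h
  rw [dbar, h', smul_eq_mul, ← mul_assoc, I_mul_I]
  ring

/-- The Cauchy kernel `1/(2πz)`, the fundamental solution of `dbar`. -/
noncomputable def cauchyKernel (z : ℂ) : ℂ := (2 * π * z)⁻¹

theorem locallyIntegrable_cauchyKernel : LocallyIntegrable cauchyKernel := by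
  have hm : AEStronglyMeasurable cauchyKernel volume :=
    (by unfold cauchyKernel; fun_prop : Measurable cauchyKernel).aestronglyMeasurable
  -- In polar coordinates the factor `r` of the area element cancels the singularity.
  have key : ∀ R : ℝ, IntegrableOn cauchyKernel (Metric.closedBall 0 R) := by
    intro R
    have h1 : Integrable (fun z : ℂ => (Iic R).indicator (fun r : ℝ => r⁻¹) ‖z‖) := by
      rw [integrable_fun_norm_addHaar (volume : Measure ℂ)]
      have : IntegrableOn (fun r : ℝ => (Iic R).indicator (fun _ : ℝ => (1 : ℝ)) r) (Ioi 0) := by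
        rw [IntegrableOn, integrable_indicator_iff measurableSet_Iic, IntegrableOn,
          Measure.restrict_restrict measurableSet_Iic]
        rw [inter_comm, Ioi_inter_Iic]
        exact integrableOn_const (by simp)
      refine this.congr_fun (fun r hr => ?_) measurableSet_Ioi
      have hr' : (r : ℝ) ≠ 0 := ne_of_gt hr
      by_cases h : r ∈ Iic R
      · simp [indicator_of_mem h, Complex.finrank_real_complex, hr']
      · simp [indicator_of_notMem h]
    have h2 : IntegrableOn (fun z : ℂ => (2 * π)⁻¹ * (Iic R).indicator (fun r : ℝ => r⁻¹) ‖z‖)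
      (Metric.closedBall 0 R) := (h1.const_mul _).integrableOn
    refine Integrable.mono' h2 hm.restrict ?_
    filter_upwards [ae_restrict_mem measurableSet_closedBall] with z hz
    have hz' : ‖z‖ ∈ Iic R := by simpa using hz
    rw [indicator_of_mem hz', cauchyKernel]
    simp [abs_of_pos Real.pi_pos, mul_comm]
  intro x
  refine ⟨Metric.ball x 1, Metric.ball_mem_nhds x one_pos, (key (‖x‖ + 1)).mono_set ?_⟩
  intro y hy
  have h1 := norm_le_norm_add_norm_sub' y x
  have h2 : ‖y - x‖ < 1 := by simpa [dist_eq_norm] using hy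
  simp only [Metric.mem_closedBall, dist_zero_right]
  rw [norm_sub_rev] at h1
  linarith [norm_sub_rev x y]

theorem exists_eq_zero_of_norm_lt {E : Type*} [NormedAddCommGroup E] {h : ℂ → E}
    (hc : HasCompactSupport h) : ∃ R : ℝ, ∀ z, R < ‖z‖ → h z = 0 := by
  obtain ⟨R, hR⟩ := hc.isCompact.isBounded.subset_closedBall 0
  refine ⟨R, fun z hz => ?_⟩
  by_contra hne
  have := hR (subset_tsupport _ hne)
  simp at this
  linarith

/-- The Cauchy–Pompeiu formula for compactly supported functions. In polar coordinates
centred at `z` the integrand splits into a radial derivative, which integrates to `h z`, and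
an angular one, which integrates to zero. -/
theorem integral_cauchyKernel_mul_dbar {h : ℂ → ℂ} (hc : HasCompactSupport h)
    (h1 : ContDiff ℝ 1 h) (z : ℂ) : ∫ t, cauchyKernel t * dbar h (z - t) = h z := by
  set e : ℝ → ℂ := fun θ => Real.cos θ + Real.sin θ * I with he
  have hcont : Continuous (fderiv ℝ h) := h1.continuous_fderiv one_ne_zero
  have hecont : Continuous e := by fun_prop
  have hdiff : Differentiable ℝ h := h1.differentiable one_ne_zero
  have henorm : ∀ θ, ‖e θ‖ = 1 := fun θ => by
    simp only [he]
    rw [Complex.ofReal_cos, Complex.ofReal_sin, ← Complex.exp_mul_I, Complex.norm_exp_ofReal_mul_I]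
  have hene : ∀ θ, e θ ≠ 0 := fun θ h0 => by have := henorm θ; simp [h0] at this
  set A : ℝ × ℝ → ℂ := fun p => fderiv ℝ h (z - p.1 * e p.2) (e p.2) with hA
  set B : ℝ × ℝ → ℂ := fun p => fderiv ℝ h (z - p.1 * e p.2) (I * e p.2) with hB
  have hAc : Continuous A := by
    apply Continuous.clm_apply
    · exact hcont.comp (by fun_prop)
    · fun_prop
  have hBc : Continuous B := by
    apply Continuous.clm_apply
    · exact hcont.comp (by fun_prop)
    · fun_prop
  obtain ⟨R₁, hR₁⟩ := exists_eq_zero_of_norm_lt hc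
  obtain ⟨R₂, hR₂⟩ := exists_eq_zero_of_norm_lt (hc.fderiv (𝕜 := ℝ))
  set R : ℝ := max R₁ R₂ + ‖z‖ with hR
  have hfar : ∀ r θ : ℝ, R < r → max R₁ R₂ < ‖z - r * e θ‖ := by
    intro r θ hr
    have h2 : ‖(r : ℂ) * e θ‖ = |r| := by simp [henorm]
    have h3 := norm_sub_norm_le ((r : ℂ) * e θ) z
    rw [norm_sub_rev, h2] at h3
    have := le_abs_self r
    linarith
  have hfarA : ∀ r θ : ℝ, R < r → fderiv ℝ h (z - r * e θ) = 0 := fun r θ hr =>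
    hR₂ _ (lt_of_le_of_lt (le_max_right _ _) (hfar r θ hr))
  have hfarh : ∀ r θ : ℝ, R < r → h (z - r * e θ) = 0 := fun r θ hr =>
    hR₁ _ (lt_of_le_of_lt (le_max_left _ _) (hfar r θ hr))
  have hint : ∀ C : ℝ × ℝ → ℂ, Continuous C → (∀ r θ, R < r → C (r, θ) = 0) →
      IntegrableOn C (Ioi 0 ×ˢ Ioo (-π) π) := by
    intro C hC h0
    have : IntegrableOn C (Icc 0 R ×ˢ Icc (-π) π) :=
      hC.continuousOn.integrableOn_compact (isCompact_Icc.prod isCompact_Icc)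
    refine (this.mono_set (s := Ioc 0 R ×ˢ Ioo (-π) π)
      (prod_mono Ioc_subset_Icc_self Ioo_subset_Icc_self)).of_forall_sdiff_eq_zero
      (measurableSet_Ioi.prod measurableSet_Ioo) ?_
    rintro ⟨r, θ⟩ ⟨⟨hr, hθ⟩, hn⟩
    refine h0 r θ ?_
    by_contra hle
    exact hn ⟨⟨hr, not_lt.1 hle⟩, hθ⟩
  have hAi := hint A hAc fun r θ hr => by simp [hA, hfarA r θ hr]
  have hBi := hint B hBc fun r θ hr => by simp [hB, hfarA r θ hr]
  have hpolar : ∀ p : ℝ × ℝ, p ∈ Ioi (0 : ℝ) ×ˢ Ioo (-π) π →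
      p.1 • (cauchyKernel (Complex.polarCoord.symm p) *
        dbar h (z - Complex.polarCoord.symm p)) = (2 * π : ℂ)⁻¹ * (A p + I * B p) := by
    rintro ⟨r, θ⟩ ⟨hr, -⟩
    have hr : (r : ℂ) ≠ 0 := by exact_mod_cast (ne_of_gt hr)
    have e1 : A (r, θ) = Real.cos θ * fderiv ℝ h (z - r * e θ) 1 +
        Real.sin θ * fderiv ℝ h (z - r * e θ) I := by
      simp only [hA]
      conv_lhs => rw [show e θ = Real.cos θ • (1 : ℂ) + Real.sin θ • I by simp [he]]
      rw [map_add, map_smul, map_smul]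
      simp [he]
    have e2 : B (r, θ) = -Real.sin θ * fderiv ℝ h (z - r * e θ) 1 +
        Real.cos θ * fderiv ℝ h (z - r * e θ) I := by
      simp only [hB]
      rw [show I * e θ = (-Real.sin θ) • (1 : ℂ) + Real.cos θ • I by
        simp only [he]; simp; linear_combination (Complex.sin θ) * I_mul_I]
      rw [map_add, map_smul, map_smul]
      simp
    have e3 : Complex.polarCoord.symm (r, θ) = r * e θ := by simp [he]
    have e4 : (e θ)⁻¹ = Real.cos θ - Real.sin θ * I := by
      rw [inv_eq_iff_eq_inv, eq_comm, inv_eq_iff_eq_inv, eq_comm]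
      apply inv_eq_of_mul_eq_one_left
      simp only [he]
      have := Complex.sin_sq_add_cos_sq (θ : ℂ)
      push_cast
      linear_combination this - (Complex.sin θ)^2 * I_mul_I
    have e5 : (r : ℂ) * cauchyKernel (r * e θ) = (2 * π : ℂ)⁻¹ * (e θ)⁻¹ := by
      rw [cauchyKernel]
      have := hene θ
      field_simp
    rw [e3, real_smul, ← mul_assoc, e5, e4, e1, e2, dbar]
    linear_combination (2 * π : ℂ)⁻¹ * (- Real.sin θ * fderiv ℝ h (z - r * e θ) I * I_mul_I)
  have hderivr : ∀ r θ : ℝ, HasDerivAt (fun r : ℝ => - h (z - r * e θ)) (A (r, θ)) r := by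
    intro r θ
    have h2 : HasDerivAt (fun r : ℝ => z - r * e θ) (-(e θ)) r := by
      have := ((hasDerivAt_id r).ofReal_comp.mul_const (e θ)).const_sub z
      simpa using this
    have := ((hdiff (z - r * e θ)).hasFDerivAt.comp_hasDerivAt r h2).fun_neg
    simpa [hA, Function.comp_def] using this
  have hderivθ : ∀ r θ : ℝ, HasDerivAt (fun θ : ℝ => - h (z - r * e θ)) (r * B (r, θ)) θ := by
    intro r θ
    have h3 : HasDerivAt e (I * e θ) θ := by
      have := ((Real.hasDerivAt_cos θ).ofReal_comp).add
        (((Real.hasDerivAt_sin θ).ofReal_comp).mul_const I)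
      convert! this using 1
      simp only [he]
      push_cast
      linear_combination (Complex.sin θ) * I_mul_I
    have h2 : HasDerivAt (fun θ : ℝ => z - r * e θ) (-(r * (I * e θ))) θ :=
      (h3.const_mul (r : ℂ)).const_sub z
    have := ((hdiff (z - r * e θ)).hasFDerivAt.comp_hasDerivAt θ h2).neg
    convert! this using 1
    simp only [hB]
    rw [map_neg, neg_neg, ← real_smul, ← real_smul (z := I * e θ), map_smul]
  have hIA : ∫ p in Ioi (0 : ℝ) ×ˢ Ioo (-π) π, A p = 2 * π * h z := by
    rw [Measure.volume_eq_prod, ← setIntegral_prod_swap, setIntegral_prod]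
    · have : ∀ θ : ℝ, ∫ r in Ioi (0 : ℝ), A (r, θ) = h z := by
        intro θ
        have hi : IntegrableOn (fun r => A (r, θ)) (Ioi 0) := by
          have : IntegrableOn (fun r => A (r, θ)) (Icc 0 R) :=
            (by fun_prop : Continuous fun r => A (r, θ)).continuousOn.integrableOn_compact
              isCompact_Icc
          refine (this.mono_set Ioc_subset_Icc_self).of_forall_sdiff_eq_zero measurableSet_Ioi ?_
          rintro r ⟨hr, hn⟩
          have : R < r := by
            by_contra hle
            exact hn ⟨hr, not_lt.1 hle⟩
          simp [hA, hfarA r θ this]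
        have := integral_Ioi_of_hasDerivAt_of_tendsto (a := 0) (m := (0 : ℂ))
          (hderivr 0 θ).continuousAt.continuousWithinAt (fun r _ => hderivr r θ) hi
          (tendsto_const_nhds.congr' (by
            filter_upwards [eventually_gt_atTop R] with r hr
            simp [hfarh r θ hr]))
        simpa using this
      simp only [Prod.swap_prod_mk, this]
      rw [setIntegral_const]
      simp [Real.pi_pos.le]
      left
      ring
    · rw [← Measure.volume_eq_prod]
      exact hAi.swap
  have hIB : ∫ p in Ioi (0 : ℝ) ×ˢ Ioo (-π) π, B p = 0 := by
    rw [Measure.volume_eq_prod, setIntegral_prod _ (by rw [← Measure.volume_eq_prod]; exact hBi)]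
    refine setIntegral_eq_zero_of_forall_eq_zero fun r hr => ?_
    have hr : (r : ℂ) ≠ 0 := by exact_mod_cast (ne_of_gt hr)
    have h4 : ∫ θ in (-π)..π, (r : ℂ) * B (r, θ) = 0 := by
      rw [intervalIntegral.integral_eq_sub_of_hasDerivAt (fun θ _ => hderivθ r θ)
        ((by fun_prop : Continuous fun θ : ℝ => (r : ℂ) * B (r, θ)).intervalIntegrable _ _)]
      simp [he]
    rw [intervalIntegral.integral_const_mul] at h4
    rw [← integral_Ioc_eq_integral_Ioo, ← intervalIntegral.integral_of_le
      (by linarith [Real.pi_pos])]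
    exact (mul_eq_zero.1 h4).resolve_left hr
  rw [← Complex.integral_comp_polarCoord_symm, polarCoord_target,
    setIntegral_congr_fun (measurableSet_Ioi.prod measurableSet_Ioo) hpolar, integral_const_mul,
    integral_add hAi (hBi.const_mul I), integral_const_mul, hIA, hIB]
  have := Real.pi_ne_zero
  field_simp
  simp

/-- The inhomogeneous Cauchy–Riemann equation with compactly supported right-hand side has a
solution which is bounded near infinity. -/
theorem exists_dbar_eq {h : ℂ → ℂ} (hc : HasCompactSupport h) (h1 : ContDiff ℝ 1 h) :
    ∃ u : ℂ → ℂ, Differentiable ℝ u ∧ (∀ z, dbar u z = h z) ∧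
      ∃ C R : ℝ, ∀ z, R ≤ ‖z‖ → ‖u z‖ ≤ C := by
  set L := ContinuousLinearMap.mul ℝ ℂ
  have hd := fun z => hc.hasFDerivAt_convolution_right L locallyIntegrable_cauchyKernel h1 z
  refine ⟨cauchyKernel ⋆[L, volume] h, fun z => (hd z).differentiableAt, fun z => ?_, ?_⟩
  · have hex : Integrable (fun t => (L.precompR ℂ) (cauchyKernel t) (fderiv ℝ h (z - t))) :=
      (hc.fderiv (𝕜 := ℝ)).convolutionExists_right (L.precompR ℂ) locallyIntegrable_cauchyKernel
        (h1.continuous_fderiv one_ne_zero) z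
    have hi : ∀ v, Integrable fun t => cauchyKernel t * fderiv ℝ h (z - t) v := fun v =>
      (ContinuousLinearMap.apply ℝ ℂ v).integrable_comp hex
    have happ : ∀ v, fderiv ℝ (cauchyKernel ⋆[L, volume] h) z v =
        ∫ t, cauchyKernel t * fderiv ℝ h (z - t) v := by
      intro v
      rw [(hd z).fderiv, convolution, ContinuousLinearMap.integral_apply hex]
      rfl
    rw [dbar, happ, happ, ← integral_const_mul, ← integral_add (hi 1) ((hi I).const_mul I),
      ← integral_cauchyKernel_mul_dbar hc h1 z]
    refine integral_congr_ae (Eventually.of_forall fun t => ?_)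
    simp only [dbar]
    ring
  · obtain ⟨R, hR⟩ := exists_eq_zero_of_norm_lt hc
    have hint : Integrable h := h1.continuous.integrable_of_hasCompactSupport hc
    refine ⟨∫ t, ‖h t‖, R + 1, fun z hz => ?_⟩
    rw [← integral_sub_left_eq_self (fun t => ‖h t‖) volume z, convolution]
    refine norm_integral_le_of_norm_le ?_ (Eventually.of_forall fun t => ?_)
    · exact (hint.comp_sub_left z).norm
    · by_cases h0 : h (z - t) = 0
      · simp [h0]
      · have h2 : ‖z - t‖ ≤ R := not_lt.1 fun h3 => h0 (hR _ h3)
        have h3 : 1 ≤ ‖t‖ := by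
          have := norm_sub_norm_le z t
          linarith
        have h4 : ‖cauchyKernel t‖ ≤ 1 := by
          rw [cauchyKernel, norm_inv]
          apply inv_le_one_of_one_le₀
          simp [abs_of_pos Real.pi_pos]
          nlinarith [Real.pi_gt_three]
        change ‖cauchyKernel t * h (z - t)‖ ≤ _
        rw [norm_mul]
        exact mul_le_of_le_one_left (norm_nonneg _) h4

theorem dbar_congr {f g : ℂ → ℂ} {z : ℂ} (h : f =ᶠ[𝓝 z] g) : dbar f z = dbar g z := by
  rw [dbar, dbar, h.fderiv_eq]

theorem dbar_sub {f g : ℂ → ℂ} {z : ℂ} (hf : DifferentiableAt ℝ f z)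
    (hg : DifferentiableAt ℝ g z) : dbar (fun w => f w - g w) z = dbar f z - dbar g z := by
  simp only [dbar, fderiv_fun_sub hf hg, sub_apply]
  ring

theorem dbar_mul {f g : ℂ → ℂ} {z : ℂ} (hf : DifferentiableAt ℝ f z)
    (hg : DifferentiableAt ℝ g z) :
    dbar (fun w => f w * g w) z = f z * dbar g z + g z * dbar f z := by
  simp only [dbar, fderiv_fun_mul hf hg]
  simp
  ring

theorem contDiffAt_dbar {f : ℂ → ℂ} {z : ℂ} (hf : ContDiffAt ℝ ∞ f z) :
    ContDiffAt ℝ 1 (dbar f) z := by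
  have h : ContDiffAt ℝ 1 (fderiv ℝ f) z := hf.fderiv_right (m := 1) (by norm_cast)
  exact (h.clm_apply contDiffAt_const).add (contDiffAt_const.mul (h.clm_apply contDiffAt_const))

theorem contDiffAt_of_differentiableOn {f : ℂ → ℂ} {Ω : Set ℂ} (hΩ : IsOpen Ω)
    (hf : DifferentiableOn ℂ f Ω) {z : ℂ} (hz : z ∈ Ω) : ContDiffAt ℝ ∞ f z :=
  ((hf.contDiffOn hΩ).contDiffAt (hΩ.mem_nhds hz)).restrict_scalars ℝ

/-! ### The Cousin problem and Laurent expansions in the plane -/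

/-- A smooth cut-off function: `1` on the disc of radius `r`, `0` outside the disc of radius
`R`. -/
theorem exists_cutoff {r R : ℝ} (hr : 0 < r) (hR : r < R) :
    ∃ χ : ℂ → ℂ, ContDiff ℝ ∞ χ ∧ (∀ z, ‖z‖ ≤ r → χ z = 1) ∧ ∀ z, R ≤ ‖z‖ → χ z = 0 := by
  let b : ContDiffBump (0 : ℂ) := ⟨r, R, hr, hR⟩
  refine ⟨fun z => (b z : ℂ), ofRealCLM.contDiff.comp b.contDiff, fun z hz => ?_, fun z hz => ?_⟩
  · dsimp only
    rw [b.one_of_mem_closedBall (by simpa using hz)]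
    simp
  · dsimp only
    rw [b.zero_of_le_dist (by simpa using hz)]
    simp

/-- The first Cousin problem on a disc: a holomorphic cocycle of an open cover of the plane
becomes a coboundary over a disc. -/
theorem exists_cousin {ι : Type} {U : ι → Set ℂ} (hU : ∀ i, IsOpen (U i))
    (hcov : ∀ z, ∃ i, z ∈ U i) {c : ι → ι → ℂ → ℂ}
    (hc : ∀ i j, DifferentiableOn ℂ (c i j) (U i ∩ U j))
    (hcc : ∀ i j m, ∀ z ∈ U i ∩ U j ∩ U m, c i j z + c j m z = c i m z) (R : ℝ) :
    ∃ g : ι → ℂ → ℂ, (∀ i, DifferentiableOn ℂ (g i) (U i ∩ Metric.ball 0 R)) ∧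
      ∀ i j, ∀ z ∈ U i ∩ U j ∩ Metric.ball 0 R, g j z - g i z = c i j z := by
  obtain ⟨ρ, hρ⟩ := SmoothPartitionOfUnity.exists_isSubordinate 𝓘(ℝ, ℂ) isClosed_univ U hU
    (fun z _ => mem_iUnion.2 (hcov z))
  set s : ι → ℂ → ℂ := fun i z => ∑ᶠ m, ρ m z • c m i z with hs
  have hsmooth : ∀ i, ∀ z ∈ U i, ContDiffAt ℝ ∞ (s i) z := fun i z hz =>
    ρ.contDiffAt_finsum fun m hm =>
      contDiffAt_of_differentiableOn ((hU m).inter (hU i)) (hc m i) ⟨hρ m hm, hz⟩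
  have hfin : ∀ (z : ℂ) (f : ι → ℂ), (fun m => ρ m z • f m).HasFiniteSupport := fun z f =>
    (ρ.locallyFinite.point_finite z).subset fun m hm hm' => hm (by
      change ρ m z • f m = 0
      rw [show ρ m z = 0 from hm', zero_smul])
  have hdiff : ∀ i j, ∀ z ∈ U i ∩ U j, s j z - s i z = c i j z := by
    intro i j z hz
    rw [hs]
    dsimp only
    rw [← finsum_sub_distrib (hfin z _) (hfin z _)]
    have : ∀ m, ρ m z • c m j z - ρ m z • c m i z = ρ m z • c i j z := by
      intro m
      by_cases hm : ρ m z = 0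
      · simp [hm]
      · have hm' : z ∈ U m := hρ m (subset_tsupport _ hm)
        rw [← smul_sub, ← hcc m i j z ⟨⟨hm', hz.1⟩, hz.2⟩]
        simp
    rw [finsum_congr this, ← finsum_smul, ρ.sum_eq_one (mem_univ z), one_smul]
  choose idx hidx using hcov
  -- The `s i` are smooth primitives, whose `dbar` does not depend on `i`.
  set h : ℂ → ℂ := fun z => dbar (s (idx z)) z
  have hh : ∀ i, ∀ z ∈ U i, h z = dbar (s i) z := by
    intro i z hz
    have hd := dbar_sub ((hsmooth i z hz).differentiableAt (by simp))
      ((hsmooth _ z (hidx z)).differentiableAt (by simp))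
    have ho : U (idx z) ∩ U i ∈ 𝓝 z := ((hU _).inter (hU i)).mem_nhds ⟨hidx z, hz⟩
    rw [dbar_congr (g := c (idx z) i) (by filter_upwards [ho] with w hw using hdiff _ _ w hw),
      dbar_eq_zero ((hc (idx z) i).differentiableAt ho)] at hd
    exact (sub_eq_zero.1 hd.symm).symm
  have hh1 : ContDiff ℝ 1 h := contDiff_iff_contDiffAt.2 fun z =>
    (contDiffAt_dbar (hsmooth _ z (hidx z))).congr_of_eventuallyEq (by
      filter_upwards [(hU _).mem_nhds (hidx z)] with w hw using hh _ w hw)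
  obtain ⟨χ, hχ, hχ1, hχ0⟩ := exists_cutoff (r := |R| + 1) (R := |R| + 2) (by positivity)
    (by linarith)
  obtain ⟨u, hu, hue, -⟩ := exists_dbar_eq (h := fun z => χ z * h z)
    (HasCompactSupport.of_support_subset_isCompact (isCompact_closedBall 0 (|R| + 2)) (by
      intro z hz
      by_contra hn
      refine hz ?_
      change χ z * h z = 0
      rw [hχ0 z (by simp at hn; exact hn.le), zero_mul]))
    ((hχ.of_le (by norm_cast)).mul hh1)
  refine ⟨fun i z => s i z - u z, fun i z hz => ?_, fun i j z hz => ?_⟩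
  · have h1 := (hsmooth i z hz.1).differentiableAt (by simp)
    refine (differentiableAt_of_dbar_eq_zero (h1.sub (hu z)) ?_).differentiableWithinAt
    have hzR : ‖z‖ ≤ |R| + 1 := by
      have := hz.2
      simp at this
      linarith [le_abs_self R]
    change dbar (fun w => s i w - u w) z = 0
    rw [dbar_sub h1 (hu z), hue, hχ1 z hzR, hh i z hz.1]
    ring
  · rw [← hdiff i j z hz.1]
    ring

/-- Laurent splitting: a holomorphic function on an annulus is the sum of one which is holomorphic
on the disc and one which is holomorphic near infinity. -/
theorem exists_laurent_split {E : ℂ → ℂ}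
    (hE : DifferentiableOn ℂ E {z | 1 / 2 < ‖z‖ ∧ ‖z‖ < 2}) :
    ∃ e₀ e₁ : ℂ → ℂ, DifferentiableOn ℂ e₀ (Metric.ball 0 2) ∧
      DifferentiableOn ℂ e₁ (Metric.ball 0 2) ∧
      ∀ z, 1 / 2 < ‖z‖ → ‖z‖ < 2 → E z = e₀ z + e₁ z⁻¹ := by
  have hopen : IsOpen {z : ℂ | 1 / 2 < ‖z‖ ∧ ‖z‖ < 2} :=
    (isOpen_lt continuous_const continuous_norm).inter (isOpen_lt continuous_norm continuous_const)
  obtain ⟨χ, hχ, hχ1, hχ0⟩ := exists_cutoff (r := 3 / 4) (R := 3 / 2) (by norm_num) (by norm_num)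
  have hnear : ∀ z : ℂ, ‖z‖ < 3 / 4 → ∀ᶠ w in 𝓝 z, χ w = 1 := fun z hz => by
    filter_upwards [(isOpen_lt continuous_norm continuous_const).mem_nhds hz] with w hw
      using hχ1 w (le_of_lt hw)
  have hfar : ∀ z : ℂ, 3 / 2 < ‖z‖ → ∀ᶠ w in 𝓝 z, χ w = 0 := fun z hz => by
    filter_upwards [(isOpen_lt continuous_const continuous_norm).mem_nhds hz] with w hw
      using hχ0 w (le_of_lt hw)
  have hEs : ∀ z, 1 / 2 < ‖z‖ → ‖z‖ < 2 → ContDiffAt ℝ ∞ E z := fun z h1 h2 =>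
    contDiffAt_of_differentiableOn hopen hE ⟨h1, h2⟩
  have hdE : ∀ z, 1 / 2 < ‖z‖ → ‖z‖ < 2 → DifferentiableAt ℂ E z := fun z h1 h2 =>
    hE.differentiableAt (hopen.mem_nhds ⟨h1, h2⟩)
  -- The part `(1 - χ) E` of `E` extends smoothly by zero to the disc.
  set v : ℂ → ℂ := fun z => (1 - χ z) * E z with hv
  have hvs : ∀ z, ‖z‖ < 2 → ContDiffAt ℝ ∞ v z := by
    intro z hz
    rcases lt_or_ge ‖z‖ (3 / 4) with h | h
    · refine (contDiffAt_const (c := (0 : ℂ))).congr_of_eventuallyEq ?_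
      filter_upwards [hnear z h] with w hw
      simp [hv, hw]
    · exact (contDiffAt_const.sub hχ.contDiffAt).mul (hEs z (by linarith) hz)
  have hhz : ∀ z : ℂ, 3 / 2 < ‖z‖ → ∀ᶠ w in 𝓝 z, dbar χ w * E w = 0 := fun z hz => by
    filter_upwards [eventually_eventually_nhds.2 (hfar z hz)] with w hw
    rw [dbar_congr (g := fun _ => 0) hw, dbar_eq_zero (differentiableAt_const _), zero_mul]
  have hh1 : ContDiff ℝ 1 fun z => -(dbar χ z * E z) := by
    refine contDiff_iff_contDiffAt.2 fun z => ?_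
    rcases lt_or_ge ‖z‖ (3 / 4) with h | h
    · refine (contDiffAt_const (c := (0 : ℂ))).congr_of_eventuallyEq ?_
      filter_upwards [eventually_eventually_nhds.2 (hnear z h)] with w hw
      rw [dbar_congr (g := fun _ => 1) hw, dbar_eq_zero (differentiableAt_const _)]
      simp
    rcases lt_or_ge (3 / 2) ‖z‖ with h' | h'
    · refine (contDiffAt_const (c := (0 : ℂ))).congr_of_eventuallyEq ?_
      filter_upwards [hhz z h'] with w hw
      rw [hw, neg_zero]
    · exact ((contDiffAt_dbar hχ.contDiffAt).mul
        ((hEs z (by linarith) (by linarith)).of_le (by norm_cast))).neg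
  obtain ⟨u, hu, hue, C, R, hC⟩ := exists_dbar_eq (h := fun z => -(dbar χ z * E z))
    (HasCompactSupport.of_support_subset_isCompact (isCompact_closedBall 0 (3 / 2)) (by
      intro z hz
      by_contra hn
      refine hz ?_
      change -(dbar χ z * E z) = 0
      rw [(hhz z (by simpa using hn)).self_of_nhds, neg_zero])) hh1
  have hvd : ∀ z, ‖z‖ < 2 → dbar v z = -(dbar χ z * E z) := by
    intro z hz
    rcases lt_or_ge ‖z‖ (3 / 4) with h | h
    · rw [dbar_congr (g := fun _ => 0) (by filter_upwards [hnear z h] with w hw; simp [hv, hw]),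
        dbar_congr (g := fun _ => 1) (hnear z h), dbar_eq_zero (differentiableAt_const _),
        dbar_eq_zero (differentiableAt_const _)]
      simp
    · have hχd : DifferentiableAt ℝ χ z := hχ.differentiable (by simp) z
      have hEd := hdE z (by linarith) hz
      rw [hv, dbar_mul (f := fun w => 1 - χ w) ((differentiableAt_const _).sub hχd)
        (hEd.restrictScalars ℝ), dbar_eq_zero hEd, dbar_sub (f := fun _ => 1)
        (differentiableAt_const _) hχd, dbar_eq_zero (differentiableAt_const _)]
      ring
  have he₀ : ∀ z, ‖z‖ < 2 → DifferentiableAt ℂ (fun w => v w - u w) z := fun z hz => by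
    have h1 := (hvs z hz).differentiableAt (by simp)
    refine differentiableAt_of_dbar_eq_zero (h1.sub (hu z)) ?_
    rw [dbar_sub h1 (hu z), hvd z hz, hue]
    ring
  have he₁ : ∀ z, 1 / 2 < ‖z‖ → DifferentiableAt ℂ (fun w => χ w * E w + u w) z := by
    intro z hz
    rcases lt_or_ge ‖z‖ 2 with h | h
    · refine ((hdE z hz h).sub (he₀ z h)).congr_of_eventuallyEq (Eventually.of_forall fun w => ?_)
      simp only [hv, Pi.sub_apply]
      ring
    · have hf := hfar z (by linarith)
      refine DifferentiableAt.congr_of_eventuallyEq (f := u) ?_ (by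
        filter_upwards [hf] with w hw
        simp [hw])
      refine differentiableAt_of_dbar_eq_zero (hu z) ?_
      rw [hue, (hhz z (by linarith)).self_of_nhds, neg_zero]
  -- The singularity at infinity is removable because `u` is bounded there.
  set w₁ : ℂ → ℂ := fun y => χ y⁻¹ * E y⁻¹ + u y⁻¹ with hw₁
  have hw₁d : DifferentiableOn ℂ w₁ (Metric.ball 0 2 \ {0}) := by
    rintro y ⟨hy, hy0⟩
    have hy0 : y ≠ 0 := hy0
    have hpos : 0 < ‖y‖ := norm_pos_iff.2 hy0
    have hy2 : ‖y‖ < 2 := by simpa using hy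
    have : 1 / 2 < ‖y⁻¹‖ := by
      rw [norm_inv, one_div]
      exact (inv_lt_inv₀ (by norm_num) hpos).2 hy2
    exact ((he₁ _ this).comp y (differentiableAt_inv hy0)).differentiableWithinAt
  have hbdd : ∀ᶠ y in 𝓝[≠] (0 : ℂ), ‖w₁ y‖ ≤ C := by
    have ht : Tendsto (fun y : ℂ => ‖y⁻¹‖) (𝓝[≠] 0) atTop := by
      simpa only [norm_inv, Function.comp_def] using
        tendsto_inv_nhdsGT_zero.comp tendsto_norm_nhdsNE_zero
    filter_upwards [ht.eventually_ge_atTop R, ht.eventually_ge_atTop 2] with y h1 h2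
    simp only [hw₁]
    rw [hχ0 _ (by linarith), zero_mul, zero_add]
    exact hC _ h1
  refine ⟨fun z => v z - u z, Function.update w₁ 0 (limUnder (𝓝[≠] 0) w₁),
    fun z hz => (he₀ z (by simpa using hz)).differentiableWithinAt, ?_, fun z h1 h2 => ?_⟩
  · refine differentiableOn_update_limUnder_of_isLittleO (Metric.ball_mem_nhds 0 two_pos) hw₁d
      (Filter.IsBoundedUnder.isLittleO_sub_self_inv
        ⟨C + ‖w₁ 0‖, eventually_map.2 ?_⟩)
    filter_upwards [hbdd] with y hy using norm_sub_le_of_le hy le_rfl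
  · have : z⁻¹ ≠ 0 := inv_ne_zero (norm_pos_iff.1 (by linarith))
    rw [Function.update_of_ne this]
    simp only [hv, hw₁, inv_inv]
    ring

/-- A Taylor expansion with holomorphic remainder. -/
theorem exists_taylor_remainder {f : ℂ → ℂ} {Ω : Set ℂ} (hΩ : Ω ∈ 𝓝 0)
    (hf : DifferentiableOn ℂ f Ω) (N : ℕ) :
    ∃ (c₀ : ℂ) (c : ℤ → ℂ) (r : ℂ → ℂ), DifferentiableOn ℂ r Ω ∧
      ∀ y, f y = c₀ + ∑ n ∈ Finset.Icc (1 : ℤ) N, c n * y ^ n + y ^ (N + 1 : ℤ) * r y := by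
  induction N with
  | zero =>
    refine ⟨f 0, 0, dslope f 0, (differentiableOn_dslope hΩ).2 hf, fun y => ?_⟩
    have := sub_smul_dslope f 0 y
    simp only [sub_zero, smul_eq_mul] at this
    simp [this]
  | succ N ih =>
    obtain ⟨c₀, c, r, hr, h⟩ := ih
    refine ⟨c₀, fun n => if n = N + 1 then r 0 else c n, dslope r 0,
      (differentiableOn_dslope hΩ).2 hr, fun y => ?_⟩
    have h1 := sub_smul_dslope r 0 y
    simp only [sub_zero, smul_eq_mul] at h1
    have h2 : Finset.Icc (1 : ℤ) ((N + 1 : ℕ) : ℤ) = insert (N + 1 : ℤ) (Finset.Icc (1 : ℤ) N) := by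
      ext n
      simp only [Finset.mem_Icc, Finset.mem_insert]
      omega
    rw [h2, Finset.sum_insert (by simp), h y]
    dsimp only
    rw [if_pos rfl]
    have h3 : ∑ n ∈ Finset.Icc (1 : ℤ) N, (if n = N + 1 then r 0 else c n) * y ^ n =
        ∑ n ∈ Finset.Icc (1 : ℤ) N, c n * y ^ n :=
      Finset.sum_congr rfl fun n hn => by
        rw [if_neg (by have := (Finset.mem_Icc.1 hn).2; omega)]
    rw [h3]
    have h4 : y ^ ((N + 1 : ℕ) + 1 : ℤ) = y ^ (N + 1 : ℤ) * y := by
      norm_cast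
    rw [h4]
    linear_combination -y ^ (N + 1 : ℤ) * h1

/-- Laurent splitting with the first `M` terms of the principal part written out. -/
theorem exists_laurent_expansion {E : ℂ → ℂ}
    (hE : DifferentiableOn ℂ E {z | 1 / 2 < ‖z‖ ∧ ‖z‖ < 2}) {M : ℤ} (hM : -1 ≤ M) :
    ∃ (e r : ℂ → ℂ) (c : ℤ → ℂ), DifferentiableOn ℂ e (Metric.ball 0 2) ∧
      DifferentiableOn ℂ r (Metric.ball 0 2) ∧
      ∀ z, 1 / 2 < ‖z‖ → ‖z‖ < 2 →
        E z = e z + ∑ n ∈ Finset.Icc (1 : ℤ) M, c n * z ^ (-n) + z ^ (-(M + 1)) * r z⁻¹ := by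
  obtain ⟨e₀, e₁, h0, h1, h⟩ := exists_laurent_split hE
  rcases eq_or_lt_of_le hM with rfl | hM
  · refine ⟨e₀, e₁, 0, h0, h1, fun z hz hz' => ?_⟩
    simp [h z hz hz']
  · obtain ⟨N, rfl⟩ : ∃ N : ℕ, M = N := ⟨M.toNat, by omega⟩
    obtain ⟨c₀, c, r, hr, hc⟩ := exists_taylor_remainder (Metric.ball_mem_nhds 0 two_pos) h1 N
    refine ⟨fun z => e₀ z + c₀, r, c, h0.add (differentiableOn_const _), hr, fun z hz hz' => ?_⟩
    rw [h z hz hz', hc]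
    simp only [inv_zpow', add_assoc]

open CategoryTheory Opposite TopologicalSpace
open scoped OnePoint

/-! ### The charts of the sphere -/

/-- The inverse of the coordinate on the chart domain `U₀` (`e = false`) or `U₁` (`e = true`). -/
noncomputable def chart : Bool → ℂ → CP1
  | false => chart0
  | true => chart1

/-- The part of `V` in the chart `e`, in the coordinate of that chart. -/
def dom (e : Bool) (V : Opens CP1) : Set ℂ := {z | chart e z ∈ V}

theorem chart_eq (e : Bool) {z : ℂ} (hz : z ≠ 0) : chart e z = chart (!e) z⁻¹ := by
  cases e <;> simp [chart, chart0, chart1, hz]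

theorem continuous_chart (e : Bool) : Continuous (chart e) := by
  cases e
  · exact OnePoint.continuous_coe
  · refine continuous_iff_continuousAt.2 fun y => ?_
    rcases eq_or_ne y 0 with rfl | hy
    · refine continuousAt_iff_punctured_nhds.2 ?_
      have h0 : chart true 0 = (∞ : OnePoint ℂ) := by simp [chart, chart1]
      rw [h0]
      have h1 : Tendsto (fun y : ℂ => ((y⁻¹ : ℂ) : OnePoint ℂ)) (𝓝[≠] 0)
          (𝓝 (∞ : OnePoint ℂ)) := by
        refine OnePoint.tendsto_coe_infty.comp ?_
        rw [coclosedCompact_eq_cocompact, ← Metric.cobounded_eq_cocompact]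
        exact tendsto_inv₀_nhdsNE_zero
      refine h1.congr' ?_
      filter_upwards [self_mem_nhdsWithin] with y hy
      have hy' : y ≠ 0 := hy
      simp [chart, chart1, hy']
    · have h1 : ContinuousAt (fun y : ℂ => ((y⁻¹ : ℂ) : OnePoint ℂ)) y :=
        OnePoint.continuous_coe.continuousAt.comp (continuousAt_inv₀ hy)
      refine h1.congr ?_
      filter_upwards [isOpen_ne.mem_nhds hy] with w hw
      simp [chart, chart1, hw]

theorem isOpen_dom (e : Bool) (V : Opens CP1) : IsOpen (dom e V) :=
  V.isOpen.preimage (continuous_chart e)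

theorem inv_mem_dom {e : Bool} {V : Opens CP1} {z : ℂ} (hz : z ∈ dom e V) (h : z ≠ 0) :
    z⁻¹ ∈ dom (!e) V := by
  rwa [dom, mem_ofPred_eq, ← chart_eq e h]

theorem inv_mem_dom' {e : Bool} {V : Opens CP1} {z : ℂ} (hz : z ∈ dom (!e) V) (h : z ≠ 0) :
    z⁻¹ ∈ dom e V := by
  simpa using inv_mem_dom hz h

/-! ### Transition functions -/

/-- The transition matrix of the rank 2 bundle: if `u` are the components of a vector field at the
point with coordinate `z⁻¹` in one chart, then `trAt k z u` are its components in the other chart,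
in which that point has the coordinate `z`. -/
noncomputable def trAt (k : ℤ) (z : ℂ) : ℂ × ℂ →ₗ[ℂ] ℂ × ℂ where
  toFun u := (-(z ^ (2 - 2 * k) * u.1), z ^ (-2 * k) * u.2 - k * z ^ (1 - 2 * k) * u.1)
  map_add' u v := by
    simp only [Prod.fst_add, Prod.snd_add, Prod.mk_add_mk, Prod.mk.injEq]
    constructor <;> ring
  map_smul' r u := by
    simp only [Prod.smul_fst, Prod.smul_snd, smul_eq_mul, Prod.smul_mk, RingHom.id_apply,
      Prod.mk.injEq]
    constructor <;> ring

theorem trAt_apply (k : ℤ) (z : ℂ) (u : ℂ × ℂ) : trAt k z u =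
    (-(z ^ (2 - 2 * k) * u.1), z ^ (-2 * k) * u.2 - k * z ^ (1 - 2 * k) * u.1) := rfl

theorem trAt_trAt_inv (k : ℤ) {z : ℂ} (hz : z ≠ 0) (u : ℂ × ℂ) :
    trAt k z (trAt k z⁻¹ u) = u := by
  have h2 : z ^ (1 - 2 * k) = z ^ (2 - 2 * k) * z⁻¹ := by
    rw [← zpow_sub_one₀ hz]; congr 1; ring
  have h3 : z ^ (-2 * k) = z ^ (2 - 2 * k) * z⁻¹ * z⁻¹ := by
    rw [← zpow_sub_one₀ hz, ← zpow_sub_one₀ hz]; congr 1; ring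
  have hs : ∀ m : ℤ, z⁻¹ ^ (m - 1) = z⁻¹ ^ m * z := fun m => by
    rw [zpow_sub_one₀ (inv_ne_zero hz), inv_inv]
  have h4 : z⁻¹ ^ (1 - 2 * k) = z⁻¹ ^ (2 - 2 * k) * z := by
    rw [← hs]; congr 1; ring
  have h5 : z⁻¹ ^ (-2 * k) = z⁻¹ ^ (2 - 2 * k) * z * z := by
    rw [← hs, ← hs]; congr 1; ring
  have h1 : z ^ (2 - 2 * k) * z⁻¹ ^ (2 - 2 * k) = 1 := by
    rw [← mul_zpow, mul_inv_cancel₀ hz, one_zpow]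
  have h6 : z * z⁻¹ = 1 := mul_inv_cancel₀ hz
  ext
  · simp only [trAt_apply]
    linear_combination u.1 * h1
  · simp only [trAt_apply]
    rw [h2, h3, h4, h5]
    generalize z ^ (2 - 2 * k) = p at *
    generalize z⁻¹ ^ (2 - 2 * k) = q at *
    generalize z⁻¹ = w at *
    linear_combination (u.2 * (z * w) ^ 2 + k * u.1 * w * (1 - z * w)) * h1 +
      (u.2 * (z * w + 1) - k * u.1 * w) * h6

theorem differentiableAt_trAt (k : ℤ) {u : ℂ → ℂ × ℂ} {z : ℂ} (hz : z ≠ 0)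
    (hu : DifferentiableAt ℂ u z⁻¹) : DifferentiableAt ℂ (fun w => trAt k w (u w⁻¹)) z := by
  have h := hu.comp z (differentiableAt_inv hz)
  have hp : ∀ m : ℤ, DifferentiableAt ℂ (fun w : ℂ => w ^ m) z := fun m =>
    differentiableAt_zpow.2 (Or.inl hz)
  simp only [trAt_apply]
  exact (((hp _).mul h.fst).neg).prodMk (((hp _).mul h.snd).sub (((hp _).const_mul _).mul h.fst))

/-! ### Cohomology of the rank 2 bundle -/

/-- The functions representing the cohomology: for `2 ≤ k` the combinations of the monomials
`x⁻ⁿ` with `1 ≤ n ≤ 2k - 3` in the first component and `1 ≤ n ≤ 2k - 1` in the second. -/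
def IsPrincipal (k : ℤ) (P : ℂ → ℂ × ℂ) : Prop :=
  (2 ≤ k → ∃ c d : ℤ → ℂ, ∀ x, P x = (∑ n ∈ Finset.Icc 1 (2 * k - 3), c n * x ^ (-n),
    ∑ n ∈ Finset.Icc 1 (2 * k - 1), d n * x ^ (-n))) ∧ (k < 2 → P = 0)

theorem IsPrincipal.differentiableAt {k : ℤ} {P : ℂ → ℂ × ℂ} (hP : IsPrincipal k P) {z : ℂ}
    (hz : z ≠ 0) : DifferentiableAt ℂ P z := by
  rcases le_or_gt 2 k with hk | hk
  · obtain ⟨c, d, h⟩ := hP.1 hk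
    rw [funext h]
    have hp : ∀ m : ℤ, DifferentiableAt ℂ (fun w : ℂ => w ^ m) z := fun m =>
      differentiableAt_zpow.2 (Or.inl hz)
    exact (DifferentiableAt.fun_sum fun n _ => (hp _).const_mul _).prodMk
      (DifferentiableAt.fun_sum fun n _ => (hp _).const_mul _)
  · rw [hP.2 hk]
    exact differentiableAt_const _

/-- The cohomology of the cover of the sphere by the discs `|x| < 2` and `|y| < 2`: up to the
functions `P` a holomorphic section over the annulus is a coboundary. For `k = 1` the residue of
the second component is removed by a constant first component, by way of the off-diagonal entry
of the transition matrix. -/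
theorem exists_annulus_decomposition (k : ℤ) {E : ℂ → ℂ × ℂ}
    (hE : DifferentiableOn ℂ E {z | 1 / 2 < ‖z‖ ∧ ‖z‖ < 2}) :
    ∃ G₀ G₁ P : ℂ → ℂ × ℂ, DifferentiableOn ℂ G₀ (Metric.ball 0 2) ∧
      DifferentiableOn ℂ G₁ (Metric.ball 0 2) ∧ IsPrincipal k P ∧
      ∀ z, 1 / 2 < ‖z‖ → ‖z‖ < 2 → G₀ z = trAt k z (G₁ z⁻¹) + P z + E z := by
  have hne : ∀ z : ℂ, 1 / 2 < ‖z‖ → z ≠ 0 := fun z hz => norm_pos_iff.1 (by linarith)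
  have hinv : ∀ z : ℂ, 1 / 2 < ‖z‖ → z⁻¹ ∈ Metric.ball (0 : ℂ) 2 := fun z hz => by
    have : 0 < ‖z‖ := by linarith
    simp only [Metric.mem_ball, dist_zero_right, norm_inv]
    rw [inv_lt_comm₀ this two_pos]
    simpa using hz
  -- The error term in the second component, after the first has been corrected by `g`.
  have hE2 : ∀ g : ℂ → ℂ, DifferentiableOn ℂ g (Metric.ball 0 2) →
      DifferentiableOn ℂ (fun z => (E z).2 - k * z ^ (1 - 2 * k) * g z⁻¹)
        {z | 1 / 2 < ‖z‖ ∧ ‖z‖ < 2} := by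
    intro g hg z hz
    have h1 : DifferentiableAt ℂ g z⁻¹ := hg.differentiableAt
      (Metric.isOpen_ball.mem_nhds (hinv z hz.1))
    have h2 := h1.comp z (differentiableAt_inv (hne z hz.1))
    have hp : DifferentiableAt ℂ (fun w : ℂ => w ^ (1 - 2 * k)) z :=
      differentiableAt_zpow.2 (Or.inl (hne z hz.1))
    exact (hE z hz).snd.sub ((hp.const_mul _).mul h2).differentiableWithinAt
  rcases le_or_gt 2 k with hk | hk
  · obtain ⟨e, r, c, he, hr, h⟩ := exists_laurent_expansion hE.fst (M := 2 * k - 3) (by omega)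
    obtain ⟨e', r', d, he', hr', h'⟩ := exists_laurent_expansion (hE2 r hr) (M := 2 * k - 1)
      (by omega)
    refine ⟨fun z => (e z, e' z), fun y => (r y, -r' y), fun x =>
      (∑ n ∈ Finset.Icc 1 (2 * k - 3), (-c n) * x ^ (-n),
        ∑ n ∈ Finset.Icc 1 (2 * k - 1), (-d n) * x ^ (-n)), he.prodMk he', hr.prodMk hr'.neg,
      ⟨fun _ => ⟨_, _, fun x => rfl⟩, fun h => absurd hk (not_le.2 h)⟩, fun z hz hz' => ?_⟩
    have h1 := h z hz hz'
    have h2 := h' z hz hz'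
    rw [show -(2 * k - 3 + 1) = 2 - 2 * k by ring] at h1
    rw [show -(2 * k - 1 + 1) = -2 * k by ring] at h2
    simp only [neg_mul, Finset.sum_neg_distrib]
    ext
    · simp only [trAt_apply, Prod.fst_add]
      linear_combination -h1
    · simp only [trAt_apply, Prod.snd_add]
      simp only [neg_mul] at h2 ⊢
      linear_combination -h2
  obtain ⟨e, r, c, he, hr, h⟩ := exists_laurent_expansion hE.fst (M := -1) le_rfl
  rcases eq_or_ne k 1 with rfl | hk1
  · obtain ⟨e', r', d, he', hr', h'⟩ := exists_laurent_expansion (hE2 r hr) (M := 1) (by omega)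
    refine ⟨fun z => (e z - d 1, e' z), fun y => (r y + d 1, -r' y), 0,
      (he.sub (differentiableOn_const _)).prodMk he',
      (hr.add (differentiableOn_const _)).prodMk hr'.neg,
      ⟨fun h => by omega, fun _ => rfl⟩, fun z hz hz' => ?_⟩
    have h1 := h z hz hz'
    have h2 := h' z hz hz'
    norm_num at h1 h2
    ext
    · simp [trAt_apply]
      linear_combination -h1
    · simp [trAt_apply]
      linear_combination -h2
  · have hk0 : k ≤ 0 := by omega
    have hg : DifferentiableOn ℂ (fun y => y ^ (2 - 2 * k) * r y) (Metric.ball 0 2) :=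
      DifferentiableOn.mul (fun y _ => (differentiableAt_zpow.2
        (Or.inr (by omega))).differentiableWithinAt) hr
    obtain ⟨e', r', d, he', hr', h'⟩ := exists_laurent_expansion (hE2 _ hg) (M := -1) le_rfl
    have hg' : DifferentiableOn ℂ (fun y => -(y ^ (-2 * k) * r' y)) (Metric.ball 0 2) :=
      (DifferentiableOn.mul (fun y _ => (differentiableAt_zpow.2
        (Or.inr (by omega))).differentiableWithinAt) hr').neg
    refine ⟨fun z => (e z, e' z), fun y => (y ^ (2 - 2 * k) * r y, -(y ^ (-2 * k) * r' y)), 0,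
      he.prodMk he', hg.prodMk hg', ⟨fun h => by omega, fun _ => rfl⟩, fun z hz hz' => ?_⟩
    have h1 := h z hz hz'
    have h2 := h' z hz hz'
    have hz0 := hne z hz
    have hc : ∀ m : ℤ, z ^ m * z⁻¹ ^ m = 1 := fun m => by
      rw [← mul_zpow, mul_inv_cancel₀ hz0, one_zpow]
    have h3 := hc (2 - 2 * k)
    have h4 := hc (-2 * k)
    have hs : Finset.Icc (1 : ℤ) (-1) = ∅ := rfl
    simp only [hs, Finset.sum_empty, add_zero, neg_add_cancel, neg_zero, zpow_zero,
      one_mul] at h1 h2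
    ext
    · simp only [trAt_apply, Prod.fst_add, Pi.zero_apply, Prod.fst_zero]
      linear_combination -h1 + r z⁻¹ * h3
    · simp only [trAt_apply, Prod.snd_add, Pi.zero_apply, Prod.snd_zero]
      simp only [neg_mul] at h4 ⊢
      linear_combination -h2 + r' z⁻¹ * h4

theorem differentiableOn_ite_norm_lt {Ω : Set ℂ} (hΩ : IsOpen Ω) {A B : ℂ → ℂ × ℂ}
    (hA : ∀ z ∈ Ω, ‖z‖ < 2 → DifferentiableAt ℂ A z)
    (hB : ∀ z ∈ Ω, 1 / 2 < ‖z‖ → DifferentiableAt ℂ B z)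
    (h : ∀ z ∈ Ω, 1 / 2 < ‖z‖ → ‖z‖ < 2 → A z = B z) :
    DifferentiableOn ℂ (fun z => if ‖z‖ < 2 then A z else B z) Ω := by
  intro z hz
  refine DifferentiableAt.differentiableWithinAt ?_
  rcases lt_or_ge ‖z‖ 2 with h2 | h2
  · refine (hA z hz h2).congr_of_eventuallyEq ?_
    filter_upwards [(isOpen_lt continuous_norm continuous_const).mem_nhds h2] with w hw
    have hw : ‖w‖ < 2 := hw
    rw [if_pos hw]
  · have h1 : 1 / 2 < ‖z‖ := by linarith
    refine (hB z hz h1).congr_of_eventuallyEq ?_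
    filter_upwards [(isOpen_lt continuous_const continuous_norm).mem_nhds h1, hΩ.mem_nhds hz]
      with w hw hwΩ
    split_ifs with hw2
    · exact h w hwΩ hw hw2
    · rfl

/-- Every cocycle of the rank 2 bundle is, up to a function `P` on `U₀ ∩ U₁`, the coboundary of
a cochain whose components in the two charts differ by `P`. -/
theorem exists_primitive (k : ℤ) {ι : Type} {U : ι → Opens CP1} (hU : ∀ p, ∃ i, p ∈ U i)
    {c : Bool → ι → ι → ℂ → ℂ × ℂ}
    (hc : ∀ e i j, DifferentiableOn ℂ (c e i j) (dom e (U i ⊓ U j)))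
    (hcc : ∀ e i j m, ∀ z ∈ dom e (U i ⊓ U j ⊓ U m), c e i j z + c e j m z = c e i m z)
    (ht : ∀ e i j, ∀ z ∈ dom e (U i ⊓ U j), z ≠ 0 → c e i j z = trAt k z (c (!e) i j z⁻¹)) :
    ∃ (P : ℂ → ℂ × ℂ) (g : Bool → ι → ℂ → ℂ × ℂ), IsPrincipal k P ∧
      (∀ e i, DifferentiableOn ℂ (g e i) (dom e (U i))) ∧
      (∀ e i j, ∀ z ∈ dom e (U i ⊓ U j), g e j z - g e i z = c e i j z) ∧
      ∀ i, ∀ z ∈ dom false (U i), z ≠ 0 → g false i z = trAt k z (g true i z⁻¹) + P z := by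
  have hloc : ∀ e, ∃ f : ι → ℂ → ℂ × ℂ,
      (∀ i, DifferentiableOn ℂ (f i) (dom e (U i) ∩ Metric.ball 0 2)) ∧
      ∀ i j, ∀ z ∈ dom e (U i) ∩ dom e (U j) ∩ Metric.ball 0 2, f j z - f i z = c e i j z := by
    intro e
    obtain ⟨g, hg, hg'⟩ := exists_cousin (U := fun i => dom e (U i)) (fun i => isOpen_dom e _)
      (fun z => hU (chart e z)) (fun i j => (hc e i j).fst)
      (fun i j m z hz => congrArg Prod.fst (hcc e i j m z hz)) 2
    obtain ⟨h, hh, hh'⟩ := exists_cousin (U := fun i => dom e (U i)) (fun i => isOpen_dom e _)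
      (fun z => hU (chart e z)) (fun i j => (hc e i j).snd)
      (fun i j m z hz => congrArg Prod.snd (hcc e i j m z hz)) 2
    exact ⟨fun i z => (g i z, h i z), fun i => (hg i).prodMk (hh i), fun i j z hz =>
      Prod.ext (hg' i j z hz) (hh' i j z hz)⟩
  choose f hf hfc using hloc
  have hball : ∀ z : ℂ, ‖z‖ < 2 → z ∈ Metric.ball (0 : ℂ) 2 := fun z hz => by simpa using hz
  have hinv : ∀ z : ℂ, 1 / 2 < ‖z‖ → ‖z⁻¹‖ < 2 := fun z hz => by
    have : 0 < ‖z‖ := by linarith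
    rw [norm_inv, inv_lt_comm₀ this two_pos]
    simpa using hz
  have hinv' : ∀ z : ℂ, z ≠ 0 → ‖z‖ < 2 → 1 / 2 < ‖z⁻¹‖ := fun z h0 hz => by
    have : 0 < ‖z‖ := norm_pos_iff.2 h0
    rw [norm_inv, lt_inv_comm₀ (by norm_num) this]
    simpa using hz
  have hne : ∀ z : ℂ, 1 / 2 < ‖z‖ → z ≠ 0 := fun z hz => norm_pos_iff.1 (by linarith)
  have hfd : ∀ e i z, z ∈ dom e (U i) → ‖z‖ < 2 → DifferentiableAt ℂ (f e i) z :=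
    fun e i z hz hz2 => (hf e i).differentiableAt
      (((isOpen_dom e _).inter Metric.isOpen_ball).mem_nhds ⟨hz, hball z hz2⟩)
  have hfd' : ∀ i z, z ∈ dom false (U i) → 1 / 2 < ‖z‖ →
      DifferentiableAt ℂ (fun w => trAt k w (f true i w⁻¹)) z := fun i z hz h =>
    differentiableAt_trAt k (hne z h)
      (hfd true i _ (inv_mem_dom hz (hne z h)) (hinv z h))
  choose idx hidx using fun z => hU (chart false z)
  -- The difference of the two local primitives over the annulus does not depend on the index.
  set E : ℂ → ℂ × ℂ := fun z => trAt k z (f true (idx z) z⁻¹) - f false (idx z) z with hEdef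
  have hEi : ∀ i z, z ∈ dom false (U i) → 1 / 2 < ‖z‖ → ‖z‖ < 2 →
      E z = trAt k z (f true i z⁻¹) - f false i z := by
    intro i z hz h1 h2
    have e0 := hfc false i (idx z) z ⟨⟨hz, hidx z⟩, hball z h2⟩
    have e1 := hfc true i (idx z) z⁻¹ ⟨⟨inv_mem_dom hz (hne z h1),
      inv_mem_dom (e := false) (hidx z) (hne z h1)⟩, hball _ (hinv z h1)⟩
    have e2 := ht false i (idx z) z ⟨hz, hidx z⟩ (hne z h1)
    rw [Bool.not_false, ← e1, ← e0, map_sub] at e2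
    simp only [hEdef]
    rw [sub_eq_sub_iff_add_eq_add] at e2 ⊢
    exact e2.symm.trans (add_comm _ _)
  have hE : DifferentiableOn ℂ E {z | 1 / 2 < ‖z‖ ∧ ‖z‖ < 2} := by
    rintro z ⟨h1, h2⟩
    refine DifferentiableAt.differentiableWithinAt ?_
    refine ((hfd' (idx z) z (hidx z) h1).sub (hfd false (idx z) z (hidx z)
      h2)).congr_of_eventuallyEq ?_
    filter_upwards [(isOpen_dom false (U (idx z))).mem_nhds (hidx z),
      (isOpen_lt continuous_const continuous_norm).mem_nhds h1,
      (isOpen_lt continuous_norm continuous_const).mem_nhds h2] with w hw hw1 hw2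
    exact hEi _ w hw hw1 hw2
  obtain ⟨G₀, G₁, P, hG₀, hG₁, hP, hG⟩ := exists_annulus_decomposition k hE
  set G : Bool → ℂ → ℂ × ℂ := fun e => bif e then G₁ else G₀ with hGdef
  set Q : Bool → ℂ → ℂ × ℂ := fun e z => bif e then -trAt k z (P z⁻¹) else P z with hQdef
  have hGd : ∀ e, DifferentiableOn ℂ (G e) (Metric.ball 0 2) := by
    rintro (_ | _)
    exacts [hG₀, hG₁]
  have hQd : ∀ e z, z ≠ 0 → DifferentiableAt ℂ (Q e) z := by
    rintro (_ | _) z hz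
    · exact hP.differentiableAt hz
    · exact (differentiableAt_trAt k hz (hP.differentiableAt (inv_ne_zero hz))).neg
  have hfal : ∀ i z, z ∈ dom false (U i) → 1 / 2 < ‖z‖ → ‖z‖ < 2 →
      f false i z + G₀ z = trAt k z (f true i z⁻¹ + G₁ z⁻¹) + P z := by
    intro i z hz h1 h2
    rw [hG z h1 h2, hEi i z hz h1 h2, map_add]
    abel
  have hagree : ∀ e i z, z ∈ dom e (U i) → 1 / 2 < ‖z‖ → ‖z‖ < 2 →
      f e i z + G e z = trAt k z (f (!e) i z⁻¹ + G (!e) z⁻¹) + Q e z := by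
    rintro (_ | _) i z hz h1 h2
    · exact hfal i z hz h1 h2
    · have h := hfal i z⁻¹ (inv_mem_dom hz (hne z h1)) (hinv' z (hne z h1) h2) (hinv z h1)
      simp only [hGdef, hQdef, Bool.not_true, cond_true, cond_false]
      rw [h, inv_inv, map_add (trAt k z), trAt_trAt_inv k (hne z h1)]
      abel
  set g : Bool → ι → ℂ → ℂ × ℂ := fun e i z => if ‖z‖ < 2 then f e i z + G e z else
    trAt k z (f (!e) i z⁻¹ + G (!e) z⁻¹) + Q e z with hg
  have hgin : ∀ e i z, ‖z‖ < 2 → g e i z = f e i z + G e z := fun e i z h => if_pos h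
  have hgout : ∀ e i z, z ∈ dom e (U i) → 1 / 2 < ‖z‖ →
      g e i z = trAt k z (f (!e) i z⁻¹ + G (!e) z⁻¹) + Q e z := by
    intro e i z hz h1
    rcases lt_or_ge ‖z‖ 2 with h | h
    · rw [hgin e i z h, hagree e i z hz h1 h]
    · exact if_neg (not_lt.2 h)
  have hcases : ∀ z : ℂ, ‖z‖ < 2 ∨ 1 / 2 < ‖z‖ := fun z => by
    rcases lt_or_ge ‖z‖ 2 with h | h
    · exact Or.inl h
    · exact Or.inr (by linarith)
  refine ⟨P, g, hP, fun e i => ?_, fun e i j z hz => ?_, fun i z hz h0 => ?_⟩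
  · refine differentiableOn_ite_norm_lt (isOpen_dom e _) (fun z hz h => ?_) (fun z hz h => ?_)
      (hagree e i)
    · exact (hfd e i z hz h).add ((hGd e).differentiableAt
        (Metric.isOpen_ball.mem_nhds (hball z h)))
    · refine (differentiableAt_trAt k (u := fun w => f (!e) i w + G (!e) w) (hne z h)
        (((hfd _ i _ (inv_mem_dom hz (hne z h)) (hinv z h))).add ((hGd _).differentiableAt
          (Metric.isOpen_ball.mem_nhds (hball _ (hinv z h)))))).add (hQd e z (hne z h))
  · rcases hcases z with h | h
    · rw [hgin e i z h, hgin e j z h, ← hfc e i j z ⟨hz, hball z h⟩]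
      abel
    · rw [hgout e i z hz.1 h, hgout e j z hz.2 h, ht e i j z hz (hne z h),
        ← hfc (!e) i j z⁻¹ ⟨inv_mem_dom (V := U i ⊓ U j) hz (hne z h), hball _ (hinv z h)⟩]
      simp only [map_add, map_sub]
      abel
  · rcases hcases z with h | h
    · rw [hgin false i z h, hgout true i z⁻¹ (inv_mem_dom hz h0) (hinv' z h0 h)]
      simp only [hQdef, hGdef, Bool.not_true, cond_true, cond_false, inv_inv]
      rw [map_add, trAt_trAt_inv k h0, map_neg, trAt_trAt_inv k h0]
      abel
    · rw [hgout false i z hz h, hgin true i _ (hinv z h)]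
      rfl

/-! ### The Grassmann algebra -/

/-- The smaller of the two indices different from `l`. -/
def lo (l : Fin 3) : Fin 3 := if l = 0 then 1 else 0

/-- The larger of the two indices different from `l`. -/
def hi (l : Fin 3) : Fin 3 := if l = 2 then 1 else 2

theorem eq_lo_hi {i j l : Fin 3} (hij : i < j) (hi' : l ≠ i) (hj : l ≠ j) :
    i = lo l ∧ j = hi l := by
  revert i j l; decide

/-- `ξ_i ξ_j` for `{i < j}` the complement of `l`. -/
noncomputable def quad (l : Fin 3) : Gr := ξ (lo l) * ξ (hi l)

/-- `ξ_i ξ_j ξ_l` for `{i < j}` the complement of `l`. -/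
noncomputable def top (l : Fin 3) : Gr := ξ (lo l) * ξ (hi l) * ξ l

theorem monomials_image {n : ℕ} {f : Fin n → Fin 3} (hf : StrictMono f) :
    monomials (Finset.univ.image f) =
      ExteriorAlgebra.ιMulti ℂ n (fun m => Pi.single (f m) (1 : ℂ)) := by
  have hcard : (Finset.univ.image f).card = n := by
    rw [Finset.card_image_of_injective _ hf.injective]; simp
  rw [monomials, ExteriorAlgebra.basis_apply_ofCard (n := n) _ hcard,
    ExteriorAlgebra.ιMulti_family]
  congr 1
  have := Finset.orderEmbOfFin_unique hcard (f := f) (fun x => by simp) hf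
  ext m : 1
  simp only [Function.comp_apply, Set.powersetCard.ofFinEmbEquiv_symm_apply, Pi.basisFun_apply]
  exact congrArg (fun a => (Pi.single a 1 : Fin 3 → ℂ)) (congrFun this m).symm

theorem monomials_empty : monomials ∅ = 1 := by
  have := monomials_image (f := (![] : Fin 0 → Fin 3)) (fun a => a.elim0)
  simpa using this

theorem monomials_singleton (m : Fin 3) : monomials {m} = ξ m := by
  have := monomials_image (f := ![m]) (fun a b h => by omega)
  rw [ExteriorAlgebra.ιMulti_succ_apply] at this
  simpa [ξ] using this

theorem monomials_compl (l : Fin 3) : monomials {l}ᶜ = quad l := by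
  have h : StrictMono ![lo l, hi l] := by
    revert l; decide
  have h' : ({l}ᶜ : Finset (Fin 3)) = Finset.univ.image ![lo l, hi l] := by
    revert l; decide
  rw [h', monomials_image h, ExteriorAlgebra.ιMulti_succ_apply, ExteriorAlgebra.ιMulti_succ_apply]
  simp [ξ, quad, Matrix.vecTail]

theorem monomials_univ : monomials Finset.univ = ξ 0 * ξ 1 * ξ 2 := by
  have h' : (Finset.univ : Finset (Fin 3)) = Finset.univ.image ![0, 1, 2] := by decide
  have h : StrictMono (![0, 1, 2] : Fin 3 → Fin 3) := by decide
  rw [h', monomials_image h, ExteriorAlgebra.ιMulti_succ_apply, ExteriorAlgebra.ιMulti_succ_apply,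
    ExteriorAlgebra.ιMulti_succ_apply]
  simp [ξ, Matrix.vecTail, mul_assoc]

theorem ι_eq_sum (v : Fin 3 → ℂ) : ExteriorAlgebra.ι ℂ v = ∑ m, v m • ξ m := by
  conv_lhs => rw [pi_eq_sum_univ' v]
  simp only [map_sum, map_smul, ξ]

theorem ξ_mul_self (m : Fin 3) : ξ m * ξ m = 0 := ExteriorAlgebra.ι_sq_zero _

theorem ξ_mul_comm (m n : Fin 3) : ξ m * ξ n = -(ξ n * ξ m) :=
  eq_neg_of_add_eq_zero_left (ExteriorAlgebra.ι_add_mul_swap _ _)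

theorem ξ_mul_mul_self (m n : Fin 3) : ξ m * (ξ n * ξ m) = 0 := by
  rw [ξ_mul_comm n m, mul_neg, ← mul_assoc, ξ_mul_self, zero_mul, neg_zero]

theorem quad_mul_ξ (l m : Fin 3) : quad l * ξ m = if m = l then top l else 0 := by
  split_ifs with h
  · rw [h]; rfl
  · have : m = lo l ∨ m = hi l := by revert l m; decide
    rcases this with rfl | rfl
    · rw [quad, mul_assoc, ξ_mul_mul_self]
    · rw [quad, mul_assoc, ξ_mul_self, mul_zero]

theorem ξ_mul_quad (l m : Fin 3) : ξ m * quad l = if m = l then top l else 0 := by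
  rw [← quad_mul_ξ, quad, ← mul_assoc, ξ_mul_comm m, neg_mul, mul_assoc, ξ_mul_comm m, mul_neg,
    neg_neg, mul_assoc]

theorem top_mul_ξ (l m : Fin 3) : top l * ξ m = 0 := by
  have h : top l * ξ m = quad l * (ξ l * ξ m) := by rw [top, quad, mul_assoc]
  by_cases hm : m = l
  · rw [h, hm, ξ_mul_self, mul_zero]
  · rw [h, ξ_mul_comm, mul_neg, ← mul_assoc, quad_mul_ξ, if_neg hm, zero_mul, neg_zero]

theorem ξ_mul_top (l m : Fin 3) : ξ m * top l = 0 := by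
  have h : ξ m * top l = ξ m * quad l * ξ l := by simp only [top, quad, mul_assoc]
  rw [h, ξ_mul_quad]
  split_ifs
  · exact top_mul_ξ l l
  · rw [zero_mul]

theorem quad_mul_ι (l : Fin 3) (v : Fin 3 → ℂ) : quad l * ExteriorAlgebra.ι ℂ v = v l • top l := by
  rw [ι_eq_sum, Finset.mul_sum]
  simp [quad_mul_ξ]

theorem ι_mul_quad (l : Fin 3) (v : Fin 3 → ℂ) : ExteriorAlgebra.ι ℂ v * quad l = v l • top l := by
  rw [ι_eq_sum, Finset.sum_mul]
  simp [ξ_mul_quad]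

theorem top_mul_ι (l : Fin 3) (v : Fin 3 → ℂ) : top l * ExteriorAlgebra.ι ℂ v = 0 := by
  rw [ι_eq_sum, Finset.mul_sum]
  simp [top_mul_ξ]

theorem ι_mul_top (l : Fin 3) (v : Fin 3 → ℂ) : ExteriorAlgebra.ι ℂ v * top l = 0 := by
  rw [ι_eq_sum, Finset.sum_mul]
  simp [ξ_mul_top]

/-- The sign relating `ξ_i ξ_j ξ_l` to `ξ_0 ξ_1 ξ_2`. -/
def sgn (l : Fin 3) : ℂ := if l = 1 then -1 else 1

theorem sgn_mul_sgn (l : Fin 3) : sgn l * sgn l = 1 := by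
  unfold sgn; split_ifs <;> norm_num

theorem monomials_univ_eq (l : Fin 3) : monomials Finset.univ = sgn l • top l := by
  have hl : l = 0 ∨ l = 1 ∨ l = 2 := by omega
  rw [monomials_univ]
  rcases hl with rfl | rfl | rfl
  · change _ = sgn 0 • (ξ 1 * ξ 2 * ξ 0)
    rw [mul_assoc (ξ 1), ξ_mul_comm 2 0, mul_neg, ← mul_assoc, ξ_mul_comm 1 0]
    simp [sgn]
  · change _ = sgn 1 • (ξ 0 * ξ 2 * ξ 1)
    rw [mul_assoc, ξ_mul_comm 1 2, mul_neg, ← mul_assoc]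
    simp [sgn]
  · change _ = sgn 2 • (ξ 0 * ξ 1 * ξ 2)
    simp [sgn]

theorem top_eq (l : Fin 3) : top l = sgn l • monomials Finset.univ := by
  rw [monomials_univ_eq l, smul_smul, sgn_mul_sgn, one_smul]

theorem repr_quad (l l' : Fin 3) :
    monomials.repr (quad l) {l'}ᶜ = if l' = l then 1 else 0 := by
  rw [← monomials_compl, Module.Basis.repr_self, Finsupp.single_apply]
  simp only [compl_inj_iff, Finset.singleton_inj, eq_comm]

theorem repr_top (l : Fin 3) : monomials.repr (top l) Finset.univ = sgn l := by
  rw [top_eq, map_smul, Module.Basis.repr_self]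
  simp

theorem monomials_mem (S : Finset (Fin 3)) : monomials S ∈ ⋀[ℂ]^S.card (Fin 3 → ℂ) := by
  rw [monomials, ExteriorAlgebra.basis_apply]
  exact ExteriorAlgebra.ιMulti_range ℂ _ ⟨_, rfl⟩

theorem repr_eq_zero {q : ℕ} {x : Gr} (hx : x ∈ ⋀[ℂ]^q (Fin 3 → ℂ)) {S : Finset (Fin 3)}
    (hS : S.card ≠ q) : monomials.repr x S = 0 := by
  have hsum := ((Pi.basisFun ℂ (Fin 3)).exteriorPower q).sum_repr ⟨x, hx⟩
  have hsum' := congrArg (Submodule.subtype _) hsum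
  rw [map_sum] at hsum'
  simp only [Submodule.subtype_apply, Submodule.coe_smul,
    ← ExteriorAlgebra.basis_eq_coe_basis] at hsum'
  rw [← hsum', map_sum, Finsupp.finsetSum_apply]
  refine Finset.sum_eq_zero fun T _ => ?_
  rw [map_smul, ← monomials, Module.Basis.repr_self, Finsupp.smul_apply, Finsupp.single_apply,
    if_neg, smul_zero]
  intro h
  exact hS (h ▸ T.2)

theorem mem_of_repr {q : ℕ} {x : Gr} (h : ∀ S, S.card ≠ q → monomials.repr x S = 0) :
    x ∈ ⋀[ℂ]^q (Fin 3 → ℂ) := by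
  rw [← monomials.sum_repr x]
  refine Submodule.sum_mem _ fun S _ => ?_
  by_cases hS : S.card = q
  · exact Submodule.smul_mem _ _ (hS ▸ monomials_mem S)
  · rw [h S hS, zero_smul]
    exact Submodule.zero_mem _

theorem ι_mul_mem {q : ℕ} (v : Fin 3 → ℂ) {x : Gr} (hx : x ∈ ⋀[ℂ]^q (Fin 3 → ℂ)) :
    ExteriorAlgebra.ι ℂ v * x ∈ ⋀[ℂ]^(q + 1) (Fin 3 → ℂ) := by
  rw [ExteriorAlgebra.exteriorPower, pow_succ']
  exact Submodule.mul_mem_mul ⟨v, rfl⟩ hx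

theorem repr_one {S : Finset (Fin 3)} : monomials.repr 1 S = if S = ∅ then 1 else 0 := by
  rw [← monomials_empty, Module.Basis.repr_self, Finsupp.single_apply]
  simp only [eq_comm]

theorem repr_one_empty : monomials.repr 1 ∅ = 1 := by
  rw [repr_one, if_pos rfl]

theorem repr_ι_mul_empty (v : Fin 3 → ℂ) (x : Gr) :
    monomials.repr (ExteriorAlgebra.ι ℂ v * x) ∅ = 0 := by
  conv_lhs => rw [← monomials.sum_repr x, Finset.mul_sum]
  simp only [mul_smul_comm, map_sum, map_smul, Finsupp.finsetSum_apply, Finsupp.smul_apply]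
  refine Finset.sum_eq_zero fun S _ => ?_
  rw [repr_eq_zero (ι_mul_mem v (monomials_mem S)) (by simp), smul_zero]

theorem repr_ξ (m l : Fin 3) : monomials.repr (ξ m) {l} = if m = l then 1 else 0 := by
  rw [← monomials_singleton, Module.Basis.repr_self, Finsupp.single_apply]
  simp only [Finset.singleton_inj]

theorem repr_ι_mul_singleton (v : Fin 3 → ℂ) (x : Gr) (l : Fin 3) :
    monomials.repr (ExteriorAlgebra.ι ℂ v * x) {l} = v l * monomials.repr x ∅ := by
  conv_lhs => rw [← monomials.sum_repr x, Finset.mul_sum]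
  simp only [mul_smul_comm, map_sum, map_smul, Finsupp.finsetSum_apply, Finsupp.smul_apply]
  rw [Finset.sum_eq_single ∅]
  · rw [monomials_empty, mul_one, ι_eq_sum]
    simp [repr_ξ, mul_comm]
  · intro S _ hS
    rw [repr_eq_zero (ι_mul_mem v (monomials_mem S)) (by simpa using hS), smul_zero]
  · simp

/-- Induction by left multiplication with vectors. -/
@[elab_as_elim]
theorem Gr.induction {p : Gr → Prop} (one : p 1) (add : ∀ x y, p x → p y → p (x + y))
    (smul : ∀ (r : ℂ) x, p x → p (r • x))
    (ι_mul : ∀ (v : Fin 3 → ℂ) x, p x → p (ExteriorAlgebra.ι ℂ v * x)) (x : Gr) : p x := by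
  refine CliffordAlgebra.left_induction (Q := (0 : QuadraticForm ℂ (Fin 3 → ℂ))) (P := p)
    (fun r => ?_) (fun x y => add x y) (fun x v => ι_mul v x) x
  change p (algebraMap ℂ Gr r)
  rw [Algebra.algebraMap_eq_smul_one]
  exact smul _ _ one

theorem repr_one_singleton (l : Fin 3) : monomials.repr 1 {l} = 0 := by
  rw [repr_one, if_neg (by simp)]

theorem repr_mul_empty (x y : Gr) :
    monomials.repr (x * y) ∅ = monomials.repr x ∅ * monomials.repr y ∅ := by
  induction x using Gr.induction with
  | one => rw [one_mul, repr_one_empty, one_mul]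
  | add x z hx hz => simp [add_mul, hx, hz]
  | smul r x hx => simp [hx, mul_assoc]
  | ι_mul v x hx => rw [mul_assoc, repr_ι_mul_empty, repr_ι_mul_empty, zero_mul]

theorem repr_mul_singleton (x y : Gr) (l : Fin 3) : monomials.repr (x * y) {l} =
    monomials.repr x {l} * monomials.repr y ∅ + monomials.repr x ∅ * monomials.repr y {l} := by
  induction x using Gr.induction with
  | one => simp [repr_one_empty, repr_one_singleton]
  | add x z hx hz => simp [add_mul, hx, hz]; ring
  | smul r x hx => simp [hx]; ring
  | ι_mul v x hx =>
    rw [mul_assoc, repr_ι_mul_singleton, repr_ι_mul_singleton, repr_ι_mul_empty, repr_mul_empty]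
    ring

theorem top_mul (l : Fin 3) (x : Gr) : top l * x = monomials.repr x ∅ • top l := by
  induction x using Gr.induction with
  | one => simp [repr_one_empty]
  | add x z hx hz => simp [mul_add, hx, hz, add_smul]
  | smul r x hx => simp [hx, smul_smul]
  | ι_mul v x hx => rw [← mul_assoc, top_mul_ι, zero_mul, repr_ι_mul_empty, zero_smul]

theorem mul_top (l : Fin 3) (x : Gr) : x * top l = monomials.repr x ∅ • top l := by
  induction x using Gr.induction with
  | one => simp [repr_one_empty]
  | add x z hx hz => simp [add_mul, hx, hz, add_smul]
  | smul r x hx => simp [hx, smul_smul]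
  | ι_mul v x hx =>
    rw [mul_assoc, hx, mul_smul_comm, ι_mul_top, repr_ι_mul_empty, zero_smul, smul_zero]

theorem quad_mul (l : Fin 3) (x : Gr) :
    quad l * x = monomials.repr x ∅ • quad l + monomials.repr x {l} • top l := by
  induction x using Gr.induction with
  | one => simp [repr_one_empty, repr_one_singleton]
  | add x z hx hz => simp [mul_add, hx, hz, add_smul]; abel
  | smul r x hx => simp [hx, smul_smul]
  | ι_mul v x hx =>
    rw [← mul_assoc, quad_mul_ι, smul_mul_assoc, top_mul, repr_ι_mul_empty, repr_ι_mul_singleton,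
      smul_smul, zero_smul, zero_add]

theorem mul_quad (l : Fin 3) (x : Gr) :
    x * quad l = monomials.repr x ∅ • quad l + monomials.repr x {l} • top l := by
  induction x using Gr.induction with
  | one => simp [repr_one_empty, repr_one_singleton]
  | add x z hx hz => simp [add_mul, hx, hz, add_smul]; abel
  | smul r x hx => simp [hx, smul_smul]
  | ι_mul v x hx =>
    rw [mul_assoc, hx, mul_add, mul_smul_comm, mul_smul_comm, ι_mul_top, ι_mul_quad,
      repr_ι_mul_empty, repr_ι_mul_singleton, smul_smul, zero_smul, zero_add, smul_zero, add_zero,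
      mul_comm]

theorem repr_dOdd_empty (l : Fin 3) (x : Gr) :
    monomials.repr (dOdd l x) ∅ = monomials.repr x {l} := by
  induction x using Gr.induction with
  | one =>
    rw [dOdd, CliffordAlgebra.contractLeft_one, repr_one_singleton]
    simp
  | add x z hx hz => simp [hx, hz]
  | smul r x hx => simp [hx]
  | ι_mul v x hx =>
    have h : dOdd l (ExteriorAlgebra.ι ℂ v * x) = v l • x - ExteriorAlgebra.ι ℂ v * dOdd l x :=
      CliffordAlgebra.contractLeft_ι_mul _ v x
    rw [h, map_sub, Finsupp.sub_apply, repr_ι_mul_empty, repr_ι_mul_singleton, map_smul]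
    simp

theorem rescale_ι (c : ℂ) (v : Fin 3 → ℂ) :
    rescale c (ExteriorAlgebra.ι ℂ v) = c • ExteriorAlgebra.ι ℂ v := by
  rw [rescale, ExteriorAlgebra.map_apply_ι]
  simp

theorem rescale_monomials (c : ℂ) (S : Finset (Fin 3)) :
    rescale c (monomials S) = c ^ S.card • monomials S := by
  rw [monomials, ExteriorAlgebra.basis_apply, rescale, ExteriorAlgebra.map_apply_ιMulti]
  have := (ExteriorAlgebra.ιMulti ℂ S.card).map_smul_univ (fun _ => c)
    (⇑(Pi.basisFun ℂ (Fin 3)) ∘ (Set.powersetCard.ofFinEmbEquiv.symm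
      (Set.powersetCard.prodEquiv.symm S).2))
  simp only [Finset.prod_const, Finset.card_univ, Fintype.card_fin] at this
  exact this

theorem repr_rescale (c : ℂ) (x : Gr) (S : Finset (Fin 3)) :
    monomials.repr (rescale c x) S = c ^ S.card * monomials.repr x S := by
  conv_lhs => rw [← monomials.sum_repr x]
  simp only [map_sum, map_smul, rescale_monomials, Finsupp.finsetSum_apply, Finsupp.smul_apply,
    Module.Basis.repr_self, Finsupp.single_apply]
  simp [mul_comm]

theorem rescale_quad (c : ℂ) (l : Fin 3) : rescale c (quad l) = c ^ 2 • quad l := by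
  simp only [quad, map_mul, ξ, rescale_ι, smul_mul_smul_comm, pow_two]

theorem rescale_top (c : ℂ) (l : Fin 3) : rescale c (top l) = c ^ 3 • top l := by
  simp only [top, map_mul, ξ, rescale_ι, smul_mul_smul_comm, pow_succ, pow_zero, one_mul]

theorem rescale_rescale (c d : ℂ) (x : Gr) : rescale c (rescale d x) = rescale (c * d) x := by
  refine monomials.ext_elem fun S => ?_
  rw [repr_rescale, repr_rescale, repr_rescale]
  ring

theorem rescale_one (x : Gr) : rescale 1 x = x := by
  refine monomials.ext_elem fun S => ?_
  rw [repr_rescale, one_pow, one_mul]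

variable {k : ℤ} {V W : Opens CP1}

/-! ### Vector fields acting on superfunctions -/

theorem coeff_of_mem {Ω : Set ℂ} (f : Ω → Gr) (S : Finset (Fin 3)) {z : ℂ} (hz : z ∈ Ω) :
    coeff f S z = monomials.repr (f ⟨z, hz⟩) S :=
  coeff_apply f S ⟨z, hz⟩

theorem coeff_of_notMem {Ω : Set ℂ} (f : Ω → Gr) (S : Finset (Fin 3)) {z : ℂ} (hz : z ∉ Ω) :
    coeff f S z = 0 :=
  Function.extend_apply' _ _ _ fun ⟨a, ha⟩ => hz (ha ▸ a.2)

theorem coeff_add {Ω : Set ℂ} (f g : Ω → Gr) (S : Finset (Fin 3)) (z : ℂ) :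
    coeff (f + g) S z = coeff f S z + coeff g S z := by
  by_cases hz : z ∈ Ω
  · simp [coeff_of_mem _ _ hz]
  · simp [coeff_of_notMem _ _ hz]

theorem coeff_smul {Ω : Set ℂ} (r : ℂ) (f : Ω → Gr) (S : Finset (Fin 3)) (z : ℂ) :
    coeff (r • f) S z = r * coeff f S z := by
  by_cases hz : z ∈ Ω
  · simp [coeff_of_mem _ _ hz]
  · simp [coeff_of_notMem _ _ hz]

theorem IsHolo.smul_const {Ω : Set ℂ} {p : ℂ → ℂ} (hp : DifferentiableOn ℂ p Ω) (c : Gr) :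
    IsHolo (fun z : Ω => p z • c) := fun S =>
  (hp.mul_const (monomials.repr c S)).congr fun z hz => by
    simp [coeff_of_mem _ _ hz]

theorem IsHolo.differentiableAt {Ω : Set ℂ} (hΩ : IsOpen Ω) {f : Ω → Gr} (hf : IsHolo f)
    (S : Finset (Fin 3)) (z : Ω) : DifferentiableAt ℂ (coeff f S) z :=
  (hf S).differentiableAt (hΩ.mem_nhds z.2)

/-- The value at `z` of the vector field `a ξ_i ξ_j ∂/∂x + b ξ_i ξ_j ξ_l ∂/∂ξ_l` applied to `f`,
as a linear function of `(a z, b z)`, written out in the coefficients of `f`. -/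
noncomputable def fld (l : Fin 3) {Ω : Set ℂ} (f : Ω → Gr) (z : Ω) : ℂ × ℂ →ₗ[ℂ] Gr where
  toFun v := (v.1 * deriv (coeff f ∅) z) • quad l +
    (v.1 * deriv (coeff f {l}) z + v.2 * coeff f {l} z) • top l
  map_add' v w := by
    simp only [Prod.fst_add, Prod.snd_add, add_mul, add_smul]
    abel
  map_smul' r v := by
    simp only [Prod.smul_fst, Prod.smul_snd, smul_eq_mul, RingHom.id_apply, smul_add, smul_smul,
      mul_assoc, mul_add]

theorem fld_apply (l : Fin 3) {Ω : Set ℂ} (f : Ω → Gr) (z : Ω) (v : ℂ × ℂ) :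
    fld l f z v = (v.1 * deriv (coeff f ∅) z) • quad l +
      (v.1 * deriv (coeff f {l}) z + v.2 * coeff f {l} z) • top l := rfl

theorem field_eq_fld (l : Fin 3) (a b : ℂ → ℂ) {Ω : Set ℂ} (f : Ω → Gr) (z : Ω) :
    field (lo l) (hi l) l a b f z = fld l f z (a z, b z) := by
  have h1 : ξ (lo l) * ξ (hi l) * dEven f z = quad l * dEven f z := rfl
  have h2 : ξ (lo l) * ξ (hi l) * ξ l * dOdd l (f z) = top l * dOdd l (f z) := rfl
  have h3 : ∀ S, monomials.repr (dEven f z) S = deriv (coeff f S) z := fun S => by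
    simp [dEven, Finsupp.finsetSum_apply, Finsupp.single_apply]
  rw [field, h1, h2, top_mul, quad_mul, repr_dOdd_empty, h3, h3, fld_apply, coeff_apply]
  module

/-- The vector fields are derivations: the odd parts of `g` cause no signs, since the fields are
even. -/
theorem fld_mul (l : Fin 3) {Ω : Set ℂ} (hΩ : IsOpen Ω) {f g : Ω → Gr} (hf : IsHolo f)
    (hg : IsHolo g) (z : Ω) (v : ℂ × ℂ) :
    fld l (f * g) z v = fld l f z v * g z + f z * fld l g z v := by
  have h0 : coeff (f * g) ∅ =ᶠ[𝓝 (z : ℂ)] fun w => coeff f ∅ w * coeff g ∅ w := by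
    filter_upwards [hΩ.mem_nhds z.2] with w hw
    simp only [coeff_of_mem _ _ hw, Pi.mul_apply, repr_mul_empty]
  have hl : coeff (f * g) {l} =ᶠ[𝓝 (z : ℂ)] fun w =>
      coeff f {l} w * coeff g ∅ w + coeff f ∅ w * coeff g {l} w := by
    filter_upwards [hΩ.mem_nhds z.2] with w hw
    simp only [coeff_of_mem _ _ hw, Pi.mul_apply, repr_mul_singleton]
  have df := fun S => hf.differentiableAt hΩ S z
  have dg := fun S => hg.differentiableAt hΩ S z
  rw [fld_apply, fld_apply, fld_apply, h0.deriv_eq, hl.deriv_eq, hl.self_of_nhds,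
    deriv_fun_mul (df _) (dg _), deriv_fun_add ((df _).fun_mul (dg _)) ((df _).fun_mul (dg _)),
    deriv_fun_mul (df _) (dg _), deriv_fun_mul (df _) (dg _)]
  simp only [add_mul, mul_add, smul_mul_assoc, mul_smul_comm, quad_mul, top_mul, mul_quad, mul_top,
    ← coeff_apply]
  module

/-- The vector fields raise the degree by 2: only the coefficients of degree 0 and 1 enter. -/
theorem fld_mem (l : Fin 3) {Ω : Set ℂ} {f : Ω → Gr} {q : ℕ}
    (hf : ∀ z, f z ∈ ⋀[ℂ]^q (Fin 3 → ℂ)) (z : Ω) (v : ℂ × ℂ) :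
    fld l f z v ∈ ⋀[ℂ]^(q + 2) (Fin 3 → ℂ) := by
  have h0 : ∀ S : Finset (Fin 3), S.card ≠ q → coeff f S = fun _ => 0 := fun S hS => by
    ext w
    by_cases hw : w ∈ Ω
    · rw [coeff_of_mem _ _ hw, repr_eq_zero (hf _) hS]
    · rw [coeff_of_notMem _ _ hw]
  have hquad : quad l ∈ ⋀[ℂ]^2 (Fin 3 → ℂ) := by
    have h : ({l}ᶜ : Finset (Fin 3)).card = 2 := by revert l; decide
    rw [← monomials_compl, ← h]
    exact monomials_mem _
  have htop : top l ∈ ⋀[ℂ]^3 (Fin 3 → ℂ) := by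
    rw [top_eq]
    exact Submodule.smul_mem _ _ (monomials_mem Finset.univ)
  rw [fld_apply]
  match q with
  | 0 =>
    rw [h0 {l} (by simp)]
    simpa using Submodule.smul_mem _ _ hquad
  | 1 =>
    rw [h0 ∅ (by simp)]
    simpa using Submodule.smul_mem _ _ htop
  | q + 2 =>
    rw [h0 ∅ (by simp), h0 {l} (by simp)]
    simp

theorem IsHolo.fld (l : Fin 3) {Ω : Set ℂ} (hΩ : IsOpen Ω) {f : Ω → Gr} (hf : IsHolo f)
    {u : ℂ → ℂ × ℂ} (hu : DifferentiableOn ℂ u Ω) : IsHolo (fun z => fld l f z (u z)) := by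
  have hd : ∀ S, DifferentiableOn ℂ (deriv (coeff f S)) Ω := fun S => (hf S).deriv hΩ
  exact (IsHolo.smul_const (hu.fst.mul (hd ∅)) (quad l)).add
    (IsHolo.smul_const ((hu.fst.mul (hd {l})).add (hu.snd.mul (hf {l}))) (top l))

theorem fld_restrict (l : Fin 3) {Ω Ω' : Set ℂ} (h : Ω' ⊆ Ω) (hΩ' : IsOpen Ω') (f : Ω → Gr)
    (z : Ω') : fld l (fun w : Ω' => f ⟨w, h w.2⟩) z = fld l f ⟨z, h z.2⟩ := by
  have hc : ∀ S, coeff (fun w : Ω' => f ⟨w, h w.2⟩) S =ᶠ[𝓝 (z : ℂ)] coeff f S := fun S => by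
    filter_upwards [hΩ'.mem_nhds z.2] with w hw
    rw [coeff_of_mem _ _ hw, coeff_of_mem _ _ (h hw)]
  refine LinearMap.ext fun v => ?_
  rw [fld_apply, fld_apply, (hc _).deriv_eq, (hc _).deriv_eq, (hc _).self_of_nhds]

/-- The components of a vector field transform by `trAt` under the change of charts. -/
theorem fld_trAt (k : ℤ) (l : Fin 3) {Ω Ω' : Set ℂ} (hΩ : IsOpen Ω) (hΩ' : IsOpen Ω')
    (hinv : ∀ y ∈ Ω', y ≠ 0 → y⁻¹ ∈ Ω) {f : Ω → Gr} (hf : IsHolo f) {g : Ω' → Gr}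
    (hg : ∀ (y : Ω') (h : (y : ℂ) ≠ 0),
      g y = rescale ((y : ℂ) ^ (-k)) (f ⟨(y : ℂ)⁻¹, hinv y y.2 h⟩))
    (y : Ω') (h : (y : ℂ) ≠ 0) (v : ℂ × ℂ) :
    fld l g y (trAt k y v) = rescale ((y : ℂ) ^ (-k)) (fld l f ⟨(y : ℂ)⁻¹, hinv y y.2 h⟩ v) := by
  obtain ⟨y, hy⟩ := y
  dsimp only at h
  have hc : ∀ S, coeff g S =ᶠ[𝓝 y] fun w => (w ^ (-k)) ^ S.card * coeff f S w⁻¹ := fun S => by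
    filter_upwards [hΩ'.mem_nhds hy, isOpen_ne.mem_nhds h] with w hw hw0
    rw [coeff_of_mem _ _ hw, hg ⟨w, hw⟩ hw0, repr_rescale, coeff_of_mem _ _ (hinv w hw hw0)]
  have hd : ∀ S, HasDerivAt (fun w => coeff f S w⁻¹) (deriv (coeff f S) y⁻¹ * -(y ^ 2)⁻¹) y :=
    fun S => (hf.differentiableAt hΩ S ⟨y⁻¹, hinv y hy h⟩).hasDerivAt.comp y (hasDerivAt_inv h)
  have h0 : deriv (coeff g ∅) y = deriv (coeff f ∅) y⁻¹ * -(y ^ 2)⁻¹ := by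
    rw [(hc ∅).deriv_eq]
    simpa using (hd ∅).deriv
  have h1 : deriv (coeff g {l}) y = (-k : ℤ) * y ^ (-k - 1) * coeff f {l} y⁻¹ +
      y ^ (-k) * (deriv (coeff f {l}) y⁻¹ * -(y ^ 2)⁻¹) := by
    rw [(hc {l}).deriv_eq]
    simpa using ((hasDerivAt_zpow (-k) y (Or.inl h)).fun_mul (hd {l})).deriv
  have h2 : coeff g {l} y = y ^ (-k) * coeff f {l} y⁻¹ := by
    simpa using (hc {l}).self_of_nhds
  have e0 : y ^ (-2 * k) = y ^ (-k) * y ^ (-k) := by rw [← zpow_add₀ h]; congr 1; ring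
  have e1 : y ^ (2 - 2 * k) = y ^ 2 * (y ^ (-k) * y ^ (-k)) := by
    rw [← e0, ← zpow_natCast, ← zpow_add₀ h]; congr 1; push_cast; ring
  have e2 : y ^ (1 - 2 * k) = y * (y ^ (-k) * y ^ (-k)) := by
    rw [← e0, ← zpow_one_add₀ h]; congr 1; ring
  have e3 : y ^ (-k - 1) = y ^ (-k) * y⁻¹ := zpow_sub_one₀ h _
  rw [fld_apply, fld_apply, map_add, map_smul, map_smul, rescale_quad, rescale_top, smul_smul,
    smul_smul, h0, h1, h2, trAt_apply, e0, e1, e2, e3]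
  dsimp only
  congr 2
  · field_simp
  · push_cast
    field_simp
    ring

/-! ### Sections in a chart -/

/-- The expression of a section in the chart `e`. -/
def Sec.f (e : Bool) (s : Sec k V) : dom e V → Gr :=
  match e with
  | false => s.f0
  | true => s.f1

theorem Sec.isHolo (e : Bool) (s : Sec k V) : IsHolo (s.f e) := by
  cases e
  exacts [s.2.1, s.2.2.1]

theorem Sec.ext {s t : Sec k V} (h : ∀ e, s.f e = t.f e) : s = t :=
  Subtype.ext (Prod.ext (h false) (h true))

theorem glue_symm {F : ∀ e, dom e V → Gr} {e : Bool}
    (h : ∀ (y : dom e V) (hy : (y : ℂ) ≠ 0),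
      F e y = rescale ((y : ℂ) ^ (-k)) (F (!e) ⟨(y : ℂ)⁻¹, inv_mem_dom y.2 hy⟩))
    (y : dom (!e) V) (hy : (y : ℂ) ≠ 0) :
      F (!e) y = rescale ((y : ℂ) ^ (-k)) (F e ⟨(y : ℂ)⁻¹, inv_mem_dom' y.2 hy⟩) := by
  rw [h ⟨(y : ℂ)⁻¹, inv_mem_dom' y.2 hy⟩ (inv_ne_zero hy), rescale_rescale, ← mul_zpow,
    mul_inv_cancel₀ hy, one_zpow, rescale_one]
  simp

theorem Sec.glue (e : Bool) (s : Sec k V) (y : dom e V) (hy : (y : ℂ) ≠ 0) :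
    s.f e y = rescale ((y : ℂ) ^ (-k)) (s.f (!e) ⟨(y : ℂ)⁻¹, inv_mem_dom y.2 hy⟩) := by
  have h1 : ∀ (y : dom true V) (hy : (y : ℂ) ≠ 0),
      s.f true y = rescale ((y : ℂ) ^ (-k)) (s.f false ⟨(y : ℂ)⁻¹, inv_mem_dom y.2 hy⟩) :=
    fun y hy => s.2.2.2 y hy
  cases e
  · exact glue_symm (F := fun e => s.f e) (e := true) h1 y hy
  · exact h1 y hy

/-- The section with given expressions in the two charts. -/
def Sec.mk (F : ∀ e, dom e V → Gr) (hF : ∀ e, IsHolo (F e))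
    (h : ∀ (y : dom true V) (hy : (y : ℂ) ≠ 0),
      F true y = rescale ((y : ℂ) ^ (-k)) (F false ⟨(y : ℂ)⁻¹, inv_mem_dom y.2 hy⟩)) : Sec k V :=
  ⟨(F false, F true), hF false, hF true, h⟩

theorem Sec.f_mk (F : ∀ e, dom e V → Gr) (hF : ∀ e, IsHolo (F e))
    (h : ∀ (y : dom true V) (hy : (y : ℂ) ≠ 0),
      F true y = rescale ((y : ℂ) ^ (-k)) (F false ⟨(y : ℂ)⁻¹, inv_mem_dom y.2 hy⟩)) (e : Bool) :
    (Sec.mk F hF h).f e = F e := by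
  cases e <;> rfl

theorem Sec.f_add (e : Bool) (s t : Sec k V) : (s + t).f e = s.f e + t.f e := by
  cases e <;> rfl

theorem Sec.f_mul (e : Bool) (s t : Sec k V) : (s * t).f e = s.f e * t.f e := by
  cases e <;> rfl

theorem Sec.f_smul (e : Bool) (r : ℂ) (s : Sec k V) : (r • s).f e = r • s.f e := by
  cases e <;> rfl

theorem Sec.f_zero (e : Bool) : (0 : Sec k V).f e = 0 := by
  cases e <;> rfl

theorem Sec.f_one (e : Bool) : (1 : Sec k V).f e = 1 := by
  cases e <;> rfl

theorem Sec.f_sum {ι : Type} (e : Bool) (t : Finset ι) (s : ι → Sec k V) :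
    (∑ i ∈ t, s i).f e = ∑ i ∈ t, (s i).f e := by
  classical
  induction t using Finset.induction_on with
  | empty => exact Sec.f_zero e
  | insert i t hi ih => rw [Finset.sum_insert hi, Finset.sum_insert hi, Sec.f_add, ih]

theorem Sec.f_res (e : Bool) (h : W ≤ V) (s : Sec k V) (z : dom e W) :
    (resO k h s).f e z = s.f e ⟨z, h z.2⟩ := by
  cases e <;> rfl

theorem isHomog_iff {q : ℕ} {s : Sec k V} :
    IsHomog q s ↔ ∀ e z, s.f e z ∈ ⋀[ℂ]^q (Fin 3 → ℂ) :=
  ⟨fun h e => by cases e; exacts [h.1, h.2], fun h => ⟨h false, h true⟩⟩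

/-- The domain of the chart `e`. -/
def Uc : Bool → Opens CP1
  | false => U0
  | true => U1

theorem chart_mem_Uc (e : Bool) (z : ℂ) : chart e z ∈ Uc e := by
  cases e
  · exact OnePoint.coe_ne_infty z
  · change chart1 z ≠ ((0 : ℂ) : OnePoint ℂ)
    rw [chart1]
    split_ifs with h
    · exact OnePoint.infty_ne_coe 0
    · intro h0
      exact inv_ne_zero h (OnePoint.coe_injective h0)

theorem ne_zero_of_le_Uc {e : Bool} (hV : V ≤ Uc e) {y : ℂ} (hy : y ∈ dom (!e) V) : y ≠ 0 := by
  rintro rfl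
  have h := hV hy
  cases e
  · refine h ?_
    simp [chart, chart1]
  · exact h rfl

theorem mem_dom_inf_Uc {e : Bool} {z : ℂ} (hz : z ∈ dom e V) : z ∈ dom e (V ⊓ Uc e) :=
  ⟨hz, chart_mem_Uc e z⟩

theorem bool_eq_not {e e' : Bool} (h : e' ≠ e) : e' = !e := by
  revert e e'; decide

/-- A section over a part of the domain of the chart `e` is determined by its expression in this
chart. -/
theorem Sec.ext_of_le {e : Bool} (hV : V ≤ Uc e) {s t : Sec k V} (h : s.f e = t.f e) : s = t := by
  refine Sec.ext fun e' => ?_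
  rcases eq_or_ne e' e with rfl | he
  · exact h
  · obtain rfl := bool_eq_not he
    ext y
    have hy := ne_zero_of_le_Uc hV y.2
    rw [s.glue _ y hy, t.glue _ y hy]
    congr 1
    revert e
    rintro (_ | _) _ h <;> intros <;> exact congrFun h _

theorem IsHolo.inv {Ω Ω' : Set ℂ} (hΩ : IsOpen Ω) {F : Ω → Gr} (hF : IsHolo F)
    (h0 : ∀ y ∈ Ω', y ≠ 0) (hinv : ∀ y ∈ Ω', y⁻¹ ∈ Ω) :
    IsHolo (fun y : Ω' => rescale ((y : ℂ) ^ (-k)) (F ⟨(y : ℂ)⁻¹, hinv y y.2⟩)) := by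
  intro S
  have h : DifferentiableOn ℂ (fun w => (w ^ (-k)) ^ S.card * coeff F S w⁻¹) Ω' := by
    intro y hy
    refine DifferentiableAt.differentiableWithinAt ?_
    exact ((differentiableAt_zpow.2 (Or.inl (h0 y hy))).pow _).mul
      ((hF.differentiableAt hΩ S ⟨y⁻¹, hinv y hy⟩).comp y (differentiableAt_inv (h0 y hy)))
  refine h.congr fun y hy => ?_
  rw [coeff_of_mem _ _ hy, repr_rescale, coeff_of_mem _ _ (hinv y hy)]

theorem exists_sec (k : ℤ) (e : Bool) (hV : V ≤ Uc e) {F : dom e V → Gr} (hF : IsHolo F) :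
    ∃ s : Sec k V, s.f e = F := by
  have h0 : ∀ y ∈ dom (!e) V, y ≠ 0 := fun y hy => ne_zero_of_le_Uc hV hy
  have hG := hF.inv (k := k) (isOpen_dom e V) h0 fun y hy => inv_mem_dom' hy (h0 y hy)
  cases e
  · exact ⟨⟨(F, _), hF, hG, fun y hy => rfl⟩, rfl⟩
  · refine ⟨⟨(_, F), hG, hF, fun y hy => ?_⟩, rfl⟩
    dsimp only
    rw [rescale_rescale, ← mul_zpow, mul_inv_cancel₀ hy, one_zpow, rescale_one]
    exact congrArg F (Subtype.ext (inv_inv _).symm)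

/-- The section over a part of the chart domain with a given expression in this chart. -/
noncomputable def Sec.ofChart (k : ℤ) (e : Bool) (hV : V ≤ Uc e) (F : dom e V → Gr)
    (hF : IsHolo F) : Sec k V :=
  (exists_sec k e hV hF).choose

theorem Sec.f_ofChart (k : ℤ) (e : Bool) (hV : V ≤ Uc e) (F : dom e V → Gr) (hF : IsHolo F) :
    (Sec.ofChart k e hV F hF).f e = F :=
  (exists_sec k e hV hF).choose_spec

theorem isHomog_of_le {e : Bool} (hV : V ≤ Uc e) {q : ℕ} {s : Sec k V}
    (h : ∀ z, s.f e z ∈ ⋀[ℂ]^q (Fin 3 → ℂ)) : IsHomog q s := by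
  refine isHomog_iff.2 fun e' y => ?_
  rcases eq_or_ne e' e with rfl | he
  · exact h y
  · obtain rfl := bool_eq_not he
    have hy := ne_zero_of_le_Uc hV y.2
    rw [s.glue _ y hy]
    refine mem_of_repr fun S hS => ?_
    rw [repr_rescale, repr_eq_zero _ hS, mul_zero]
    revert e
    rintro (_ | _) _ h <;> intros <;> exact h _

/-! ### Degree 2 vector fields in coordinates -/

/-- In the chart `e`, the vector field `D` is
`a ξ_i ξ_j ∂/∂x + b ξ_i ξ_j ξ_l ∂/∂ξ_l` where `u = (a, b)`. -/
def IsFld (e : Bool) (l : Fin 3) (D : VF k V) (u : ℂ → ℂ × ℂ) : Prop :=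
  ∀ (W : Opens CP1) (h : W ≤ V) (s : Sec k W) z, (D.act h s).f e z = fld l (s.f e) z (u z)

theorem isField0_iff {l : Fin 3} {D : VF k V} {a b : ℂ → ℂ} :
    IsField0 k (lo l) (hi l) l D a b ↔ IsFld false l D (fun z => (a z, b z)) :=
  forall_congr' fun W => forall_congr' fun h => forall_congr' fun s => forall_congr' fun z => by
    rw [field_eq_fld]; rfl

theorem isField1_iff {l : Fin 3} {D : VF k V} {a b : ℂ → ℂ} :
    IsField1 k (lo l) (hi l) l D a b ↔ IsFld true l D (fun z => (a z, b z)) :=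
  forall_congr' fun W => forall_congr' fun h => forall_congr' fun s => forall_congr' fun z => by
    rw [field_eq_fld]; rfl

theorem mem_T2ij {l : Fin 3} {D : VF k V} :
    D ∈ T2ij k (lo l) (hi l) l V ↔
      ∀ e, ∃ u, DifferentiableOn ℂ u (dom e V) ∧ IsFld e l D u := by
  constructor
  · rintro ⟨⟨a, b, ha, hb, h⟩, ⟨a', b', ha', hb', h'⟩⟩ e
    cases e
    exacts [⟨_, ha.prodMk hb, isField0_iff.1 h⟩, ⟨_, ha'.prodMk hb', isField1_iff.1 h'⟩]
  · intro h
    obtain ⟨u, hu, h0⟩ := h false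
    obtain ⟨v, hv, h1⟩ := h true
    exact ⟨⟨fun z => (u z).1, fun z => (u z).2, hu.fst, hu.snd, isField0_iff.2 h0⟩,
      ⟨fun z => (v z).1, fun z => (v z).2, hv.fst, hv.snd, isField1_iff.2 h1⟩⟩

theorem VF.act_add (D E : VF k V) (h : W ≤ V) (s : Sec k W) :
    (D + E).act h s = D.act h s + E.act h s := rfl

theorem VF.act_smul (r : ℂ) (D : VF k V) (h : W ≤ V) (s : Sec k W) :
    (r • D).act h s = r • D.act h s := rfl

theorem VF.ext {D E : VF k V} (h : ∀ (W : Opens CP1) (h : W ≤ V) (s : Sec k W) e z,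
    (D.act h s).f e z = (E.act h s).f e z) : D = E :=
  Subtype.ext (funext fun W => LinearMap.ext fun s => Sec.ext fun e => funext fun z =>
    h W.1 W.2 s e z)

theorem VF.act_mul (D : VF k V) (h : W ≤ V) (s t : Sec k W) :
    D.act h (s * t) = D.act h s * t + s * D.act h t :=
  D.2.1 ⟨W, h⟩ s t

theorem VF.res_act (D : VF k V) {W' : Opens CP1} (h : W ≤ V) (h' : W' ≤ W) (s : Sec k W) :
    resO k h' (D.act h s) = D.act (h'.trans h) (resO k h' s) :=
  D.2.2.1 ⟨W, h⟩ ⟨W', h'.trans h⟩ h' s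

theorem VF.isHomog_act (D : VF k V) (h : W ≤ V) {q : ℕ} {s : Sec k W} (hs : IsHomog q s) :
    IsHomog (q + 2) (D.act h s) :=
  D.2.2.2 ⟨W, h⟩ q s hs

/-- The section `(a ξ_i ξ_j ∂/∂x + b ξ_i ξ_j ξ_l ∂/∂ξ_l) s`. -/
noncomputable def fldSec (l : Fin 3) (u : Bool → ℂ → ℂ × ℂ)
    (hu : ∀ e, DifferentiableOn ℂ (u e) (dom e V))
    (hc : ∀ z ∈ dom true V, z ≠ 0 → u true z = trAt k z (u false z⁻¹)) (h : W ≤ V)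
    (s : Sec k W) : Sec k W :=
  Sec.mk (fun e z => fld l (s.f e) z (u e z))
    (fun e => (s.isHolo e).fld l (isOpen_dom e W) ((hu e).mono fun _ hz => h hz))
    (fun y hy => by
      rw [hc y (h y.2) hy]
      exact fld_trAt k l (isOpen_dom false W) (isOpen_dom true W) (fun y hy h => inv_mem_dom hy h)
        (s.isHolo false) (s.glue true) y hy _)

theorem f_fldSec (l : Fin 3) (u : Bool → ℂ → ℂ × ℂ)
    (hu : ∀ e, DifferentiableOn ℂ (u e) (dom e V))
    (hc : ∀ z ∈ dom true V, z ≠ 0 → u true z = trAt k z (u false z⁻¹)) (h : W ≤ V)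
    (s : Sec k W) (e : Bool) (z : dom e W) :
    (fldSec l u hu hc h s).f e z = fld l (s.f e) z (u e z) := by
  rw [fldSec, Sec.f_mk]

theorem fld_add (l : Fin 3) {Ω : Set ℂ} (hΩ : IsOpen Ω) {f g : Ω → Gr} (hf : IsHolo f)
    (hg : IsHolo g) (z : Ω) (v : ℂ × ℂ) : fld l (f + g) z v = fld l f z v + fld l g z v := by
  have h : ∀ S, coeff (f + g) S = fun w => coeff f S w + coeff g S w := fun S =>
    funext (coeff_add f g S)
  rw [fld_apply, fld_apply, fld_apply, h, h, deriv_fun_add (hf.differentiableAt hΩ _ z)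
    (hg.differentiableAt hΩ _ z), deriv_fun_add (hf.differentiableAt hΩ _ z)
    (hg.differentiableAt hΩ _ z)]
  module

theorem fld_smul (l : Fin 3) {Ω : Set ℂ} (r : ℂ) (f : Ω → Gr) (z : Ω) (v : ℂ × ℂ) :
    fld l (r • f) z v = r • fld l f z v := by
  have h : ∀ S, coeff (r • f) S = fun w => r * coeff f S w := fun S =>
    funext (coeff_smul r f S)
  rw [fld_apply, fld_apply, h, h, deriv_const_mul_field, deriv_const_mul_field]
  module

theorem fld_res (l : Fin 3) (e : Bool) (h : W ≤ V) (s : Sec k V) (z : dom e W) :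
    fld l ((resO k h s).f e) z = fld l (s.f e) ⟨z, h z.2⟩ := by
  rw [funext (Sec.f_res e h s)]
  exact fld_restrict l (fun w hw => h hw) (isOpen_dom e W) (s.f e) z

/-- Vector fields in `𝒯₂^{ij}` exist for all components which transform correctly. -/
theorem exists_vectorField (l : Fin 3) (u : Bool → ℂ → ℂ × ℂ)
    (hu : ∀ e, DifferentiableOn ℂ (u e) (dom e V))
    (hc : ∀ z ∈ dom true V, z ≠ 0 → u true z = trAt k z (u false z⁻¹)) :
    ∃ D : T2ij k (lo l) (hi l) l V, ∀ e, IsFld e l D.1 (u e) := by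
  let D : ∀ W : Set.Iic V, Sec k W.1 →ₗ[ℂ] Sec k W.1 := fun W =>
    { toFun := fldSec l u hu hc (mem_Iic.1 W.2)
      map_add' := fun s t => Sec.ext fun e => funext fun z => by
        rw [Sec.f_add, Pi.add_apply, f_fldSec, f_fldSec, f_fldSec, Sec.f_add,
          fld_add l (isOpen_dom e _) (s.isHolo e) (t.isHolo e)]
      map_smul' := fun r s => Sec.ext fun e => funext fun z => by
        rw [RingHom.id_apply, Sec.f_smul, Pi.smul_apply, f_fldSec, f_fldSec, Sec.f_smul,
          fld_smul] }
  have hD : D ∈ T2 k V := by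
    refine ⟨fun W s t => Sec.ext fun e => funext fun z => ?_, fun W W' h s =>
      Sec.ext fun e => funext fun z => ?_, fun W q s hs => isHomog_iff.2 fun e z => ?_⟩
    · change (fldSec l u hu hc (mem_Iic.1 W.2) (s * t)).f e z =
        (fldSec l u hu hc (mem_Iic.1 W.2) s * t + s * fldSec l u hu hc (mem_Iic.1 W.2) t).f e z
      rw [Sec.f_add, Sec.f_mul, Sec.f_mul, Pi.add_apply, Pi.mul_apply, Pi.mul_apply, f_fldSec,
        f_fldSec, f_fldSec, Sec.f_mul, fld_mul l (isOpen_dom e _) (s.isHolo e) (t.isHolo e)]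
    · change (resO k h (fldSec l u hu hc (mem_Iic.1 W.2) s)).f e z =
        (fldSec l u hu hc (mem_Iic.1 W'.2) (resO k h s)).f e z
      rw [Sec.f_res, f_fldSec, f_fldSec]
      exact (DFunLike.congr_fun (fld_res l e h s z) (u e z)).symm
    · change (fldSec l u hu hc (mem_Iic.1 W.2) s).f e z ∈ _
      rw [f_fldSec]
      exact fld_mem l (isHomog_iff.1 hs e) z _
  have hF : ∀ e, IsFld e l (show VF k V from ⟨D, hD⟩) (u e) := fun e W h s z =>
    f_fldSec l u hu hc h s e z
  exact ⟨⟨⟨D, hD⟩, mem_T2ij.2 fun e => ⟨u e, hu e, hF e⟩⟩, hF⟩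

/-! ### Components of a vector field -/

theorem IsHolo.coordinate (e : Bool) (V : Opens CP1) :
    IsHolo (fun z : dom e V => (z : ℂ) • (1 : Gr)) :=
  IsHolo.smul_const differentiableOn_id 1

/-- The coordinate of the chart `e`, as a section over the part of `V` in this chart. -/
noncomputable def xSec (k : ℤ) (e : Bool) (V : Opens CP1) : Sec k (V ⊓ Uc e) :=
  Sec.ofChart k e inf_le_right (fun z => (z : ℂ) • 1) (IsHolo.coordinate e _)

/-- The `l`-th odd coordinate of the chart `e`, as a section over the part of `V` in this
chart. -/
noncomputable def ξSec (k : ℤ) (e : Bool) (V : Opens CP1) (l : Fin 3) : Sec k (V ⊓ Uc e) :=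
  Sec.ofChart k e inf_le_right (fun _ => ξ l) (IsHolo.const _)

theorem f_xSec (e : Bool) (V : Opens CP1) : (xSec k e V).f e =
    fun z : dom e (V ⊓ Uc e) => (z : ℂ) • (1 : Gr) :=
  Sec.f_ofChart ..

theorem f_ξSec (e : Bool) (V : Opens CP1) (l : Fin 3) : (ξSec k e V l).f e = fun _ => ξ l :=
  Sec.f_ofChart ..

theorem res_xSec (e : Bool) (h : W ≤ V) :
    resO k (inf_le_inf_right _ h) (xSec k e V) = xSec k e W :=
  Sec.ext_of_le inf_le_right (funext fun z => by rw [Sec.f_res, f_xSec, f_xSec])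

theorem res_ξSec (e : Bool) (h : W ≤ V) (l : Fin 3) :
    resO k (inf_le_inf_right _ h) (ξSec k e V l) = ξSec k e W l :=
  Sec.ext_of_le inf_le_right (funext fun z => by rw [Sec.f_res, f_ξSec, f_ξSec])

/-- The components of `D` in the chart `e` along `ξ_i ξ_j ∂/∂x` and `ξ_i ξ_j ξ_l ∂/∂ξ_l`, read off
from `D x` and `D ξ_l` and extended by zero outside the chart. -/
noncomputable def comp (e : Bool) (l : Fin 3) : VF k V →ₗ[ℂ] ℂ → ℂ × ℂ where
  toFun D z := (coeff ((D.act inf_le_left (xSec k e V)).f e) {l}ᶜ z,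
    sgn l * coeff ((D.act inf_le_left (ξSec k e V l)).f e) Finset.univ z)
  map_add' D E := by
    ext z
    · simp only [VF.act_add, Sec.f_add, coeff_add, Pi.add_apply, Prod.fst_add]
    · simp only [VF.act_add, Sec.f_add, coeff_add, Pi.add_apply, Prod.snd_add, mul_add]
  map_smul' r D := by
    ext z
    · simp only [VF.act_smul, Sec.f_smul, coeff_smul, Pi.smul_apply, Prod.smul_fst,
        RingHom.id_apply, smul_eq_mul]
    · simp only [VF.act_smul, Sec.f_smul, coeff_smul, Pi.smul_apply, Prod.smul_snd,
        RingHom.id_apply, smul_eq_mul]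
      ring

theorem comp_apply (e : Bool) (l : Fin 3) (D : VF k V) (z : ℂ) :
    comp e l D z = (coeff ((D.act inf_le_left (xSec k e V)).f e) {l}ᶜ z,
      sgn l * coeff ((D.act inf_le_left (ξSec k e V l)).f e) Finset.univ z) := rfl

theorem differentiableOn_comp (e : Bool) (l : Fin 3) (D : VF k V) :
    DifferentiableOn ℂ (comp e l D) (dom e V) := by
  have h : dom e V ⊆ dom e (V ⊓ Uc e) := fun z hz => mem_dom_inf_Uc hz
  exact (((Sec.isHolo e _) _).mono h).prodMk ((((Sec.isHolo e _) _).mono h).const_mul _)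

theorem comp_res (e : Bool) (l : Fin 3) (h : W ≤ V) (D : VF k V) {z : ℂ} (hz : z ∈ dom e W) :
    comp e l (resVF k h D) z = comp e l D z := by
  have hz' := mem_dom_inf_Uc hz
  have hz'' : z ∈ dom e (V ⊓ Uc e) := mem_dom_inf_Uc (h hz)
  have hx : (resVF k h D).act inf_le_left (xSec k e W) =
      resO k (inf_le_inf_right _ h) (D.act inf_le_left (xSec k e V)) := by
    rw [VF.res_act, res_xSec e h]; rfl
  have hξ : (resVF k h D).act inf_le_left (ξSec k e W l) =
      resO k (inf_le_inf_right _ h) (D.act inf_le_left (ξSec k e V l)) := by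
    rw [VF.res_act, res_ξSec e h]; rfl
  rw [comp_apply, comp_apply, hx, hξ]
  simp only [coeff_of_mem _ _ hz', coeff_of_mem _ _ hz'', Sec.f_res]

theorem fld_xSec (e : Bool) (V : Opens CP1) (l : Fin 3) (z : dom e (V ⊓ Uc e)) (v : ℂ × ℂ) :
    fld l ((xSec k e V).f e) z v = v.1 • quad l := by
  have hnb := (isOpen_dom e (V ⊓ Uc e)).mem_nhds z.2
  have h0 : coeff ((xSec k e V).f e) ∅ =ᶠ[𝓝 (z : ℂ)] id := by
    filter_upwards [hnb] with w hw
    simp [coeff_of_mem _ _ hw, f_xSec, repr_one]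
  have h1 : coeff ((xSec k e V).f e) {l} =ᶠ[𝓝 (z : ℂ)] fun _ => 0 := by
    filter_upwards [hnb] with w hw
    simp [coeff_of_mem _ _ hw, f_xSec, repr_one]
  rw [fld_apply, h0.deriv_eq, h1.deriv_eq, h1.self_of_nhds]
  simp

theorem fld_ξSec (e : Bool) (V : Opens CP1) (l m : Fin 3) (z : dom e (V ⊓ Uc e)) (v : ℂ × ℂ) :
    fld l ((ξSec k e V m).f e) z v = if m = l then v.2 • top l else 0 := by
  have hnb := (isOpen_dom e (V ⊓ Uc e)).mem_nhds z.2
  have h0 : coeff ((ξSec k e V m).f e) ∅ =ᶠ[𝓝 (z : ℂ)] fun _ => 0 := by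
    filter_upwards [hnb] with w hw
    simp [coeff_of_mem _ _ hw, f_ξSec, ← monomials_singleton]
  have h1 : coeff ((ξSec k e V m).f e) {l} =ᶠ[𝓝 (z : ℂ)] fun _ => if m = l then 1 else 0 := by
    filter_upwards [hnb] with w hw
    simp only [coeff_of_mem _ _ hw, f_ξSec, repr_ξ]
  rw [fld_apply, h0.deriv_eq, h1.deriv_eq, h1.self_of_nhds]
  split_ifs <;> simp

/-- A vector field which is a sum of fields with components `u l` at a point has these
components. -/
theorem comp_eq_of_act_eq_sum {e : Bool} {D : VF k V} {z : ℂ} (hz : z ∈ dom e V)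
    {u : Fin 3 → ℂ × ℂ} (h : ∀ s : Sec k (V ⊓ Uc e),
      (D.act inf_le_left s).f e ⟨z, mem_dom_inf_Uc hz⟩ =
        ∑ l, fld l (s.f e) ⟨z, mem_dom_inf_Uc hz⟩ (u l)) (l : Fin 3) :
    comp e l D z = u l := by
  have hz' : z ∈ dom e (V ⊓ Uc e) := mem_dom_inf_Uc hz
  rw [comp_apply, coeff_of_mem _ _ hz', coeff_of_mem _ _ hz', h, h]
  ext
  · simp only [fld_xSec, map_sum, map_smul, Finsupp.finsetSum_apply, Finsupp.smul_apply, repr_quad]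
    simp
  · simp only [fld_ξSec, Finset.sum_ite_eq, Finset.mem_univ, if_true, map_smul,
      Finsupp.smul_apply, repr_top, smul_eq_mul]
    linear_combination (u l).2 * sgn_mul_sgn l

theorem IsFld.comp_eq {e : Bool} {l : Fin 3} {D : VF k V} {u : ℂ → ℂ × ℂ} (h : IsFld e l D u)
    {z : ℂ} (hz : z ∈ dom e V) : comp e l D z = u z := by
  have := comp_eq_of_act_eq_sum hz (D := D) (u := fun l' => if l' = l then u z else 0)
    (fun s => by
      rw [h, Finset.sum_eq_single l (fun l' _ hl => by rw [if_neg hl, map_zero]) (by simp),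
        if_pos rfl]) l
  rwa [if_pos rfl] at this

theorem isFld_comp {l : Fin 3} {D : VF k V} (hD : D ∈ T2ij k (lo l) (hi l) l V) (e : Bool) :
    IsFld e l D (comp e l D) := by
  obtain ⟨u, -, hu⟩ := mem_T2ij.1 hD e
  intro W h s z
  rw [hu W h s z, hu.comp_eq (h z.2)]

/-! ### Degree 2 derivations are vector fields -/

theorem VF.act_one (D : VF k V) (h : W ≤ V) : D.act h 1 = 0 := by
  have := D.act_mul h 1 1
  simpa using this

theorem eq_zero_of_mem_of_three_lt {q : ℕ} (hq : 3 < q) {x : Gr}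
    (hx : x ∈ ⋀[ℂ]^q (Fin 3 → ℂ)) : x = 0 := by
  refine monomials.ext_elem fun S => ?_
  rw [repr_eq_zero hx, map_zero, Finsupp.zero_apply]
  have : S.card ≤ 3 := by simpa using S.card_le_univ
  omega

theorem sum_finset_fin_three {M : Type*} [AddCommMonoid M] {T : Finset (Fin 3) → M}
    (hT : ∀ S, 2 ≤ S.card → T S = 0) : ∑ S, T S = T ∅ + ∑ m, T {m} := by
  have h : (Finset.univ : Finset (Finset (Fin 3))).filter (fun S => S.card < 2) =
      insert ∅ (Finset.univ.image singleton) := by decide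
  rw [← Finset.sum_filter_of_ne (p := fun S : Finset (Fin 3) => S.card < 2), h,
    Finset.sum_insert (by simp), Finset.sum_image Finset.singleton_injective.injOn]
  intro S _ hS
  by_contra hn
  exact hS (hT S (not_lt.1 hn))

theorem sum_finset_card_two {M : Type*} [AddCommMonoid M] {T : Finset (Fin 3) → M}
    (hT : ∀ S, S.card ≠ 2 → T S = 0) : ∑ S, T S = ∑ m, T {m}ᶜ := by
  have h : (Finset.univ : Finset (Finset (Fin 3))).filter (fun S => S.card = 2) =
      Finset.univ.image (fun m => {m}ᶜ) := by decide
  have hi : Function.Injective (fun m : Fin 3 => ({m}ᶜ : Finset (Fin 3))) :=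
    compl_injective.comp Finset.singleton_injective
  rw [← Finset.sum_filter_of_ne (p := fun S : Finset (Fin 3) => S.card = 2), h,
    Finset.sum_image hi.injOn]
  intro S _ hS
  by_contra hn
  exact hS (hT S hn)

theorem eq_sum_quad {x : Gr} (hx : x ∈ ⋀[ℂ]^2 (Fin 3 → ℂ)) :
    x = ∑ l, monomials.repr x {l}ᶜ • quad l := by
  conv_lhs => rw [← monomials.sum_repr x]
  rw [sum_finset_card_two fun S hS => by rw [repr_eq_zero hx hS, zero_smul]]
  simp only [monomials_compl]

theorem eq_smul_top {x : Gr} (hx : x ∈ ⋀[ℂ]^3 (Fin 3 → ℂ)) (l : Fin 3) :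
    x = (sgn l * monomials.repr x Finset.univ) • top l := by
  conv_lhs => rw [← monomials.sum_repr x]
  rw [Finset.sum_eq_single Finset.univ, monomials_univ_eq l, smul_smul, mul_comm]
  · intro S _ hS
    rw [repr_eq_zero hx, zero_smul]
    intro hc
    exact hS ((Finset.card_eq_iff_eq_univ S).1 hc)
  · simp

/-- The section of degree 0 given by a holomorphic function of the coordinate of the chart `e`. -/
noncomputable def evenSec (k : ℤ) (e : Bool) (hW : W ≤ Uc e) (p : ℂ → ℂ)
    (hp : DifferentiableOn ℂ p (dom e W)) : Sec k W :=
  Sec.ofChart k e hW (fun z => p z • 1) (IsHolo.smul_const hp 1)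

theorem f_evenSec (e : Bool) (hW : W ≤ Uc e) (p : ℂ → ℂ)
    (hp : DifferentiableOn ℂ p (dom e W)) :
    (evenSec k e hW p hp).f e = fun z : dom e W => p z • (1 : Gr) :=
  Sec.f_ofChart ..

/-- A derivation acts on functions of the even coordinate by the chain rule. -/
theorem act_evenSec (D : VF k V) (h : W ≤ V) (e : Bool) (hW : W ≤ Uc e) (p : ℂ → ℂ)
    (hp : DifferentiableOn ℂ p (dom e W)) (z : dom e W) :
    (D.act h (evenSec k e hW p hp)).f e z =
      deriv p z • (D.act h (evenSec k e hW id differentiableOn_id)).f e z := by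
  -- `p = p z + (x - z) q`, where `q z` is the derivative of `p` at `z`; constants are annihilated.
  have hd : DifferentiableOn ℂ (dslope p z) (dom e W) :=
    (differentiableOn_dslope ((isOpen_dom e W).mem_nhds z.2)).2 hp
  have hs : evenSec k e hW p hp = p z • 1 +
      (evenSec k e hW id differentiableOn_id + (-(z : ℂ)) • 1) * evenSec k e hW _ hd := by
    refine Sec.ext_of_le hW (funext fun w => ?_)
    have := sub_smul_dslope p (z : ℂ) w
    rw [smul_eq_mul] at this
    simp only [Sec.f_add, Sec.f_mul, Sec.f_smul, Sec.f_one, Pi.add_apply, Pi.mul_apply,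
      Pi.smul_apply, Pi.one_apply, f_evenSec, ← add_smul, smul_mul_smul_comm, mul_one, id]
    congr 1
    linear_combination -this
  rw [hs]
  simp only [map_add, map_smul, VF.act_mul, VF.act_one, smul_zero, zero_add, add_zero]
  simp only [Sec.f_add, Sec.f_mul, Sec.f_smul, Sec.f_one, Pi.add_apply, Pi.mul_apply,
    Pi.smul_apply, Pi.one_apply, f_evenSec, id, ← add_smul, add_neg_cancel, zero_smul, zero_mul,
    dslope_same, mul_smul_comm, mul_one, add_zero]

/-- The structure theorem for `𝒯₂`: in each chart, a degree 2 derivation is the sum of the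
vector fields with its components. A section is a combination of monomials with holomorphic
coefficients; by degree those of degree at least 2 are annihilated, and the value of the
derivation on an even coordinate function at a point is found by division by a linear factor. -/
theorem act_eq_sum_fld (D : VF k V) (h : W ≤ V) (e : Bool) (s : Sec k W) (z : dom e W) :
    (D.act h s).f e z = ∑ l, fld l (s.f e) z (comp e l D z) := by
  -- After restriction, the coefficients of `s` in the chart are themselves sections.
  wlog hW : W ≤ Uc e generalizing W
  · have hz := mem_dom_inf_Uc z.2
    have h1 := this (inf_le_left.trans h) (resO k inf_le_left s) ⟨z, hz⟩
      (inf_le_right : W ⊓ Uc e ≤ Uc e)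
    rw [← VF.res_act D h inf_le_left s, Sec.f_res] at h1
    rw [h1]
    simp only [fld_res]
  have hF := s.isHolo e
  set T : Finset (Fin 3) → Sec k W := fun S => Sec.ofChart k e hW
    (fun w => coeff (s.f e) S w • monomials S) (IsHolo.smul_const (hF S) _) with hT
  have hTf : ∀ S, (T S).f e = fun w : dom e W => coeff (s.f e) S w • monomials S := fun S =>
    Sec.f_ofChart ..
  have hs : s = ∑ S, T S := by
    refine Sec.ext_of_le hW (funext fun w => ?_)
    rw [Sec.f_sum, Finset.sum_apply]
    simp only [hTf, coeff_apply]
    exact (monomials.sum_repr _).symm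
  have hhigh : ∀ S : Finset (Fin 3), 2 ≤ S.card → (D.act h (T S)).f e z = 0 := by
    intro S hS
    refine eq_zero_of_mem_of_three_lt (q := S.card + 2) (by omega)
      (isHomog_iff.1 (D.isHomog_act h (isHomog_of_le hW (q := S.card) fun w => ?_)) e z)
    rw [hTf]
    exact Submodule.smul_mem _ _ (monomials_mem S)
  set x : Sec k W := evenSec k e hW id differentiableOn_id with hx
  set y : Fin 3 → Sec k W := fun m => Sec.ofChart k e hW (fun _ => ξ m) (IsHolo.const _) with hy
  have hyf : ∀ m, (y m).f e = fun _ => ξ m := fun m => Sec.f_ofChart ..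
  have hWU : W ≤ V ⊓ Uc e := le_inf h hW
  have hz : (z : ℂ) ∈ dom e (V ⊓ Uc e) := hWU z.2
  have hxV : x = resO k hWU (xSec k e V) := Sec.ext_of_le hW (funext fun w => by
    rw [Sec.f_res, f_xSec, hx, f_evenSec]; rfl)
  have hyV : ∀ m, y m = resO k hWU (ξSec k e V m) := fun m =>
    Sec.ext_of_le hW (funext fun w => by rw [Sec.f_res, f_ξSec, hyf])
  have hDx : (D.act h x).f e z = ∑ l, (comp e l D z).1 • quad l := by
    have hdeg : IsHomog 0 x := isHomog_of_le hW fun w => by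
      rw [hx, f_evenSec]
      have := monomials_mem ∅
      rw [monomials_empty] at this
      exact Submodule.smul_mem _ _ this
    rw [eq_sum_quad (isHomog_iff.1 (D.isHomog_act h hdeg) e z)]
    refine Finset.sum_congr rfl fun l _ => ?_
    rw [comp_apply, coeff_of_mem _ _ hz, hxV, ← VF.res_act D inf_le_left hWU, Sec.f_res]
  have hDy : ∀ m, (D.act h (y m)).f e z = (comp e m D z).2 • top m := by
    intro m
    have hdeg : IsHomog 1 (y m) := isHomog_of_le hW fun w => by
      rw [hyf]
      have := monomials_mem {m}
      rwa [monomials_singleton, Finset.card_singleton] at this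
    rw [eq_smul_top (isHomog_iff.1 (D.isHomog_act h hdeg) e z) m]
    rw [comp_apply, coeff_of_mem _ Finset.univ hz, hyV, ← VF.res_act D inf_le_left hWU, Sec.f_res]
  have hT0 : T ∅ = evenSec k e hW _ (hF ∅) := Sec.ext_of_le hW (by
    rw [hTf, f_evenSec, monomials_empty])
  have hT1 : ∀ m, T {m} = evenSec k e hW _ (hF {m}) * y m := fun m => Sec.ext_of_le hW (by
    rw [hTf, Sec.f_mul, f_evenSec, hyf, monomials_singleton]
    funext w
    simp)
  have hsum : (D.act h s).f e z = ∑ S, (D.act h (T S)).f e z := by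
    conv_lhs => rw [hs]
    rw [map_sum, Sec.f_sum, Finset.sum_apply]
  rw [hsum, sum_finset_fin_three hhigh, hT0, act_evenSec, ← hx, hDx, Finset.smul_sum,
    ← Finset.sum_add_distrib]
  refine Finset.sum_congr rfl fun l _ => ?_
  rw [hT1, VF.act_mul, Sec.f_add, Sec.f_mul, Sec.f_mul, Pi.add_apply, Pi.mul_apply, Pi.mul_apply,
    act_evenSec, ← hx, hDx, hDy, f_evenSec, hyf, fld_apply]
  simp only [smul_mul_assoc, Finset.sum_mul, quad_mul_ξ, one_mul]
  rw [Finset.sum_eq_single l (fun m _ hm => by rw [if_neg hm.symm, smul_zero]) (by simp),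
    if_pos rfl]
  module

theorem comp_eq_trAt (D : VF k V) (e : Bool) (l : Fin 3) {z : ℂ} (hz : z ∈ dom e V)
    (h0 : z ≠ 0) : comp e l D z = trAt k z (comp (!e) l D z⁻¹) := by
  refine comp_eq_of_act_eq_sum (u := fun l => trAt k z (comp (!e) l D z⁻¹)) hz (fun s => ?_) l
  set y : dom e (V ⊓ Uc e) := ⟨z, mem_dom_inf_Uc hz⟩
  rw [Sec.glue e _ y h0, act_eq_sum_fld, map_sum]
  refine Finset.sum_congr rfl fun m _ => ?_
  exact (fld_trAt k m (isOpen_dom (!e) _) (isOpen_dom e _) (fun y hy h => inv_mem_dom hy h)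
    (s.isHolo _) (s.glue e) y h0 _).symm

/-- Vector fields with the same components are equal. -/
theorem VF.ext_comp {D E : VF k V} (h : ∀ e l, ∀ z ∈ dom e V, comp e l D z = comp e l E z) :
    D = E :=
  VF.ext fun W hW s e z => by
    rw [act_eq_sum_fld, act_eq_sum_fld]
    exact Finset.sum_congr rfl fun l _ => by rw [h e l z (hW z.2)]

theorem comp_of_ne {l m : Fin 3} {D : VF k V} (hD : D ∈ T2ij k (lo l) (hi l) l V) (hm : m ≠ l)
    (e : Bool) {z : ℂ} (hz : z ∈ dom e V) : comp e m D z = 0 := by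
  have := comp_eq_of_act_eq_sum hz (D := D) (u := fun l' => if l' = l then comp e l D z else 0)
    (fun s => by
      rw [isFld_comp hD, Finset.sum_eq_single l (fun l' _ hl => by rw [if_neg hl, map_zero])
        (by simp), if_pos rfl]) m
  rwa [if_neg hm] at this

/-! ### Independence of the principal parts -/

theorem tendsto_zpow_nhds_zero {n : ℤ} (hn : 1 ≤ n) :
    Tendsto (fun y : ℂ => y ^ n) (𝓝 0) (𝓝 0) := by
  have h := (continuousAt_zpow₀ (0 : ℂ) n (Or.inr (by omega))).tendsto
  rwa [zero_zpow n (by omega)] at h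

theorem eq_zero_of_tendsto_inv {G : ℂ → ℂ} (hG : Differentiable ℂ G)
    (h : Tendsto (fun y => G y⁻¹) (𝓝[≠] 0) (𝓝 0)) : G = 0 := by
  refine hG.eq_const_of_tendsto_cocompact ?_
  rw [← Metric.cobounded_eq_cocompact]
  refine (h.comp tendsto_inv₀_cobounded').congr fun z => ?_
  rw [Function.comp_apply, inv_inv]

/-- A combination of the `yⁿ` with `1 ≤ n ≤ M` which vanishes to order `N > M` at `0` is zero. -/
theorem eq_zero_of_zpow_mul_eq_sum {ψ : ℂ → ℂ} (hψ : ContinuousAt ψ 0) {M N : ℤ} (hMN : M < N)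
    {α : ℤ → ℂ}
    (h : ∀ᶠ y in 𝓝[≠] (0 : ℂ), y ^ N * ψ y = ∑ n ∈ Finset.Icc 1 M, α n * y ^ n) :
    ∀ n ∈ Finset.Icc 1 M, α n = 0 := by
  have key : ∀ j : ℕ, ∀ n ∈ Finset.Icc 1 M, n = j → α n = 0 := by
    intro j
    induction j using Nat.strong_induction_on with
    | _ j ih =>
    intro m hm hj
    have hm' := Finset.mem_Icc.1 hm
    -- Divide by `y ^ m` and let `y` tend to `0`.
    have hR : Tendsto (fun y : ℂ => ∑ n ∈ Finset.Icc 1 M, α n * y ^ (n - m)) (𝓝[≠] 0)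
        (𝓝 (∑ n ∈ Finset.Icc 1 M, if n = m then α m else 0)) := by
      refine tendsto_finsetSum _ fun n hn => ?_
      have hn' := Finset.mem_Icc.1 hn
      rcases lt_trichotomy n m with hlt | rfl | hgt
      · have h0 := ih n.toNat (by omega) n hn (by omega)
        simp [h0, hlt.ne]
      · simp
      · rw [if_neg hgt.ne']
        have := ((tendsto_zpow_nhds_zero (n := n - m) (by omega)).const_mul (α n))
        rw [mul_zero] at this
        exact this.mono_left nhdsWithin_le_nhds
    have hL : Tendsto (fun y : ℂ => y ^ (N - m) * ψ y) (𝓝[≠] 0) (𝓝 0) := by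
      have := (tendsto_zpow_nhds_zero (n := N - m) (by omega)).mul hψ.tendsto
      rw [zero_mul] at this
      exact this.mono_left nhdsWithin_le_nhds
    rw [Finset.sum_ite_eq' , if_pos hm] at hR
    refine tendsto_nhds_unique hR (hL.congr' ?_)
    filter_upwards [h, self_mem_nhdsWithin] with y hy hy0
    have hy0 : y ≠ 0 := hy0
    simp only [zpow_sub₀ hy0, ← mul_div_assoc, ← Finset.sum_div]
    rw [← hy, div_mul_eq_mul_div]
  exact fun n hn => key n.toNat n hn (by have := Finset.mem_Icc.1 hn; omega)

/-- The `x⁻ⁿ` with `1 ≤ n ≤ M < N` are independent modulo entire functions and functions which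
vanish to order `N` at infinity. -/
theorem eq_zero_of_zpow_mul_eq_add_sum {G ψ : ℂ → ℂ} (hG : Differentiable ℂ G)
    (hψ : ContinuousAt ψ 0) {M N : ℤ} (hMN : M < N) (hN : 1 ≤ N) {α : ℤ → ℂ}
    (h : ∀ᶠ y in 𝓝[≠] (0 : ℂ), y ^ N * ψ y = G y⁻¹ + ∑ n ∈ Finset.Icc 1 M, α n * y ^ n) :
    G = 0 ∧ ∀ n ∈ Finset.Icc 1 M, α n = 0 := by
  have hG0 : G = 0 := by
    refine eq_zero_of_tendsto_inv hG ?_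
    have hL : Tendsto (fun y : ℂ => y ^ N * ψ y) (𝓝[≠] 0) (𝓝 0) := by
      have := (tendsto_zpow_nhds_zero hN).mul hψ.tendsto
      rw [zero_mul] at this
      exact this.mono_left nhdsWithin_le_nhds
    have hR : Tendsto (fun y : ℂ => ∑ n ∈ Finset.Icc 1 M, α n * y ^ n) (𝓝[≠] 0) (𝓝 0) := by
      have : Tendsto (fun y : ℂ => ∑ n ∈ Finset.Icc 1 M, α n * y ^ n) (𝓝 0)
          (𝓝 (∑ n ∈ Finset.Icc 1 M, α n * 0)) := tendsto_finsetSum _ fun n hn =>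
        (tendsto_zpow_nhds_zero (Finset.mem_Icc.1 hn).1).const_mul _
      simp only [mul_zero, Finset.sum_const_zero] at this
      exact this.mono_left nhdsWithin_le_nhds
    have := hL.sub hR
    rw [sub_zero] at this
    refine this.congr' ?_
    filter_upwards [h] with y hy
    rw [hy, add_sub_cancel_right]
  refine ⟨hG0, eq_zero_of_zpow_mul_eq_sum hψ hMN ?_⟩
  filter_upwards [h] with y hy
  rw [hy, hG0, Pi.zero_apply, zero_add]

/-- A principal part which is the difference of sections of the rank 2 bundle over `U₀` and over a
neighbourhood of infinity is zero. -/
theorem eq_zero_of_trAt_eq {k : ℤ} (hk : 2 ≤ k) {G φ : ℂ → ℂ × ℂ} (hG : Differentiable ℂ G)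
    (hφ : ContinuousAt φ 0) {α β : ℤ → ℂ}
    (h : ∀ᶠ y in 𝓝[≠] (0 : ℂ), φ y = trAt k y (G y⁻¹ +
      (∑ n ∈ Finset.Icc 1 (2 * k - 3), α n * y ^ n,
        ∑ n ∈ Finset.Icc 1 (2 * k - 1), β n * y ^ n))) :
    (∀ n ∈ Finset.Icc 1 (2 * k - 3), α n = 0) ∧ ∀ n ∈ Finset.Icc 1 (2 * k - 1), β n = 0 := by
  have hinv : ∀ {y : ℂ}, y ≠ 0 → ∀ m : ℤ, y ^ (-m) * y ^ m = 1 := fun hy m => by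
    rw [← zpow_add₀ hy, neg_add_cancel, zpow_zero]
  obtain ⟨h1, hα⟩ := eq_zero_of_zpow_mul_eq_add_sum (ψ := fun y => -(φ y).1) hG.fst hφ.fst.neg
    (M := 2 * k - 3) (N := 2 * k - 2) (by omega) (by omega) (α := α) (by
      filter_upwards [h, self_mem_nhdsWithin] with y hy hy0
      have e := hinv hy0 (2 * k - 2)
      rw [neg_sub] at e
      rw [hy, trAt_apply, Prod.fst_add]
      linear_combination ((G y⁻¹).1 + ∑ n ∈ Finset.Icc 1 (2 * k - 3), α n * y ^ n) * e)
  refine ⟨hα, (eq_zero_of_zpow_mul_eq_add_sum (ψ := fun y => (φ y).2) hG.snd hφ.snd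
    (M := 2 * k - 1) (N := 2 * k) (by omega) (by omega) (α := β) ?_).2⟩
  filter_upwards [h, self_mem_nhdsWithin] with y hy hy0
  have e := hinv hy0 (2 * k)
  have hs : ∑ n ∈ Finset.Icc 1 (2 * k - 3), α n * y ^ n = 0 :=
    Finset.sum_eq_zero fun n hn => by rw [hα n hn, zero_mul]
  have hg : (G y⁻¹).1 = 0 := congrFun h1 y⁻¹
  rw [hy, trAt_apply, Prod.fst_add, Prod.snd_add, hg, hs]
  rw [← neg_mul] at e
  linear_combination ((G y⁻¹).2 + ∑ n ∈ Finset.Icc 1 (2 * k - 1), β n * y ^ n) * e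

/-! ### Cohomology of the sheaves of vector fields -/

/-- Inside one chart, the components of a vector field are arbitrary holomorphic functions. -/
theorem exists_vectorField_of_le (l : Fin 3) {e : Bool} (hV : V ≤ Uc e) {u : ℂ → ℂ × ℂ}
    (hu : DifferentiableOn ℂ u (dom e V)) :
    ∃ D : T2ij k (lo l) (hi l) l V, IsFld e l D.1 u := by
  let v : Bool → ℂ → ℂ × ℂ := fun e' => if e' = e then u else fun z => trAt k z (u z⁻¹)
  have hve : v e = u := if_pos rfl
  have hvn : v (!e) = fun z => trAt k z (u z⁻¹) := if_neg (Bool.not_ne_self e)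
  obtain ⟨D, hD⟩ := exists_vectorField (k := k) (V := V) l v (fun e' => by
      rcases eq_or_ne e' e with rfl | he
      · rwa [hve]
      · obtain rfl := bool_eq_not he
        rw [hvn]
        intro z hz
        have h0 := ne_zero_of_le_Uc hV hz
        exact (differentiableAt_trAt k h0 (hu.differentiableAt
          ((isOpen_dom e V).mem_nhds (inv_mem_dom' hz h0)))).differentiableWithinAt) (by
      intro z hz h0
      cases e with
      | false =>
        rw [hve]
        exact congrFun hvn z
      | true =>
        rw [hve, show v false = _ from hvn]
        simp only [inv_inv]
        rw [trAt_trAt_inv k h0])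
  refine ⟨D, ?_⟩
  have := hD e
  rwa [hve] at this

/-- A section of `𝒯₂` as a vector field. -/
noncomputable def ofT2 : (sheafT2 k).obj (op V) →ₗ[ℂ] VF k V := LinearMap.id

theorem ofT2_res (h : W ≤ V) (s : (sheafT2 k).obj (op V)) :
    ofT2 (Cech.res _ h s) = resVF k h (ofT2 s) := rfl

theorem ext_comp_ofT2 {s t : (sheafT2 k).obj (op V)}
    (h : ∀ e l, ∀ z ∈ dom e V, comp e l (ofT2 s) z = comp e l (ofT2 t) z) : s = t :=
  VF.ext_comp h

theorem exists_ofT2_eq (D : VF k V) : ∃ s : (sheafT2 k).obj (op V), ofT2 s = D := ⟨D, rfl⟩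

/-- The components of a cocycle of vector fields satisfy the hypotheses of `exists_primitive`. -/
theorem exists_primitive_comp {U : CP1 → Opens CP1} (hU : ∀ p, p ∈ U p)
    (c : ∀ p q, VF k (U p ⊓ U q))
    (hc : ∀ p q r,
      resVF k (V' := U p ⊓ U q ⊓ U r) inf_le_left (c p q) +
        resVF k (V' := U p ⊓ U q ⊓ U r) (inf_le_inf_right _ inf_le_right) (c q r) =
        resVF k (V' := U p ⊓ U q ⊓ U r) (inf_le_inf_right _ inf_le_left) (c p r)) (l : Fin 3) :
    ∃ (P : ℂ → ℂ × ℂ) (g : Bool → CP1 → ℂ → ℂ × ℂ), IsPrincipal k P ∧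
      (∀ e p, DifferentiableOn ℂ (g e p) (dom e (U p))) ∧
      (∀ e p q, ∀ z ∈ dom e (U p ⊓ U q), g e q z - g e p z = comp e l (c p q) z) ∧
      ∀ p, ∀ z ∈ dom false (U p), z ≠ 0 → g false p z = trAt k z (g true p z⁻¹) + P z := by
  refine exists_primitive k (fun p => ⟨p, hU p⟩) (c := fun e p q => comp e l (c p q))
    (fun e p q => differentiableOn_comp e l _) (fun e p q r z hz => ?_)
    (fun e p q z hz h0 => comp_eq_trAt _ e l hz h0)
  have := congrFun (congrArg (comp e l) (hc p q r)) z
  rwa [map_add, Pi.add_apply, comp_res e l _ _ hz, comp_res e l _ _ hz,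
    comp_res e l _ _ hz] at this

theorem subsingleton_H1_sheafT2 (hk : k < 2) : Subsingleton (Cech.H1 (sheafT2 k)) := by
  refine subsingleton_of_forall_eq 0 fun w => ?_
  obtain ⟨U, c, rfl⟩ := Cech.exists_mkClass _ w
  choose P g hP hg hgc ht using exists_primitive_comp (k := k) U.mem (fun p q => ofT2 (c.1 p q))
    (fun p q r => congrArg ofT2 (c.2 p q r))
  have hP0 : ∀ l, P l = 0 := fun l => (hP l).2 hk
  have hex : ∀ l p, ∃ D : T2ij k (lo l) (hi l) l (U.nhd p),
      ∀ e, IsFld e l D.1 (g l e p) := fun l p =>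
    exists_vectorField l (fun e => g l e p) (fun e => hg l e p) fun z hz h0 => by
      have := ht l p z⁻¹ (inv_mem_dom hz h0) (inv_ne_zero h0)
      rw [this, hP0, inv_inv, Pi.zero_apply, add_zero, trAt_trAt_inv k h0]
  choose D hD using hex
  choose b hbD using fun p => exists_ofT2_eq (∑ l, (D l p).1)
  have hb : ∀ e l p, ∀ z ∈ dom e (U.nhd p), comp e l (ofT2 (b p)) z = g l e p z := by
    intro e l p z hz
    rw [hbD, map_sum, Finset.sum_apply, Finset.sum_eq_single l
      (fun m _ hm => comp_of_ne (D m p).2 hm.symm e hz) (by simp), (hD l p e).comp_eq hz]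
  have hcb : c = Cech.d0 (sheafT2 k) U.nhd b := Cech.Z1.ext _ fun p q =>
    ext_comp_ofT2 fun e l z hz => by
      rw [Cech.d0_apply, map_sub, map_sub, Pi.sub_apply, ofT2_res, ofT2_res, comp_res e l _ _ hz,
        comp_res e l _ _ hz, hb e l q z hz.2, hb e l p z hz.1, hgc l e p q z hz]
  rw [hcb, Cech.mkClass_d0]

variable {l : Fin 3}

/-- A section of `𝒯₂^{ij}` as a vector field. -/
noncomputable def toVF : (sheafT2ij k (lo l) (hi l) l).obj (op V) →ₗ[ℂ] VF k V :=
  (T2ij k (lo l) (hi l) l V).subtype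

theorem toVF_injective : Function.Injective (toVF (k := k) (V := V) (l := l)) :=
  Subtype.val_injective

theorem toVF_mem (s : (sheafT2ij k (lo l) (hi l) l).obj (op V)) :
    toVF s ∈ T2ij k (lo l) (hi l) l V :=
  Subtype.property (p := (· ∈ T2ij k (lo l) (hi l) l V)) s

/-- The components in the chart `e` of a section of `𝒯₂^{ij}`. -/
noncomputable def cmp (e : Bool) :
    (sheafT2ij k (lo l) (hi l) l).obj (op V) →ₗ[ℂ] ℂ → ℂ × ℂ :=
  comp e l ∘ₗ toVF

theorem cmp_res (e : Bool) (h : W ≤ V) (s : (sheafT2ij k (lo l) (hi l) l).obj (op V)) {z : ℂ}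
    (hz : z ∈ dom e W) : cmp e (Cech.res _ h s) z = cmp e s z :=
  comp_res e l h (toVF s) hz

theorem differentiableOn_cmp (e : Bool) (s : (sheafT2ij k (lo l) (hi l) l).obj (op V)) :
    DifferentiableOn ℂ (cmp e s) (dom e V) :=
  differentiableOn_comp e l _

theorem cmp_eq_trAt (e : Bool) (s : (sheafT2ij k (lo l) (hi l) l).obj (op V)) {z : ℂ}
    (hz : z ∈ dom e V) (h0 : z ≠ 0) : cmp e s z = trAt k z (cmp (!e) s z⁻¹) :=
  comp_eq_trAt _ e l hz h0

/-- Sections of `𝒯₂^{ij}` are determined by their components on `U₀ ∩ U₁`. -/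
theorem ext_cmp {s t : (sheafT2ij k (lo l) (hi l) l).obj (op V)}
    (h : ∀ z ∈ dom false V, z ≠ 0 → cmp false s z = cmp false t z) : s = t := by
  have hne : ∀ e, ∀ z ∈ dom e V, z ≠ 0 → cmp e s z = cmp e t z := by
    rintro (_ | _) z hz h0
    · exact h z hz h0
    · rw [cmp_eq_trAt true s hz h0, cmp_eq_trAt true t hz h0]
      exact congrArg _ (h z⁻¹ (inv_mem_dom hz h0) (inv_ne_zero h0))
  refine toVF_injective (VF.ext_comp fun e m z hz => ?_)
  rcases eq_or_ne m l with rfl | hm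
  · rcases eq_or_ne z 0 with rfl | h0
    · have hd := fun s : (sheafT2ij k (lo m) (hi m) m).obj (op V) =>
        ((differentiableOn_cmp e s).differentiableAt
          ((isOpen_dom e V).mem_nhds hz)).continuousAt.tendsto.mono_left
            (nhdsWithin_le_nhds (s := {0}ᶜ))
      refine tendsto_nhds_unique (hd s) ((hd t).congr' ?_)
      filter_upwards [nhdsWithin_le_nhds ((isOpen_dom e V).mem_nhds hz), self_mem_nhdsWithin]
        with w hw hw0
      exact (hne e w hw hw0).symm
    · exact hne e z hz h0
  · rw [comp_of_ne (toVF_mem s) hm e hz, comp_of_ne (toVF_mem t) hm e hz]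

theorem exists_section_of_le (l : Fin 3) {e : Bool} (hV : V ≤ Uc e) {u : ℂ → ℂ × ℂ}
    (hu : DifferentiableOn ℂ u (dom e V)) :
    ∃ s : (sheafT2ij k (lo l) (hi l) l).obj (op V),
      IsFld e l (toVF s) u ∧ ∀ z ∈ dom e V, cmp e s z = u z := by
  obtain ⟨D, hD⟩ := exists_vectorField_of_le (k := k) l hV hu
  exact ⟨D, hD, fun z hz => hD.comp_eq hz⟩

/-- The factors `i`, `j` say whether the respective member of the cover is `U₁`. -/
theorem cmp_pairCochain (s : (sheafT2ij k (lo l) (hi l) l).obj (op (stdCover 0 ⊓ stdCover 1)))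
    (i j : Fin 2) {z : ℂ} (hz : z ∈ dom false (stdCover i ⊓ stdCover j)) :
    cmp false (Cech.pairCochain _ stdCover s i j) z =
      (j.val : ℂ) • cmp false s z - (i.val : ℂ) • cmp false s z := by
  match i, j with
  | 0, 0 => simp [Cech.pairCochain]
  | 0, 1 => simp [Cech.pairCochain]
  | 1, 0 =>
    have := cmp_res false (le_of_eq (inf_comm _ _)) s hz
    simp [Cech.pairCochain, this]
  | 1, 1 => simp [Cech.pairCochain]

/-- Every class is represented by a cocycle of the standard cover with principal components. -/
theorem exists_classOf_eq (w : Cech.H1 (sheafT2ij k (lo l) (hi l) l)) :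
    ∃ (P : ℂ → ℂ × ℂ) (s : (sheafT2ij k (lo l) (hi l) l).obj (op (stdCover 0 ⊓ stdCover 1))),
      IsPrincipal k P ∧ (∀ z ∈ dom false (stdCover 0 ⊓ stdCover 1), cmp false s z = P z) ∧
      w = Cech.classOf _ stdCover stdIndex stdIndex_mem (Cech.pairZ1 _ stdCover s) := by
  obtain ⟨U, c, rfl⟩ := Cech.exists_mkClass _ w
  obtain ⟨P, g, hP, hg, hgc, ht⟩ := exists_primitive_comp (k := k) U.mem
    (fun p q => toVF (c.1 p q)) (fun p q r => congrArg toVF (c.2 p q r)) l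
  have h0 : ∀ z ∈ dom false (stdCover 0 ⊓ stdCover 1), z ≠ 0 := fun z hz =>
    ne_zero_of_le_Uc (e := true) (inf_le_right : stdCover 0 ⊓ stdCover 1 ≤ U1) hz
  obtain ⟨s, -, hs⟩ := exists_section_of_le (k := k) l (e := false)
    (inf_le_left : stdCover 0 ⊓ stdCover 1 ≤ U0)
    (fun z hz => (hP.differentiableAt (h0 z hz)).differentiableWithinAt)
  -- Inside `U₁` the primitive of the chart at infinity is used, which differs by `P`.
  have hβ : ∀ p (i : Fin 2), ∃ β : (sheafT2ij k (lo l) (hi l) l).obj (op (U.nhd p ⊓ stdCover i)),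
      ∀ z ∈ dom false (U.nhd p ⊓ stdCover i), z ≠ 0 →
        cmp false β z = g false p z - (i.val : ℂ) • P z := by
    intro p i
    match i with
    | 0 =>
      obtain ⟨β, -, hβ⟩ := exists_section_of_le (k := k) l (e := false)
        (inf_le_right : U.nhd p ⊓ stdCover 0 ≤ U0) ((hg false p).mono fun z hz => hz.1)
      exact ⟨β, fun z hz _ => by rw [hβ z hz]; simp⟩
    | 1 =>
      obtain ⟨β, -, hβ⟩ := exists_section_of_le (k := k) l (e := true)
        (inf_le_right : U.nhd p ⊓ stdCover 1 ≤ U1) ((hg true p).mono fun z hz => hz.1)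
      refine ⟨β, fun z hz hz0 => ?_⟩
      rw [cmp_eq_trAt false β hz hz0, Bool.not_false, hβ _ (inv_mem_dom hz hz0),
        ht p z hz.1 hz0]
      simp
  choose β hβ using hβ
  refine ⟨P, s, hP, hs, Cech.mkClass_eq_classOf _ c stdCover stdIndex stdIndex_mem _
    (fun p => β p (stdIndex p)) fun p q => ext_cmp fun z hz hz0 => ?_⟩
  have hzp : z ∈ dom false (U.nhd p ⊓ stdCover (stdIndex p)) := hz.1
  have hzq : z ∈ dom false (U.nhd q ⊓ stdCover (stdIndex q)) := hz.2
  have hz01 : z ∈ dom false (stdCover 0 ⊓ stdCover 1) :=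
    ⟨chart_mem_Uc false z, by
      change chart false z ∈ Uc true
      rw [chart_eq false hz0]
      exact chart_mem_Uc true _⟩
  have hgz := hgc false p q z ⟨hzp.1, hzq.1⟩
  have hcz : comp false l (toVF (c.1 p q)) z = cmp false (c.1 p q) z := rfl
  rw [map_sub, map_sub, Pi.sub_apply, Pi.sub_apply, cmp_res false _ _ hz, cmp_res false _ _ hz,
    cmp_res false _ _ hz, cmp_res false _ _ hz, hβ p _ z hzp hz0, hβ q _ z hzq hz0,
    Cech.pairZ1_apply, cmp_pairCochain s _ _ ⟨hzp.2, hzq.2⟩, hs z hz01, ← hcz, ← hgz]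
  abel

/-- Cocycles of the standard cover with different principal components are not cohomologous. -/
theorem eq_zero_of_classOf_eq_zero (hk : 2 ≤ k) {α β : ℤ → ℂ}
    {s : (sheafT2ij k (lo l) (hi l) l).obj (op (stdCover 0 ⊓ stdCover 1))}
    (hs : ∀ z ∈ dom false (stdCover 0 ⊓ stdCover 1), cmp false s z =
      (∑ n ∈ Finset.Icc 1 (2 * k - 3), α n * z ^ (-n),
        ∑ n ∈ Finset.Icc 1 (2 * k - 1), β n * z ^ (-n)))
    (h : Cech.classOf _ stdCover stdIndex stdIndex_mem (Cech.pairZ1 _ stdCover s) = 0) :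
    (∀ n ∈ Finset.Icc 1 (2 * k - 3), α n = 0) ∧ ∀ n ∈ Finset.Icc 1 (2 * k - 1), β n = 0 := by
  obtain ⟨V, hV, b, hb⟩ := Cech.exists_of_classOf_eq_zero _ stdCover stdIndex stdIndex_mem _ h
  have hbz : ∀ p q, ∀ z ∈ dom false (V.nhd p ⊓ V.nhd q),
      cmp false (b q) z - cmp false (b p) z =
        ((stdIndex q).val : ℂ) • cmp false s z - ((stdIndex p).val : ℂ) • cmp false s z := by
    intro p q z hz
    have := congrFun (congrArg (cmp false) (hb p q)) z
    rwa [map_sub, Pi.sub_apply, cmp_res false _ _ hz, cmp_res false _ _ hz, cmp_res false _ _ hz,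
      Cech.pairZ1_apply, cmp_pairCochain s _ _ ⟨hV p hz.1, hV q hz.2⟩] at this
  have h0 : ∀ z, stdIndex (chart false z) = 0 := fun z => rfl
  have h1 : stdIndex (chart true 0) = 1 := by
    rw [show chart true 0 = (∞ : OnePoint ℂ) by simp [chart, chart1]]
    rfl
  -- The local sections at the points of `U₀` agree, and so define an entire function.
  have hG : Differentiable ℂ fun z => cmp false (b (chart false z)) z := by
    intro z
    have hz : z ∈ dom false (V.nhd (chart false z)) := V.mem _
    refine ((differentiableOn_cmp false (b (chart false z))).differentiableAt
      ((isOpen_dom false _).mem_nhds hz)).congr_of_eventuallyEq ?_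
    filter_upwards [(isOpen_dom false _).mem_nhds hz] with w hw
    have := hbz (chart false z) (chart false w) w ⟨hw, V.mem _⟩
    rw [h0, h0, sub_self] at this
    exact sub_eq_zero.1 this
  have hz1 : (0 : ℂ) ∈ dom true (V.nhd (chart true 0)) := V.mem _
  have hnb := (isOpen_dom true (V.nhd (chart true 0))).mem_nhds hz1
  refine eq_zero_of_trAt_eq hk hG (φ := cmp true (b (chart true 0)))
    ((differentiableOn_cmp true _).differentiableAt hnb).continuousAt ?_
  filter_upwards [nhdsWithin_le_nhds hnb, self_mem_nhdsWithin] with y hy hy0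
  have hy0 : y ≠ 0 := hy0
  have hy' : y⁻¹ ∈ dom false (V.nhd (chart true 0)) := inv_mem_dom hy hy0
  have hyy : y⁻¹ ∈ dom false (V.nhd (chart false y⁻¹)) := V.mem _
  have := hbz (chart false y⁻¹) (chart true 0) y⁻¹ ⟨hyy, hy'⟩
  have hi1 := hV _ hy'
  rw [h1] at hi1
  rw [h0, h1, hs _ ⟨hV _ hyy, hi1⟩] at this
  rw [cmp_eq_trAt true _ hy hy0, Bool.not_true]
  congr 1
  simp only [zpow_neg, inv_zpow, inv_inv] at this
  rw [← sub_eq_iff_eq_add', this]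
  simp

/-! ### The basis -/

theorem sum_Icc_eq (a b : ℤ) (f : ℤ → ℂ) :
    ∑ n ∈ Finset.Icc a b, f n = ∑ n : Set.Icc a b, f n :=
  Finset.sum_subtype _ (fun _ => Finset.mem_Icc) f

theorem exists_basis (hk : 2 ≤ k) (l : Fin 3) :
    ∃ B : Module.Basis (Set.Icc (1 : ℤ) (2 * k - 3) ⊕ Set.Icc (1 : ℤ) (2 * k - 1)) ℂ
        (Cech.H1 (sheafT2ij k (lo l) (hi l) l)),
      (∀ n, IsClassOf k (lo l) (hi l) l (B (Sum.inl n)) (fun x => x ^ (-n.1)) 0) ∧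
      (∀ n, IsClassOf k (lo l) (hi l) l (B (Sum.inr n)) 0 (fun x => x ^ (-n.1))) := by
  have h0 : ∀ z ∈ dom false (stdCover 0 ⊓ stdCover 1), z ≠ 0 := fun z hz =>
    ne_zero_of_le_Uc (e := true) (inf_le_right : stdCover 0 ⊓ stdCover 1 ≤ U1) hz
  have hp : ∀ m : ℤ, DifferentiableOn ℂ (fun z : ℂ => z ^ m)
      (dom false (stdCover 0 ⊓ stdCover 1)) := fun m z hz =>
    (differentiableAt_zpow.2 (Or.inl (h0 z hz))).differentiableWithinAt
  have hle : stdCover 0 ⊓ stdCover 1 ≤ Uc false := inf_le_left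
  choose s hsF hs using fun n : ℤ => exists_section_of_le (k := k) l hle
    ((hp (-n)).prodMk (differentiableOn_const (c := (0 : ℂ))))
  choose t htF ht using fun n : ℤ => exists_section_of_le (k := k) l hle
    ((differentiableOn_const (c := (0 : ℂ))).prodMk (hp (-n)))
  let cl := Cech.classOf (sheafT2ij k (lo l) (hi l) l) stdCover stdIndex stdIndex_mem ∘ₗ
    Cech.pairZ1 _ stdCover
  let σ : Set.Icc (1 : ℤ) (2 * k - 3) ⊕ Set.Icc (1 : ℤ) (2 * k - 1) →
      (sheafT2ij k (lo l) (hi l) l).obj (op (stdCover 0 ⊓ stdCover 1)) :=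
    Sum.elim (fun n => s n) (fun n => t n)
  have hσ : ∀ (γ : Set.Icc (1 : ℤ) (2 * k - 3) ⊕ Set.Icc (1 : ℤ) (2 * k - 1) → ℂ) (α β : ℤ → ℂ),
      (∀ n, γ (Sum.inl n) = α n) → (∀ n, γ (Sum.inr n) = β n) →
      ∀ z ∈ dom false (stdCover 0 ⊓ stdCover 1), cmp false (∑ i, γ i • σ i) z =
        (∑ n ∈ Finset.Icc 1 (2 * k - 3), α n * z ^ (-n),
          ∑ n ∈ Finset.Icc 1 (2 * k - 1), β n * z ^ (-n)) := by
    intro γ α β hα hβ z hz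
    rw [map_sum, Finset.sum_apply, Fintype.sum_sum_type, sum_Icc_eq, sum_Icc_eq]
    simp only [map_smul, Pi.smul_apply, hα, hβ, σ, Sum.elim_inl, Sum.elim_inr, hs _ z hz,
      ht _ z hz]
    ext
    · simp [Prod.fst_sum]
    · simp [Prod.snd_sum]
  have hcl : ∀ γ : Set.Icc (1 : ℤ) (2 * k - 3) ⊕ Set.Icc (1 : ℤ) (2 * k - 1) → ℂ,
      cl (∑ i, γ i • σ i) = ∑ i, γ i • cl (σ i) := fun γ => by
    rw [map_sum]
    simp only [map_smul]
  have hli : LinearIndependent ℂ fun i => cl (σ i) := by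
    refine Fintype.linearIndependent_iff.2 fun γ hγ => ?_
    rw [← hcl] at hγ
    obtain ⟨hα, hβ⟩ := eq_zero_of_classOf_eq_zero hk (hσ γ
      (fun n => if h : n ∈ Set.Icc (1 : ℤ) (2 * k - 3) then γ (Sum.inl ⟨n, h⟩) else 0)
      (fun n => if h : n ∈ Set.Icc (1 : ℤ) (2 * k - 1) then γ (Sum.inr ⟨n, h⟩) else 0)
      (fun n => by rw [dif_pos n.2]) (fun n => by rw [dif_pos n.2])) hγ
    rintro (n | n)
    · have := hα n (Finset.mem_Icc.2 n.2)
      rwa [dif_pos n.2] at this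
    · have := hβ n (Finset.mem_Icc.2 n.2)
      rwa [dif_pos n.2] at this
  have hsp : ⊤ ≤ Submodule.span ℂ (Set.range fun i => cl (σ i)) := by
    intro w _
    obtain ⟨P, D, hP, hD, rfl⟩ := exists_classOf_eq w
    obtain ⟨c, d, hcd⟩ := hP.1 hk
    have hDs : D = ∑ i, Sum.elim (fun n => c n.1) (fun n => d n.1) i • σ i :=
      ext_cmp fun z hz _ => by
        rw [hD z hz, hcd, hσ _ c d (fun _ => rfl) (fun _ => rfl) z hz]
    have : cl D = _ := (congrArg cl hDs).trans (hcl _)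
    change cl D ∈ _
    rw [this]
    exact Submodule.sum_mem _ fun i _ => Submodule.smul_mem _ _
      (Submodule.subset_span ⟨i, rfl⟩)
  refine ⟨Module.Basis.mk hli hsp, fun n => ?_, fun n => ?_⟩
  · exact ⟨Cech.pairZ1 _ stdCover (s n), s n, rfl, isField0_iff.2 (hsF n),
      Module.Basis.mk_apply hli hsp _⟩
  · exact ⟨Cech.pairZ1 _ stdCover (t n), t n, rfl, isField0_iff.2 (htF n),
      Module.Basis.mk_apply hli hsp _⟩

end SuperP1

theorem corollary1 (k : ℤ) :
    (2 ≤ k → ∀ i j l : Fin 3, i < j → l ≠ i → l ≠ j →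
      ∃ B : Module.Basis (Set.Icc (1 : ℤ) (2 * k - 3) ⊕ Set.Icc (1 : ℤ) (2 * k - 1)) ℂ
          (Cech.H1 (SuperP1.sheafT2ij k i j l)),
        (∀ n, SuperP1.IsClassOf k i j l (B (Sum.inl n)) (fun x => x ^ (-n.1)) 0) ∧
        (∀ n, SuperP1.IsClassOf k i j l (B (Sum.inr n)) 0 (fun x => x ^ (-n.1)))) ∧
    (k < 2 → Subsingleton (Cech.H1 (SuperP1.sheafT2 k))) := by
  refine ⟨fun hk i j l hij hi hj => ?_, SuperP1.subsingleton_H1_sheafT2⟩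
  obtain ⟨rfl, rfl⟩ := SuperP1.eq_lo_hi hij hi hj
  exact SuperP1.exists_basis hk l
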